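/- Notation. $\langle f,g\rangle=\int_{\mathbb R}fg\,dx$, $\|f\|=\langle f,f\rangle^{1/2}$; to *orthonormalize* a list of functions means to apply the Gram--Schmidt process in the given order, with normalization. A cubic spline is a function that, off finitely many knots, is on each interval a polynomial of degree at most $3$. Construction. Let $\xi_1(x)=(1-|x|)^2(1+2|x|)$ and $\xi_2(x)=(1-|x|)^2x$ for $|x|\le 1$, both zero elsewhere, and $\xi_{j,2k+l-1}(x)=2^{j/2}\xi_l(2^jx-k)$, $l=1,2$. *Scaling generators.* Put $\phi_1=\xi_{1,2}/\|\xi_{1,2}\|$, $\phi_2=\xi_{1,3}/\|\xi_{1,3}\|$. Let $\mathbf b^1,\dots,\mathbf b^4$ be a basis of the null space of the $2\times 6$ matrix $C_{ij}=\langle\xi_{1,i+1},\xi_{2,j+1}\rangle$, let $w_i=\sum_{j=1}^6 b^i_j\xi_{2,j+1}$, and orthonormalize $w_1,\dots,w_4$ to $v_1,\dots,v_4$. Let $c_i=\xi_{1,i-1}\chi_{[0,1]}-\sum_{m=1}^2\langle\xi_{1,i-1}\chi_{[0,1]},\phi_m\rangle\phi_m$ for $i=1,2$ and $c_i=\xi_{1,i+1}\chi_{[0,1]}-\sum_{m=1}^2\langle\xi_{1,i+1}\chi_{[0,1]},\phi_m\rangle\phi_m$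 for $i=3,4$. Let $\phi_3=\sum_{j=1}^4 s_{1,j}v_j$, $\phi_4=\sum_{j=1}^4 s_{2,j}v_j$, where the real numbers $s_{i,j}$ satisfy $\sum_j s_{i,j}^2=1$ $(i=1,2)$, $\sum_j s_{1,j}s_{2,j}=0$ and $$\Big\langle c_i-\sum_{m=3}^4\langle c_i,\phi_m\rangle\phi_m,\; c_k-\sum_{m=3}^4\langle c_k,\phi_m\rangle\phi_m\Big\rangle=0,\qquad i=1,2,\; k=3,4 .$$ Let $\phi_5=g_5/\|g_5\|$, $\phi_6=g_6/\|g_6\|$ with $$g_5=\xi_{1,0}-\sum_{j=1}^4\langle\xi_{1,0},\phi_j\rangle\phi_j-\sum_{j=1}^4\langle\xi_{1,0},\phi_j(\cdot+1)\rangle\phi_j(\cdot+1),$$ $$g_6=\xi_{1,1}-\sum_{j=1}^5\langle\xi_{1,1},\phi_j\rangle\phi_j-\sum_{j=1}^5\langle\xi_{1,1},\phi_j(\cdot+1)\rangle\phi_j(\cdot+1).$$ For $j,k\in\mathbb Z$ let $\phi_{j,6k+l}(x)=2^{j/2}\phi_l(2^jx-k)$ for $l=1,\dots,4$ and $\phi_{j,6k+l}(x)=2^{j/2}\phi_l(2^jx-k-1)$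 for $l=5,6$. *Wavelet generators.* Let $p_k=\phi_k(2\,\cdot)$ for $k=1,\dots,4$, $p_{k+4}=\phi_k(2\cdot-1)$ for $k=1,\dots,6$, and $q_i=\phi_i$ for $i=1,\dots,6$, $q_{i+2}=\phi_i(\cdot-1)$ for $i=5,6$. Take a basis of two vectors $\mathbf b^1,\mathbf b^2$ of the space of all $\mathbf b\in\mathbb R^{10}$ with $\sum_j b_j\langle p_j,q_i\rangle=0$ for $i=1,\dots,8$, let $u_i=\sum_{j=1}^{10}b^i_jp_j$, and orthonormalize $u_1,u_2$ to $\psi_1,\psi_2$. Let $h_i=\phi_{i+4}(2\,\cdot)-\sum_{m=5}^6\langle\phi_{i+4}(2\,\cdot),\phi_m\rangle\phi_m$, $i=1,2$, and orthonormalize $h_1,h_2$ to $\psi_3,\psi_4$. Take a basis of two vectors $\mathbf b^1,\mathbf b^2$ of the space of all $\mathbf b=(b_k)_{k=-11}^{10}$ for which $\sum_{k} b_k\phi_{1,k}$ is orthogonal to $\phi_{0,k}$ $(-7\le k\le 6)$, $\psi_1(\cdot+1)$, $\psi_2(\cdot+1)$ and $\psi_1,\dots,\psi_4$; let $z_i=\sum_{k=-11}^{10}b^i_k\phi_{1,k}$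 and orthonormalize $z_1,z_2$ to $\psi_5,\psi_6$. For $j,k\in\mathbb Z$ let $\psi_{j,6k+l}(x)=2^{j/2}\psi_l(2^jx-k)$ for $l=1,2$ and $\psi_{j,6k+l}(x)=2^{j/2}\psi_l(2^jx-k-1)$ for $l=3,\dots,6$. **Theorem.** The free data (the coefficients $s_{i,j}$ and the bases of the three null spaces, of the stated sizes) can be chosen as required. For every such choice: a) The generators $\psi_i$, $i=1,\dots,6$, and the wavelets $\psi_{j,k}$, $j,k\in\mathbb Z$, are cubic splines belonging to $C^1(\mathbb R)$. b) For $i,j=1,\dots,6$: $\langle\phi_i,\phi_j\rangle=\delta_{i,j}$, $\langle\psi_i,\psi_j\rangle=\delta_{i,j}$, $\langle\phi_i,\psi_j\rangle=0$. c) All $\phi_{j,k}$ and $\psi_{j,k}$, $j,k\in\mathbb Z$, belong to $L^2(\mathbb R)$. For $i,j,k,l\in\mathbb Z$: $\langle\phi_{i,k},\phi_{i,l}\rangle=\delta_{k,l}$, $\langle\psi_{i,k},\psi_{j,l}\rangle=\delta_{i,j}\delta_{k,l}$, and $\langle\phi_{i,k},\psi_{j,l}\rangle=0$ if $i\le j$.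 d) The wavelets have four vanishing moments: for all $j,k\in\mathbb Z$ and every polynomial $p$ of degree less than $4$, $p\,\psi_{j,k}$ is integrable and $\int_{\mathbb R}p\,\psi_{j,k}\,dx=0$. e) The family $\Psi=\{\phi_{0,k}:k\in\mathbb Z\}\cup\{\psi_{j,k}:j\ge 0,\ k\in\mathbb Z\}$ is an orthonormal (Hilbert) basis of $L^2(\mathbb R)$. f) $\operatorname{diam}\operatorname{supp}\phi_{0,k}\le 2$ for $k\in\mathbb Z$ and $\operatorname{diam}\operatorname{supp}\psi_{j,k}\le 2^{1-j}$ for $j,k\in\mathbb Z$. -/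

import Mathlib

open MeasureTheory

noncomputable section

namespace CubicWavelet

/-- The real `L²(ℝ)` inner product of two functions. -/
def ip (f g : ℝ → ℝ) : ℝ := ∫ x, f x * g x

/-- The `L²(ℝ)` norm. -/
def nrm (f : ℝ → ℝ) : ℝ := Real.sqrt (ip f f)

/-- Normalization `f / ‖f‖`. -/
def normalized (f : ℝ → ℝ) : ℝ → ℝ := (nrm f)⁻¹ • f

/-- `f - ∑ i, ⟨f, e i⟩ e i`. -/
def residual {n : ℕ} (f : ℝ → ℝ) (e : Fin n → ℝ → ℝ) : ℝ → ℝ :=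
  f - ∑ i, ip f (e i) • e i

/-- The vectors `b 0, …, b (r - 1)` form a basis of the null space of the matrix `M`. -/
def IsNullBasis {m n r : ℕ} (M : Matrix (Fin m) (Fin n) ℝ) (b : Fin r → Fin n → ℝ) : Prop :=
  LinearIndependent ℝ b ∧ Submodule.span ℝ (Set.range b) = LinearMap.ker M.mulVecLin

/-- A cubic spline on `ℝ`: with finitely many knots `t`, on each open interval free of knots the
function is a polynomial of degree at most three. -/
def IsCubicSpline (f : ℝ → ℝ) : Prop :=
  ∃ t : Finset ℝ, ∀ a b : ℝ, a < b → (∀ y ∈ t, y ∉ Set.Ioo a b) →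
    ∃ p : Polynomial ℝ, p.natDegree ≤ 3 ∧ ∀ x ∈ Set.Ioo a b, f x = p.eval x

/-! Hermite cubic splines. -/

def hermite1 (x : ℝ) : ℝ :=
  if -1 ≤ x ∧ x ≤ 0 then (x + 1) ^ 2 * (1 - 2 * x)
  else if 0 ≤ x ∧ x ≤ 1 then (1 - x) ^ 2 * (1 + 2 * x)
  else 0

def hermite2 (x : ℝ) : ℝ :=
  if -1 ≤ x ∧ x ≤ 0 then (x + 1) ^ 2 * x
  else if 0 ≤ x ∧ x ≤ 1 then (1 - x) ^ 2 * x
  else 0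

/-- `ξ_{j, 2k+l-1}(x) = 2^{j/2} ξ_l(2^j x - k)`, `l = 1, 2`. -/
def xi (j m : ℤ) (x : ℝ) : ℝ :=
  (2 : ℝ) ^ ((j : ℝ) / 2) *
    (if m % 2 = 0 then hermite1 else hermite2) ((2 : ℝ) ^ j * x - ((m / 2 : ℤ) : ℝ))

/-- From six generators `f 0, …, f 5` (the functions numbered `1, …, 6`), of which the first `r`
are translated by `k` and the others by `k + 1`: the function with index `(j, m)`,
`m = 6k + l`, `1 ≤ l ≤ 6`, is `x ↦ 2^{j/2} f_l(2^j x - k)` if `l ≤ r`, and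
`x ↦ 2^{j/2} f_l(2^j x - k - 1)` if `l > r`. -/
def dilTrans (r : ℕ) (f : Fin 6 → ℝ → ℝ) (j m : ℤ) (x : ℝ) : ℝ :=
  let k : ℤ := (m - 1) / 6
  let l : Fin 6 := ⟨((m - 1) % 6).toNat, by omega⟩
  (2 : ℝ) ^ ((j : ℝ) / 2) *
    f l ((2 : ℝ) ^ j * x - ((if (l : ℕ) < r then k else k + 1 : ℤ) : ℝ))

/-- The data that the construction leaves free: a basis `bC` of the null space of `C`, the
coefficients `s` of the third and fourth scaling generator, and bases `bS`, `bT` of the null spaces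
belonging to `S` and `T`. The conditions on them are in `Choice.Admissible` below. -/
structure Choice where
  bC : Fin 4 → Fin 6 → ℝ
  s : Fin 2 → Fin 4 → ℝ
  bS : Fin 2 → Fin 10 → ℝ
  bT : Fin 2 → Fin 22 → ℝ

/-! Scaling generators. -/

def phi1 : ℝ → ℝ := normalized (xi 1 2)

def phi2 : ℝ → ℝ := normalized (xi 1 3)

/-- `C_{ij} = ⟨ξ_{1,i+1}, ξ_{2,j+1}⟩`, `i = 1, 2`, `j = 1, …, 6`. -/
def matC : Matrix (Fin 2) (Fin 6) ℝ :=
  Matrix.of fun i j => ip (xi 1 ((i : ℤ) + 2)) (xi 2 ((j : ℤ) + 2))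

/-- `c_1, c_2` (from `ξ_{1,0}, ξ_{1,1}`) and `c_3, c_4` (from `ξ_{1,4}, ξ_{1,5}`): the restrictions
to `[0,1]`, minus their components along the first two scaling generators. -/
def cfun (i : Fin 4) : ℝ → ℝ :=
  residual ((Set.Icc (0 : ℝ) 1).indicator (xi 1 (![0, 1, 4, 5] i))) ![phi1, phi2]

namespace Choice

variable (P : Choice)

def w (i : Fin 4) : ℝ → ℝ := ∑ j : Fin 6, P.bC i j • xi 2 ((j : ℤ) + 2)

def v1 : ℝ → ℝ := normalized (P.w 0)

def v2 : ℝ → ℝ := normalized (residual (P.w 1) ![P.v1])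

def v3 : ℝ → ℝ := normalized (residual (P.w 2) ![P.v1, P.v2])

def v4 : ℝ → ℝ := normalized (residual (P.w 3) ![P.v1, P.v2, P.v3])

def v : Fin 4 → ℝ → ℝ := ![P.v1, P.v2, P.v3, P.v4]

def phi3 : ℝ → ℝ := ∑ j, P.s 0 j • P.v j

def phi4 : ℝ → ℝ := ∑ j, P.s 1 j • P.v j

/-- The first four scaling generators. -/
def phiIn : Fin 4 → ℝ → ℝ := ![phi1, phi2, P.phi3, P.phi4]

def g5 : ℝ → ℝ :=
  xi 1 0 - ∑ j, ip (xi 1 0) (P.phiIn j) • P.phiIn j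
    - ∑ j, ip (xi 1 0) (fun x => P.phiIn j (x + 1)) • fun x => P.phiIn j (x + 1)

def phi5 : ℝ → ℝ := normalized P.g5

/-- The first five scaling generators. -/
def phiFive : Fin 5 → ℝ → ℝ := ![phi1, phi2, P.phi3, P.phi4, P.phi5]

def g6 : ℝ → ℝ :=
  xi 1 1 - ∑ j, ip (xi 1 1) (P.phiFive j) • P.phiFive j
    - ∑ j, ip (xi 1 1) (fun x => P.phiFive j (x + 1)) • fun x => P.phiFive j (x + 1)

def phi6 : ℝ → ℝ := normalized P.g6

/-- The six scaling generators. -/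
def phi : Fin 6 → ℝ → ℝ := ![phi1, phi2, P.phi3, P.phi4, P.phi5, P.phi6]

/-- The scaling functions `φ_{j,m}`. -/
def scaling (j m : ℤ) : ℝ → ℝ := dilTrans 4 P.phi j m

/-! Wavelet generators. -/

/-- `φ_k(2·)`, `k = 1, …, 4`, and `φ_k(2· - 1)`, `k = 1, …, 6`. -/
def p : Fin 10 → ℝ → ℝ :=
  ![fun x => P.phi 0 (2 * x), fun x => P.phi 1 (2 * x), fun x => P.phi 2 (2 * x),
    fun x => P.phi 3 (2 * x), fun x => P.phi 0 (2 * x - 1), fun x => P.phi 1 (2 * x - 1),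
    fun x => P.phi 2 (2 * x - 1), fun x => P.phi 3 (2 * x - 1), fun x => P.phi 4 (2 * x - 1),
    fun x => P.phi 5 (2 * x - 1)]

/-- `φ_i`, `i = 1, …, 6`, and `φ_i(· - 1)`, `i = 5, 6`. -/
def q : Fin 8 → ℝ → ℝ :=
  ![P.phi 0, P.phi 1, P.phi 2, P.phi 3, P.phi 4, P.phi 5,
    fun x => P.phi 4 (x - 1), fun x => P.phi 5 (x - 1)]

def matS : Matrix (Fin 10) (Fin 8) ℝ := Matrix.of fun i j => ip (P.p i) (P.q j)

def u (i : Fin 2) : ℝ → ℝ := ∑ j, P.bS i j • P.p j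

def psi1 : ℝ → ℝ := normalized (P.u 0)

def psi2 : ℝ → ℝ := normalized (residual (P.u 1) ![P.psi1])

def h1 : ℝ → ℝ := residual (fun x => P.phi5 (2 * x)) ![P.phi5, P.phi6]

def h2 : ℝ → ℝ := residual (fun x => P.phi6 (2 * x)) ![P.phi5, P.phi6]

def psi3 : ℝ → ℝ := normalized P.h1

def psi4 : ℝ → ℝ := normalized (residual P.h2 ![P.psi3])

/-- The functions to which the last two wavelet generators have to be orthogonal: `φ_{0,k}`,
`k = -7, …, 6`, then `ψ_1(· + 1), ψ_2(· + 1)`, then `ψ_1, …, ψ_4`. -/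
def rowT (i : Fin 20) : ℝ → ℝ :=
  if (i : ℕ) < 14 then P.scaling 0 ((i : ℤ) - 7)
  else (![fun x => P.psi1 (x + 1), fun x => P.psi2 (x + 1), P.psi1, P.psi2, P.psi3, P.psi4] :
    Fin 6 → ℝ → ℝ) ⟨(i : ℕ) - 14, by omega⟩

/-- The columns belong to `φ_{1,k}`, `k = -11, …, 10`. -/
def matT : Matrix (Fin 20) (Fin 22) ℝ :=
  Matrix.of fun i j => ip (P.rowT i) (P.scaling 1 ((j : ℤ) - 11))

def z (i : Fin 2) : ℝ → ℝ := ∑ j : Fin 22, P.bT i j • P.scaling 1 ((j : ℤ) - 11)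

def psi5 : ℝ → ℝ := normalized (P.z 0)

def psi6 : ℝ → ℝ := normalized (residual (P.z 1) ![P.psi5])

/-- The six wavelet generators. -/
def psi : Fin 6 → ℝ → ℝ := ![P.psi1, P.psi2, P.psi3, P.psi4, P.psi5, P.psi6]

/-- The wavelets `ψ_{j,m}`. -/
def wavelet (j m : ℤ) : ℝ → ℝ := dilTrans 2 P.psi j m

/-- The requirements that the construction makes on the free data. -/
structure Admissible : Prop where
  /-- `bC` is a basis of the null space of `C`. -/
  basisC : IsNullBasis matC P.bC
  /-- Normalization and orthogonality of the two coefficient vectors. -/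
  s_norm : ∀ i, ∑ j, P.s i j ^ 2 = 1
  s_orth : ∑ j, P.s 0 j * P.s 1 j = 0
  /-- `(I - P_W) c_i ⊥ (I - P_W) c_k` for `i = 1, 2` and `k = 3, 4`, where `W` is spanned by the
  third and fourth scaling generator. -/
  cond : ∀ i ∈ ({0, 1} : Set (Fin 4)), ∀ k ∈ ({2, 3} : Set (Fin 4)),
    ip (residual (cfun i) ![P.phi3, P.phi4]) (residual (cfun k) ![P.phi3, P.phi4]) = 0
  /-- `bS` is a basis of the space of coefficient vectors `b` with
  `∑ j, b j ⟨p_j, q_i⟩ = 0` for all `i`. -/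
  basisS : IsNullBasis P.matS.transpose P.bS
  /-- `bT` is a basis of the null space of `T`. -/
  basisT : IsNullBasis P.matT P.bT

end Choice

end CubicWavelet

end

/-! ### Orthogonality relations in an abstract inner product space -/

namespace CubicWavelet

section Abstract

variable {E : Type*} [NormedAddCommGroup E] [InnerProductSpace ℝ E]

/-! The construction is an intertwined multiresolution. Let `V j` be the span of the Hermite splines
`X j m`. These spaces increase and their union is dense in L². The spans `level j` of the scaling
functions are interleaved with them: `V (j + 1)` is contained in `level j` (`X_mem_level`), and the
generators, which span `level 0`, lie in `V 2` (`gens_mem_V_two`).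

Orthonormality of the scaling functions: four generators live on `[0,1]`; the other two are the
level-one splines at the node `0`, stripped of their components along the four generators on each of
the two adjacent unit intervals, and orthonormalized. The only overlap not settled by supports or
projections is that of two boundary generators at distance one. The condition imposed on the `c_i`
says precisely that it vanishes (`inner_boundary_tr`). Refinability follows because the level-two
splines are combinations of dilated generators (`X_two_mem`).

Wavelets: fine-scale functions are sorted by the position `pos` of their support. Ten of them live
on `[0,1]`, where eight scaling functions are active; this leaves two wavelets. Two more come from
the dilated boundary generators. On `[-1,1]` there are 22 fine functions and 20 conditions, leaving
the last two. The counts are exact because the scaling functions active on `[0,1]` stay independent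
after projection to the fine functions there (`coeff_eq_zero`). This rests on `left_coords_eq_zero`
and its mirror image: no nonzero half of a boundary function agrees with an element of `V 1` on
`[0,1]`, and this comes down to a nonzero two by two determinant.

Two facts are not built into the definitions: the last two wavelets are orthogonal to their unit
translates (`high_high_one`), and every fine function is a finite combination of coarse scaling
functions and wavelets (`fine_mem_coarse`). Both use the "parts" on `[0,1]` of the boundary
generators: these parts, with the inner generators and the first two wavelets, span all fine
functions on `[0,1]`.

Completeness follows by telescoping `level_succ_le` and from the density of the Hermite splines. The
moments vanish because cubics agree on `[-1,1]` with elements of `V 0`, to which the wavelet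
generators are orthogonal. That the nonlinear condition on the coefficients `s` can be met is a
separate matter: it amounts to a matrix Riccati equation, solved explicitly by nested square roots
(`exists_riccati`).

Everything before the basis statement takes place in the incomplete space of compactly supported
splines, where only projections to finite-dimensional subspaces are needed. -/

theorem inner_eq_zero_of_mem_span {S : Set E} {f g : E} (hS : ∀ s ∈ S, inner ℝ s g = 0)
    (hf : f ∈ Submodule.span ℝ S) : inner ℝ f g = 0 := by
  induction hf using Submodule.span_induction with
  | mem x hx => exact hS x hx
  | zero => exact inner_zero_left _
  | add x y _ _ hx hy => rw [inner_add_left, hx, hy, add_zero]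
  | smul c x _ hx => rw [real_inner_smul_left, hx, mul_zero]

/-- The span is finite-dimensional, so the projection exists although `E` need not be complete.
Since `S` may be dependent, this replaces dimension counts below: a remainder orthogonal to enough
functions is shown to vanish. -/
theorem exists_mem_span_sub_orthogonal {S : Set E} (hS : S.Finite) (f : E) :
    ∃ g ∈ Submodule.span ℝ S, ∀ s ∈ S, inner ℝ s (f - g) = 0 := by
  have := FiniteDimensional.span_of_finite ℝ hS
  refine ⟨(Submodule.span ℝ S).starProjection f, Submodule.starProjection_apply_mem _ _,
    fun s hs => ?_⟩
  exact (Submodule.mem_orthogonal _ _).1 (Submodule.sub_starProjection_mem_orthogonal f) s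
    (Submodule.subset_span hs)

/-- Integer translations `τ` and dyadic dilations `δ`, as isometries of an inner product space. -/
structure DilationSystem (τ δ : ℤ → E →ₗᵢ[ℝ] E) : Prop where
  tr_zero : ∀ f, τ 0 f = f
  tr_add : ∀ m n f, τ (m + n) f = τ m (τ n f)
  dil_zero : ∀ f, δ 0 f = f
  dil_add : ∀ m n f, δ (m + n) f = δ m (δ n f)
  tr_dil : ∀ n f, τ n (δ 1 f) = δ 1 (τ (2 * n) f)

namespace DilationSystem

variable {τ δ : ℤ → E →ₗᵢ[ℝ] E} (h : DilationSystem τ δ)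
include h

theorem inner_tr (m n : ℤ) (f g : E) : inner ℝ (τ m f) (τ n g) = inner ℝ f (τ (n - m) g) := by
  have : τ n g = τ m (τ (n - m) g) := by rw [← h.tr_add]; congr 2; ring
  rw [this, LinearIsometry.inner_map_map]

theorem inner_tr_left (m : ℤ) (f g : E) : inner ℝ (τ m f) g = inner ℝ f (τ (-m) g) := by
  have := h.inner_tr m 0 f g
  rwa [h.tr_zero, zero_sub] at this

end DilationSystem

/-- Twice the centre of the support, on the fine scale, of the function with index `s`. -/
def pos (s : ℤ × Fin 6) : ℤ := 2 * s.1 + if (s.2 : ℕ) < 4 then 1 else 0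

/-- The dilated and translated generators of the next finer scale. -/
def fine (τ δ : ℤ → E →ₗᵢ[ℝ] E) (φ : Fin 6 → E) (s : ℤ × Fin 6) : E := δ 1 (τ s.1 (φ s.2))

/-- The span of the fine-scale functions with position in `[a, b]`. -/
def band (τ δ : ℤ → E →ₗᵢ[ℝ] E) (φ : Fin 6 → E) (a b : ℤ) : Submodule ℝ E :=
  Submodule.span ℝ (fine τ δ φ '' {s | a ≤ pos s ∧ pos s ≤ b})

/-- Orthonormal generators that are refinable with prescribed supports. -/
structure ScalingSystem (τ δ : ℤ → E →ₗᵢ[ℝ] E) (φ : Fin 6 → E) : Prop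
    extends DilationSystem τ δ where
  orth : ∀ i j n, inner ℝ (φ i) (τ n (φ j)) = if i = j ∧ n = 0 then 1 else 0
  mem_band_inner : ∀ i : Fin 6, (i : ℕ) < 4 → φ i ∈ band τ δ φ 1 3
  mem_band : ∀ i, φ i ∈ band τ δ φ (-3) 3

section

variable {τ δ : ℤ → E →ₗᵢ[ℝ] E} {φ : Fin 6 → E}

theorem fine_mem_band {a b : ℤ} {s : ℤ × Fin 6} (ha : a ≤ pos s) (hb : pos s ≤ b) :
    fine τ δ φ s ∈ band τ δ φ a b :=
  Submodule.subset_span ⟨s, ⟨ha, hb⟩, rfl⟩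

theorem band_mono {a b c d : ℤ} (h1 : c ≤ a) (h2 : b ≤ d) : band τ δ φ a b ≤ band τ δ φ c d :=
  Submodule.span_mono (Set.image_mono fun _ hs => ⟨h1.trans hs.1, hs.2.trans h2⟩)

theorem exists_band_split {a b c : ℤ} {f : E} (hf : f ∈ band τ δ φ a c) :
    ∃ x ∈ band τ δ φ a b, ∃ y ∈ band τ δ φ (b + 1) c, x + y = f := by
  have : f ∈ band τ δ φ a b ⊔ band τ δ φ (b + 1) c := by
    rw [band, band, ← Submodule.span_union, ← Set.image_union]
    refine Submodule.span_mono (Set.image_mono fun s hs => ?_) hf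
    rcases le_or_gt (pos s) b with h | h
    · exact Or.inl ⟨hs.1, h⟩
    · exact Or.inr ⟨h, hs.2⟩
  exact Submodule.mem_sup.1 this

theorem DilationSystem.tr_fine (h : DilationSystem τ δ) (n : ℤ) (s : ℤ × Fin 6) : τ n (fine τ δ φ s) = fine τ δ φ (2 * n + s.1, s.2) := by
  rw [fine, h.tr_dil, ← h.tr_add, fine]

theorem DilationSystem.tr_mem_band (h : DilationSystem τ δ) {a b : ℤ} {f : E} (n : ℤ) (hf : f ∈ band τ δ φ a b) :
    τ n f ∈ band τ δ φ (a + 4 * n) (b + 4 * n) := by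
  have : band τ δ φ a b ≤ (band τ δ φ (a + 4 * n) (b + 4 * n)).comap (τ n).toLinearMap := by
    refine Submodule.span_le.2 ?_
    rintro _ ⟨s, hs, rfl⟩
    change τ n (fine τ δ φ s) ∈ band τ δ φ _ _
    rw [h.tr_fine]
    have := hs.1; have := hs.2
    apply fine_mem_band <;> (simp only [pos] at *; omega)
  exact this hf

namespace ScalingSystem

variable (h : ScalingSystem τ δ φ)
include h

theorem inner_tr_tr (i j : Fin 6) (m n : ℤ) :
    inner ℝ (τ m (φ i)) (τ n (φ j)) = if i = j ∧ m = n then 1 else 0 := by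
  rw [h.inner_tr, h.orth]
  simp [sub_eq_zero, eq_comm]

theorem inner_fine (s t : ℤ × Fin 6) :
    inner ℝ (fine τ δ φ s) (fine τ δ φ t) = if s = t then 1 else 0 := by
  rw [fine, fine, LinearIsometry.inner_map_map, h.inner_tr_tr]
  simp [Prod.ext_iff, and_comm]

theorem orthonormal_fine : Orthonormal ℝ (fine τ δ φ) :=
  orthonormal_iff_ite.2 h.inner_fine

/-- Positions do the work of supports, and more: fine functions with overlapping supports are still
orthogonal when their positions differ. -/
theorem inner_band {a b c d : ℤ} {f g : E} (hf : f ∈ band τ δ φ a b) (hg : g ∈ band τ δ φ c d)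
    (hbc : b < c ∨ d < a) : inner ℝ f g = 0 := by
  refine inner_eq_zero_of_mem_span ?_ hf
  rintro _ ⟨s, hs, rfl⟩
  rw [real_inner_comm]
  refine inner_eq_zero_of_mem_span ?_ hg
  rintro _ ⟨t, ht, rfl⟩
  rw [h.inner_fine, if_neg]
  rintro rfl
  have := hs.1; have := hs.2; have := ht.1; have := ht.2
  omega

theorem tr_mem_inner (i : Fin 6) (hi : (i : ℕ) < 4) (n : ℤ) :
    τ n (φ i) ∈ band τ δ φ (1 + 4 * n) (3 + 4 * n) := h.tr_mem_band n (h.mem_band_inner i hi)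

theorem tr_mem (i : Fin 6) (n : ℤ) : τ n (φ i) ∈ band τ δ φ (-3 + 4 * n) (3 + 4 * n) :=
  h.tr_mem_band n (h.mem_band i)

theorem dil_mem (i : Fin 6) (hi : 4 ≤ (i : ℕ)) : δ 1 (φ i) ∈ band τ δ φ 0 0 := by
  have : δ 1 (φ i) = fine τ δ φ (0, i) := by rw [fine, h.tr_zero]
  rw [this]
  apply fine_mem_band <;> simp [pos, not_lt.2 hi]

theorem tr_dil_mem (i : Fin 6) (hi : 4 ≤ (i : ℕ)) (n : ℤ) :
    τ n (δ 1 (φ i)) ∈ band τ δ φ (4 * n) (4 * n) := by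
  simpa using h.tr_mem_band n (h.dil_mem i hi)

/-- The supports may overlap, but the coarse function has no fine component at position `0`, the
position of the dilated boundary generators. -/
theorem inner_tr_dil (i j : Fin 6) (hj : 4 ≤ (j : ℕ)) (n : ℤ) (hn : (i : ℕ) < 4 ∨ n ≠ 0) :
    inner ℝ (τ n (φ i)) (δ 1 (φ j)) = 0 := by
  by_cases hi : (i : ℕ) < 4
  · exact h.inner_band (h.tr_mem_inner i hi n) (h.dil_mem j hj) (by omega)
  · exact h.inner_band (h.tr_mem i n) (h.dil_mem j hj) (by omega)

end ScalingSystem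

end

/-- The first four wavelet generators. -/
structure LowWavelets (τ δ : ℤ → E →ₗᵢ[ℝ] E) (φ ψ : Fin 6 → E) : Prop
    extends ScalingSystem τ δ φ where
  low_pair : ∀ i j : Fin 6, (i : ℕ) < 2 → (j : ℕ) < 2 → inner ℝ (ψ i) (ψ j) = if i = j then 1 else 0
  low_mem : ∀ i : Fin 6, (i : ℕ) < 2 → ψ i ∈ band τ δ φ 1 3
  low_orth : ∀ i : Fin 6, (i : ℕ) < 2 → ∀ j, inner ℝ (φ j) (ψ i) = 0
  low_orth_tr : ∀ i : Fin 6, (i : ℕ) < 2 → ∀ j : Fin 6, 4 ≤ (j : ℕ) → inner ℝ (τ 1 (φ j)) (ψ i) = 0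
  low_max : ∀ f ∈ band τ δ φ 1 3, (∀ j, inner ℝ (φ j) f = 0) →
    (∀ j : Fin 6, 4 ≤ (j : ℕ) → inner ℝ (τ 1 (φ j)) f = 0) → f ∈ Submodule.span ℝ {ψ 0, ψ 1}
  mid_pair : ∀ i j : Fin 6, (i = 2 ∨ i = 3) → (j = 2 ∨ j = 3) →
    inner ℝ (ψ i) (ψ j) = if i = j then 1 else 0
  mid_mem : ∀ i : Fin 6, (i = 2 ∨ i = 3) →
    ψ i ∈ Submodule.span ℝ {δ 1 (φ 4), δ 1 (φ 5), φ 4, φ 5}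
  mid_orth : ∀ i : Fin 6, (i = 2 ∨ i = 3) → ∀ j : Fin 6, 4 ≤ (j : ℕ) → inner ℝ (φ j) (ψ i) = 0

/-- Orthogonality to the scaling functions and wavelets that meet the interval `[-1, 1]`. -/
structure OrthRows (τ : ℤ → E →ₗᵢ[ℝ] E) (φ ψ : Fin 6 → E) (f : E) : Prop where
  scal : ∀ j, inner ℝ (φ j) f = 0
  scal_left : ∀ j, inner ℝ (τ (-1) (φ j)) f = 0
  scal_right : ∀ j : Fin 6, 4 ≤ (j : ℕ) → inner ℝ (τ 1 (φ j)) f = 0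
  wav : ∀ i : Fin 6, (i : ℕ) < 4 → inner ℝ (ψ i) f = 0
  wav_left : ∀ i : Fin 6, (i : ℕ) < 2 → inner ℝ (τ (-1) (ψ i)) f = 0

/-- All six wavelet generators. -/
structure WaveletSystem (τ δ : ℤ → E →ₗᵢ[ℝ] E) (φ ψ : Fin 6 → E) : Prop
    extends LowWavelets τ δ φ ψ where
  high_pair : ∀ i j : Fin 6, 4 ≤ (i : ℕ) → 4 ≤ (j : ℕ) →
    inner ℝ (ψ i) (ψ j) = if i = j then 1 else 0
  high_mem : ∀ i : Fin 6, 4 ≤ (i : ℕ) → ψ i ∈ band τ δ φ (-3) 3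
  high_orth : ∀ i : Fin 6, 4 ≤ (i : ℕ) → OrthRows τ φ ψ (ψ i)
  high_max : ∀ f ∈ band τ δ φ (-3) 3, OrthRows τ φ ψ f → f ∈ Submodule.span ℝ {ψ 4, ψ 5}

section

variable {τ δ : ℤ → E →ₗᵢ[ℝ] E} {φ ψ : Fin 6 → E}

namespace LowWavelets

variable (h : LowWavelets τ δ φ ψ)
include h

/-- The wavelets `ψ 2` and `ψ 3` combine dilated and undilated boundary generators, so their
orthogonality relations are reduced to those of these four functions. -/
theorem inner_mid {i : Fin 6} (hi : i = 2 ∨ i = 3) {g : E}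
    (h1 : ∀ j : Fin 6, 4 ≤ (j : ℕ) → inner ℝ (δ 1 (φ j)) g = 0)
    (h2 : ∀ j : Fin 6, 4 ≤ (j : ℕ) → inner ℝ (φ j) g = 0) : inner ℝ (ψ i) g = 0 := by
  refine inner_eq_zero_of_mem_span ?_ (h.mid_mem i hi)
  rintro s (rfl | rfl | rfl | rfl)
  · exact h1 4 (by decide)
  · exact h1 5 (by decide)
  · exact h2 4 (by decide)
  · exact h2 5 (by decide)

theorem scal_low (n : ℤ) (i j : Fin 6) (hj : (j : ℕ) < 2) : inner ℝ (τ n (φ i)) (ψ j) = 0 := by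
  rcases eq_or_ne n 0 with rfl | hn
  · rw [h.tr_zero]; exact h.low_orth j hj i
  by_cases hi : (i : ℕ) < 4
  · exact h.inner_band (h.tr_mem_inner i hi n) (h.low_mem j hj) (by omega)
  · rcases eq_or_ne n 1 with rfl | hn1
    · exact h.low_orth_tr j hj i (by omega)
    · exact h.inner_band (h.tr_mem i n) (h.low_mem j hj) (by omega)

theorem scal_mid (n : ℤ) (i j : Fin 6) (hj : j = 2 ∨ j = 3) : inner ℝ (τ n (φ i)) (ψ j) = 0 := by
  by_cases hc : (i : ℕ) < 4 ∨ n ≠ 0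
  · rw [real_inner_comm]
    refine h.inner_mid hj (fun k hk => ?_) fun k hk => ?_
    · rw [real_inner_comm]; exact h.inner_tr_dil i k hk n hc
    · rw [h.orth, if_neg]
      rintro ⟨rfl, rfl⟩
      omega
  · push Not at hc
    obtain ⟨hi, rfl⟩ := hc
    rw [h.tr_zero]
    exact h.mid_orth j hj i hi

theorem low_low (n : ℤ) (i j : Fin 6) (hi : (i : ℕ) < 2) (hj : (j : ℕ) < 2) :
    inner ℝ (ψ i) (τ n (ψ j)) = if i = j ∧ n = 0 then 1 else 0 := by
  rcases eq_or_ne n 0 with rfl | hn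
  · rw [h.tr_zero, h.low_pair i j hi hj]; simp
  · rw [if_neg (by tauto)]
    exact h.inner_band (h.low_mem i hi) (h.tr_mem_band n (h.low_mem j hj)) (by omega)

theorem mid_low (n : ℤ) (i j : Fin 6) (hi : i = 2 ∨ i = 3) (hj : (j : ℕ) < 2) :
    inner ℝ (ψ i) (τ n (ψ j)) = 0 := by
  refine h.inner_mid hi (fun k hk => ?_) fun k hk => ?_
  · exact h.inner_band (h.dil_mem k hk) (h.tr_mem_band n (h.low_mem j hj)) (by omega)
  · have := h.inner_tr_left (-n) (φ k) (ψ j)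
    rw [neg_neg] at this
    rw [← this]
    exact h.scal_low _ _ _ hj

theorem mid_mid (n : ℤ) (i j : Fin 6) (hi : i = 2 ∨ i = 3) (hj : j = 2 ∨ j = 3) :
    inner ℝ (ψ i) (τ n (ψ j)) = if i = j ∧ n = 0 then 1 else 0 := by
  rcases eq_or_ne n 0 with rfl | hn
  · rw [h.tr_zero, h.mid_pair i j hi hj]; simp
  · rw [if_neg (by tauto)]
    refine h.inner_mid hi (fun k hk => ?_) fun k hk => ?_
    · have := h.inner_tr_left (-n) (δ 1 (φ k)) (ψ j)
      rw [neg_neg] at this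
      rw [← this, real_inner_comm]
      refine h.inner_mid hj (fun l hl => ?_) fun l hl => ?_
      · exact h.inner_band (h.dil_mem l hl) (h.tr_dil_mem k hk (-n)) (by omega)
      · rw [real_inner_comm, h.inner_tr_left, neg_neg, real_inner_comm]
        exact h.inner_tr_dil l k hk n (Or.inr hn)
    · have := h.inner_tr_left (-n) (φ k) (ψ j)
      rw [neg_neg] at this
      rw [← this]
      exact h.scal_mid _ _ _ hj

theorem mid_mem_band (i : Fin 6) (hi : i = 2 ∨ i = 3) : ψ i ∈ band τ δ φ (-3) 3 := by
  refine Submodule.span_le.2 ?_ (h.mid_mem i hi)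
  rintro s (rfl | rfl | rfl | rfl)
  · exact band_mono (by omega) (by omega) (h.dil_mem 4 (by decide))
  · exact band_mono (by omega) (by omega) (h.dil_mem 5 (by decide))
  · exact h.mem_band 4
  · exact h.mem_band 5

/-- Uniqueness in the space of fine-scale functions on the unit interval. -/
theorem eq_zero_of_orth {f : E} (hf : f ∈ band τ δ φ 1 3) (h0 : ∀ j, inner ℝ (φ j) f = 0)
    (h1 : ∀ j : Fin 6, 4 ≤ (j : ℕ) → inner ℝ (τ 1 (φ j)) f = 0)
    (h2 : ∀ j : Fin 6, (j : ℕ) < 2 → inner ℝ (ψ j) f = 0) : f = 0 := by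
  rw [← inner_self_eq_zero (𝕜 := ℝ)]
  refine inner_eq_zero_of_mem_span ?_ (h.low_max f hf h0 h1)
  rintro s (rfl | rfl)
  · exact h2 0 (by decide)
  · exact h2 1 (by decide)

/-- Take the fine components of `φ j` at positions `1` to `3`; those at positions up to `0` do not
see functions in `band 1 7`. -/
theorem exists_right_part (j : Fin 6) :
    ∃ r ∈ band τ δ φ 1 3, ∀ g ∈ band τ δ φ 1 7, inner ℝ r g = inner ℝ (φ j) g := by
  obtain ⟨x, hx, y, hy, hxy⟩ := exists_band_split (b := 0) (h.mem_band j)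
  refine ⟨y, hy, fun g hg => ?_⟩
  rw [← hxy, inner_add_left, h.inner_band hx hg (by omega), zero_add]

/-- The mirror image: for the translate by one, the components beyond position `3` are dropped. -/
theorem exists_left_part (j : Fin 6) :
    ∃ r ∈ band τ δ φ 1 3, ∀ g ∈ band τ δ φ (-3) 3, inner ℝ r g = inner ℝ (τ 1 (φ j)) g := by
  obtain ⟨x, hx, y, hy, hxy⟩ := exists_band_split (b := 3) (h.tr_mem j 1)
  refine ⟨x, band_mono (by omega) (by omega) hx, fun g hg => ?_⟩
  rw [← hxy, inner_add_left, h.inner_band hy hg (by omega), add_zero]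

/-- The parts in `[0, 1]` of the two generators of support `[-1, 1]`, and of their translates. -/
theorem exists_parts : ∃ r l : Fin 6 → E,
    (∀ j, r j ∈ band τ δ φ 1 3 ∧ ∀ g ∈ band τ δ φ 1 7, inner ℝ (r j) g = inner ℝ (φ j) g) ∧
    (∀ j, l j ∈ band τ δ φ 1 3 ∧
      ∀ g ∈ band τ δ φ (-3) 3, inner ℝ (l j) g = inner ℝ (τ 1 (φ j)) g) := by
  choose r hr hr' using h.exists_right_part
  choose l hl hl' using h.exists_left_part
  exact ⟨r, l, fun j => ⟨hr j, hr' j⟩, fun j => ⟨hl j, hl' j⟩⟩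

end LowWavelets

end

end Abstract

end CubicWavelet

/-! ### Translates of the last wavelets, and the two-scale decomposition -/

namespace CubicWavelet

section Abstract

variable {E : Type*} [NormedAddCommGroup E] [InnerProductSpace ℝ E]
variable {τ δ : ℤ → E →ₗᵢ[ℝ] E} {φ ψ : Fin 6 → E}

namespace LowWavelets

variable (h : LowWavelets τ δ φ ψ)
include h

/-- Eight conditions on a ten-dimensional space leave a plane, namely the span of the two right
parts. Instead of counting, one subtracts the projection to that span: the remainder also becomes
orthogonal to `φ 4` and `φ 5`, and `eq_zero_of_orth` applies. -/
theorem mem_span_right_parts {r : Fin 6 → E}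
    (hr : ∀ j, r j ∈ band τ δ φ 1 3 ∧ ∀ g ∈ band τ δ φ 1 7, inner ℝ (r j) g = inner ℝ (φ j) g)
    {f : E} (hf : f ∈ band τ δ φ 1 3) (h0 : ∀ j : Fin 6, (j : ℕ) < 4 → inner ℝ (φ j) f = 0)
    (h1 : ∀ j : Fin 6, 4 ≤ (j : ℕ) → inner ℝ (τ 1 (φ j)) f = 0)
    (h2 : ∀ j : Fin 6, (j : ℕ) < 2 → inner ℝ (ψ j) f = 0) :
    f ∈ Submodule.span ℝ (r '' {j | 4 ≤ (j : ℕ)}) := by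
  obtain ⟨g, hg, hfg⟩ := exists_mem_span_sub_orthogonal (S := r '' {j | 4 ≤ (j : ℕ)})
    (Set.toFinite _) f
  have hgb : g ∈ band τ δ φ 1 3 := by
    refine Submodule.span_le.2 ?_ hg
    rintro _ ⟨j, _, rfl⟩
    exact (hr j).1
  -- Subtracting `g` does not disturb the conditions already satisfied: each function `x` in them is
  -- orthogonal to the right parts, because pairing with a right part is pairing with a boundary
  -- generator.
  have key : ∀ x : E, (∀ j : Fin 6, 4 ≤ (j : ℕ) → inner ℝ (r j) x = 0) → inner ℝ x g = 0 := by
    intro x hx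
    rw [real_inner_comm]
    refine inner_eq_zero_of_mem_span ?_ hg
    rintro _ ⟨j, hj, rfl⟩
    exact hx j hj
  have : f - g = 0 := by
    refine h.eq_zero_of_orth (sub_mem hf hgb) (fun j => ?_) (fun j hj => ?_) fun j hj => ?_
    · by_cases hj : (j : ℕ) < 4
      · rw [inner_sub_right, h0 j hj, key, sub_zero]
        intro k hk
        rw [(hr k).2 _ (band_mono le_rfl (by omega) (h.mem_band_inner j hj))]
        have := h.orth k j 0
        rw [h.tr_zero] at this
        rw [this, if_neg]
        rintro ⟨rfl, -⟩
        omega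
      · have := (hr j).2 _ (band_mono le_rfl (by omega) (sub_mem hf hgb))
        rw [← this]
        exact hfg _ ⟨j, by simpa using hj, rfl⟩
    · rw [inner_sub_right, h1 j hj, key, sub_zero]
      intro k hk
      rw [(hr k).2 _ (by simpa using h.tr_mem j 1), h.orth, if_neg (by simp)]
    · rw [inner_sub_right, h2 j hj, key, sub_zero]
      intro k hk
      rw [(hr k).2 _ (band_mono le_rfl (by omega) (h.low_mem j hj)), h.low_orth j hj]
  rwa [sub_eq_zero.1 this]

/-- These `4 + 2 + 2 + 2` functions realize every condition in `eq_zero_of_orth`, so the remainder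
after projection to their span is zero. -/
theorem mem_span_parts {r l : Fin 6 → E}
    (hr : ∀ j, r j ∈ band τ δ φ 1 3 ∧ ∀ g ∈ band τ δ φ 1 7, inner ℝ (r j) g = inner ℝ (φ j) g)
    (hl : ∀ j, l j ∈ band τ δ φ 1 3 ∧
      ∀ g ∈ band τ δ φ (-3) 3, inner ℝ (l j) g = inner ℝ (τ 1 (φ j)) g)
    {f : E} (hf : f ∈ band τ δ φ 1 3) :
    f ∈ Submodule.span ℝ (φ '' {j | (j : ℕ) < 4} ∪ ψ '' {j | (j : ℕ) < 2} ∪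
      r '' {j | 4 ≤ (j : ℕ)} ∪ l '' {j | 4 ≤ (j : ℕ)}) := by
  obtain ⟨g, hg, hfg⟩ := exists_mem_span_sub_orthogonal (S := φ '' {j | (j : ℕ) < 4} ∪
    ψ '' {j | (j : ℕ) < 2} ∪ r '' {j | 4 ≤ (j : ℕ)} ∪ l '' {j | 4 ≤ (j : ℕ)})
    (Set.toFinite _) f
  have hgb : g ∈ band τ δ φ 1 3 := by
    refine Submodule.span_le.2 ?_ hg
    rintro _ (((⟨j, hj, rfl⟩ | ⟨j, hj, rfl⟩) | ⟨j, hj, rfl⟩) | ⟨j, hj, rfl⟩)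
    · exact h.mem_band_inner j hj
    · exact h.low_mem j hj
    · exact (hr j).1
    · exact (hl j).1
  have : f - g = 0 := by
    refine h.eq_zero_of_orth (sub_mem hf hgb) (fun j => ?_) (fun j hj => ?_) fun j hj => ?_
    · by_cases hj : (j : ℕ) < 4
      · exact hfg _ (Or.inl (Or.inl (Or.inl ⟨j, hj, rfl⟩)))
      · have := (hr j).2 _ (band_mono le_rfl (by omega) (sub_mem hf hgb))
        rw [← this]
        exact hfg _ (Or.inl (Or.inr ⟨j, by simpa using hj, rfl⟩))
    · have := (hl j).2 _ (band_mono (by omega) le_rfl (sub_mem hf hgb))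
      rw [← this]
      exact hfg _ (Or.inr ⟨j, hj, rfl⟩)
    · exact hfg _ (Or.inl (Or.inl (Or.inr ⟨j, hj, rfl⟩)))
  rwa [sub_eq_zero.1 this]

end LowWavelets

namespace WaveletSystem

variable (h : WaveletSystem τ δ φ ψ)
include h

theorem scal_wav (n : ℤ) (i j : Fin 6) : inner ℝ (τ n (φ i)) (ψ j) = 0 := by
  by_cases h2 : (j : ℕ) < 2
  · exact h.scal_low n i j h2
  by_cases h4 : (j : ℕ) < 4
  · exact h.scal_mid n i j (by omega)
  have ho := h.high_orth j (by omega)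
  rcases eq_or_ne n 0 with rfl | hn
  · rw [h.tr_zero]; exact ho.scal i
  rcases eq_or_ne n (-1) with rfl | hn1
  · exact ho.scal_left i
  by_cases hi : (i : ℕ) < 4
  · exact h.inner_band (h.tr_mem_inner i hi n) (h.high_mem j (by omega)) (by omega)
  rcases eq_or_ne n 1 with rfl | hn2
  · exact ho.scal_right i (by omega)
  · exact h.inner_band (h.tr_mem i n) (h.high_mem j (by omega)) (by omega)

theorem high_low (n : ℤ) (i j : Fin 6) (hi : 4 ≤ (i : ℕ)) (hj : (j : ℕ) < 2) :
    inner ℝ (τ n (ψ j)) (ψ i) = 0 := by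
  have ho := h.high_orth i hi
  rcases eq_or_ne n 0 with rfl | hn
  · rw [h.tr_zero]; exact ho.wav j (by omega)
  rcases eq_or_ne n (-1) with rfl | hn1
  · exact ho.wav_left j hj
  · exact h.inner_band (h.tr_mem_band n (h.low_mem j hj)) (h.high_mem i hi) (by omega)

theorem high_mid (n : ℤ) (i j : Fin 6) (hi : 4 ≤ (i : ℕ)) (hj : j = 2 ∨ j = 3) :
    inner ℝ (ψ j) (τ n (ψ i)) = 0 := by
  have ho := h.high_orth i hi
  rcases eq_or_ne n 0 with rfl | hn
  · rw [h.tr_zero]; exact ho.wav j (by omega)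
  · refine h.inner_mid hj (fun k hk => ?_) fun k hk => ?_
    · exact h.inner_band (h.dil_mem k hk) (h.tr_mem_band n (h.high_mem i hi)) (by omega)
    · have := h.inner_tr_left (-n) (φ k) (ψ i)
      rw [neg_neg] at this
      rw [← this]
      exact h.scal_wav _ _ _

/-- Not imposed by the construction. On the common interval `[0,1]`, the component of `ψ i` meets
all conditions of `mem_span_right_parts`, hence combines right parts of `φ 4` and `φ 5`. A right
part paired with the translate of `ψ j` gives the same as the whole generator, and that pairing
vanishes. -/
theorem high_high_one (i j : Fin 6) (hi : 4 ≤ (i : ℕ)) (hj : 4 ≤ (j : ℕ)) :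
    inner ℝ (ψ i) (τ 1 (ψ j)) = 0 := by
  obtain ⟨r, -, hr, -⟩ := h.exists_parts
  -- Only the components at positions `1` to `3` interact: `y` of the first wavelet and `x'` of the
  -- translated one.
  obtain ⟨x, hx, y, hy, hxy⟩ := exists_band_split (b := 0) (h.high_mem i hi)
  obtain ⟨x', hx', y', hy', hxy'⟩ := exists_band_split (b := 3) (h.tr_mem_band 1 (h.high_mem j hj))
  rw [zero_add] at hy
  norm_num at hx' hy'
  have e1 : ∀ g ∈ band τ δ φ 1 7, inner ℝ g (ψ i) = inner ℝ g y := fun g hg => by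
    rw [← hxy, inner_add_right, h.inner_band hg hx (by omega), zero_add]
  have e2 : ∀ g ∈ band τ δ φ (-3) 3, inner ℝ g (τ 1 (ψ j)) = inner ℝ g x' := fun g hg => by
    rw [← hxy', inner_add_right, h.inner_band hg hy' (by omega), add_zero]
  rw [e2 _ (h.high_mem i hi), real_inner_comm,
    e1 _ (band_mono (by omega) (by omega) hx'), real_inner_comm]
  have hmem : y ∈ Submodule.span ℝ (r '' {j | 4 ≤ (j : ℕ)}) := by
    refine h.mem_span_right_parts hr hy (fun k hk => ?_) (fun k hk => ?_) fun k hk => ?_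
    · rw [← e1 _ (band_mono le_rfl (by omega) (h.mem_band_inner k hk))]
      simpa [h.tr_zero] using h.scal_wav 0 k i
    · rw [← e1 _ (by simpa using h.tr_mem k 1)]
      exact h.scal_wav 1 k i
    · rw [← e1 _ (band_mono le_rfl (by omega) (h.low_mem k hk))]
      simpa [h.tr_zero] using h.high_low 0 i k hi hk
  refine inner_eq_zero_of_mem_span ?_ hmem
  rintro _ ⟨k, hk, rfl⟩
  rw [(hr k).2 _ (band_mono (by omega) (by omega) hx'), ← e2 _ (h.mem_band k)]
  have := h.inner_tr_left (-1) (φ k) (ψ j)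
  rw [neg_neg] at this
  rw [← this]
  exact h.scal_wav _ _ _

theorem wav_wav (n : ℤ) (i j : Fin 6) :
    inner ℝ (ψ i) (τ n (ψ j)) = if i = j ∧ n = 0 then 1 else 0 := by
  have flip : ∀ (n : ℤ) (i j : Fin 6), inner ℝ (ψ i) (τ n (ψ j)) = inner ℝ (ψ j) (τ (-n) (ψ i)) :=
    fun n i j => by rw [real_inner_comm, h.inner_tr_left]
  have low : ∀ k : Fin 6, (k : ℕ) < 2 ∨ (k = 2 ∨ k = 3) ∨ 4 ≤ (k : ℕ) := by decide
  have hne : ∀ (p : Fin 6 → Prop), p i → ¬ p j → ¬ (i = j ∧ n = 0) := by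
    rintro p hp hq ⟨rfl, -⟩
    exact hq hp
  rcases low i with hi | hi | hi <;> rcases low j with hj | hj | hj
  · exact h.low_low n i j hi hj
  · rw [if_neg (hne (fun k => (k : ℕ) < 2) hi (by omega)), flip, h.mid_low _ _ _ hj hi]
  · rw [if_neg (hne (fun k => (k : ℕ) < 2) hi (by omega)), flip, real_inner_comm]
    exact h.high_low _ _ _ hj hi
  · rw [if_neg (hne (fun k => k = 2 ∨ k = 3) hi (by omega)), h.mid_low _ _ _ hi hj]
  · exact h.mid_mid n i j hi hj
  · rw [if_neg (hne (fun k => k = 2 ∨ k = 3) hi (by omega)), h.high_mid _ _ _ hj hi]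
  · rw [if_neg (hne (fun k => 4 ≤ (k : ℕ)) hi (by omega)), real_inner_comm]
    exact h.high_low _ _ _ hi hj
  · rw [if_neg (hne (fun k => 4 ≤ (k : ℕ)) hi (by omega)), flip, h.high_mid _ _ _ hi hj]
  · rcases eq_or_ne n 0 with rfl | hn
    · rw [h.tr_zero, h.high_pair i j hi hj]; simp
    rw [if_neg (by tauto)]
    rcases eq_or_ne n 1 with rfl | h1
    · exact h.high_high_one i j hi hj
    rcases eq_or_ne n (-1) with rfl | h2
    · rw [flip, neg_neg]; exact h.high_high_one j i hj hi
    · exact h.inner_band (h.high_mem i hi) (h.tr_mem_band n (h.high_mem j hj)) (by omega)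

/-- The span of the scaling functions and wavelets at level zero. -/
abbrev coarse (_ : WaveletSystem τ δ φ ψ) : Submodule ℝ E :=
  Submodule.span ℝ (Set.range fun s : ℤ × Fin 6 => τ s.1 (φ s.2)) ⊔
    Submodule.span ℝ (Set.range fun s : ℤ × Fin 6 => τ s.1 (ψ s.2))

theorem scal_mem_coarse (n : ℤ) (i : Fin 6) : τ n (φ i) ∈ h.coarse :=
  Submodule.mem_sup_left (Submodule.subset_span ⟨(n, i), rfl⟩)

theorem wav_mem_coarse (n : ℤ) (i : Fin 6) : τ n (ψ i) ∈ h.coarse :=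
  Submodule.mem_sup_right (Submodule.subset_span ⟨(n, i), rfl⟩)

theorem tr_mem_coarse (n : ℤ) {f : E} (hf : f ∈ h.coarse) : τ n f ∈ h.coarse := by
  have : h.coarse ≤ h.coarse.comap (τ n).toLinearMap := by
    refine sup_le (Submodule.span_le.2 ?_) (Submodule.span_le.2 ?_)
    · rintro _ ⟨s, rfl⟩
      change τ n (τ s.1 (φ s.2)) ∈ h.coarse
      rw [← h.tr_add]
      exact h.scal_mem_coarse _ _
    · rintro _ ⟨s, rfl⟩
      change τ n (τ s.1 (ψ s.2)) ∈ h.coarse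
      rw [← h.tr_add]
      exact h.wav_mem_coarse _ _
  exact this hf

/-- The hypotheses are `OrthRows` without the conditions against `φ 4`, `φ 5`, `ψ 2`, `ψ 3`.
Subtracting the projection to the span of these four supplies the missing ones and keeps the others;
the remainder is then a combination of `ψ 4` and `ψ 5` by maximality. -/
theorem mem_coarse_of_orth {f : E} (hf : f ∈ band τ δ φ (-3) 3)
    (h0 : ∀ j : Fin 6, (j : ℕ) < 4 → inner ℝ (φ j) f = 0)
    (h1 : ∀ j, inner ℝ (τ (-1) (φ j)) f = 0)
    (h2 : ∀ j : Fin 6, 4 ≤ (j : ℕ) → inner ℝ (τ 1 (φ j)) f = 0)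
    (h3 : ∀ j : Fin 6, (j : ℕ) < 2 → inner ℝ (ψ j) f = 0)
    (h4 : ∀ j : Fin 6, (j : ℕ) < 2 → inner ℝ (τ (-1) (ψ j)) f = 0) : f ∈ h.coarse := by
  obtain ⟨g, hg, hfg⟩ := exists_mem_span_sub_orthogonal
    (S := φ '' {j | 4 ≤ (j : ℕ)} ∪ ψ '' {j | j = 2 ∨ j = 3}) (Set.toFinite _) f
  have hgb : g ∈ band τ δ φ (-3) 3 := by
    refine Submodule.span_le.2 ?_ hg
    rintro _ (⟨j, hj, rfl⟩ | ⟨j, hj, rfl⟩)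
    · exact h.mem_band j
    · exact h.mid_mem_band j hj
  have hgc : g ∈ h.coarse := by
    refine Submodule.span_le.2 ?_ hg
    rintro _ (⟨j, hj, rfl⟩ | ⟨j, hj, rfl⟩)
    · simpa [h.tr_zero] using h.scal_mem_coarse 0 j
    · simpa [h.tr_zero] using h.wav_mem_coarse 0 j
  have key : ∀ x : E, (∀ j : Fin 6, 4 ≤ (j : ℕ) → inner ℝ x (φ j) = 0) →
      (∀ j : Fin 6, j = 2 ∨ j = 3 → inner ℝ x (ψ j) = 0) → inner ℝ x g = 0 := by
    intro x h5 h6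
    rw [real_inner_comm]
    refine inner_eq_zero_of_mem_span ?_ hg
    rintro _ (⟨j, hj, rfl⟩ | ⟨j, hj, rfl⟩) <;> rw [real_inner_comm]
    exacts [h5 j hj, h6 j hj]
  have hss : ∀ (n : ℤ) (i j : Fin 6), inner ℝ (τ n (φ i)) (φ j) = if j = i ∧ n = 0 then 1 else 0 :=
    fun n i j => by rw [real_inner_comm, h.orth]
  have hss0 : ∀ (i j : Fin 6), inner ℝ (φ i) (φ j) = if j = i then 1 else 0 :=
    fun i j => by simpa [h.tr_zero] using hss 0 i j
  have hsw : ∀ i j : Fin 6, inner ℝ (φ i) (ψ j) = 0 := fun i j => by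
    simpa [h.tr_zero] using h.scal_wav 0 i j
  have hww : ∀ (n : ℤ) (i j : Fin 6), inner ℝ (τ n (ψ i)) (ψ j) = if j = i ∧ n = 0 then 1 else 0 :=
    fun n i j => by rw [real_inner_comm, h.wav_wav]
  have hww0 : ∀ (i j : Fin 6), inner ℝ (ψ i) (ψ j) = if j = i then 1 else 0 :=
    fun i j => by simpa [h.tr_zero] using hww 0 i j
  have hrow : OrthRows τ φ ψ (f - g) := by
    refine ⟨fun j => ?_, fun j => ?_, fun j hj => ?_, fun j hj => ?_, fun j hj => ?_⟩
    · by_cases hj : (j : ℕ) < 4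
      · rw [inner_sub_right, h0 j hj, key, sub_zero]
        · intro k hk
          rw [hss0, if_neg]
          rintro rfl
          omega
        · exact fun k _ => hsw _ _
      · exact hfg _ (Or.inl ⟨j, by simpa using hj, rfl⟩)
    · rw [inner_sub_right, h1 j, key, sub_zero]
      · intro k hk
        rw [hss, if_neg (by simp)]
      · exact fun k _ => h.scal_wav _ _ _
    · rw [inner_sub_right, h2 j hj, key, sub_zero]
      · intro k hk
        rw [hss, if_neg (by simp)]
      · exact fun k _ => h.scal_wav _ _ _
    · by_cases hj' : (j : ℕ) < 2
      · rw [inner_sub_right, h3 j hj', key, sub_zero]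
        · intro k hk
          rw [real_inner_comm, hsw]
        · intro k hk
          rw [hww0, if_neg]
          rintro rfl
          omega
      · exact hfg _ (Or.inr ⟨j, by simp only [Set.mem_ofPred_eq]; omega, rfl⟩)
    · rw [inner_sub_right, h4 j hj, key, sub_zero]
      · intro k hk
        rw [h.inner_tr_left, neg_neg, real_inner_comm]
        exact h.scal_wav _ _ _
      · intro k hk
        rw [hww, if_neg (by simp)]
  have hfin : f - g ∈ h.coarse := by
    refine Submodule.span_le.2 ?_ (h.high_max _ (sub_mem hf hgb) hrow)
    rintro s (rfl | rfl)
    · simpa [h.tr_zero] using h.wav_mem_coarse 0 4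
    · simpa [h.tr_zero] using h.wav_mem_coarse 0 5
  simpa using add_mem hfin hgc

/-- Against functions in `band 1 7` the part inherits the orthogonality of `φ j`; functions further
left do not meet it. Together these give the hypotheses of `mem_coarse_of_orth`. -/
theorem right_part_mem_coarse {r : E} (hr : r ∈ band τ δ φ 1 3) {j : Fin 6} (hj : 4 ≤ (j : ℕ))
    (hrg : ∀ g ∈ band τ δ φ 1 7, inner ℝ r g = inner ℝ (φ j) g) : r ∈ h.coarse := by
  refine h.mem_coarse_of_orth (band_mono (by omega) le_rfl hr) (fun k hk => ?_) (fun k => ?_)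
    (fun k hk => ?_) (fun k hk => ?_) fun k hk => ?_
  · rw [real_inner_comm, hrg _ (band_mono le_rfl (by omega) (h.mem_band_inner k hk))]
    have := h.orth j k 0
    rw [h.tr_zero] at this
    rw [this, if_neg]
    rintro ⟨rfl, -⟩
    omega
  · exact h.inner_band (h.tr_mem k (-1)) hr (by omega)
  · rw [real_inner_comm, hrg _ (by simpa using h.tr_mem k 1), h.orth, if_neg (by simp)]
  · rw [real_inner_comm, hrg _ (band_mono le_rfl (by omega) (h.low_mem k hk)), h.low_orth k hk]
  · exact h.inner_band (h.tr_mem_band (-1) (h.low_mem k hk)) hr (by omega)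

/-- After translation by `-1` the part lies at positions `-3` to `-1`, where `mem_coarse_of_orth`
can be used; translating back stays in the coarse span. -/
theorem left_part_mem_coarse {r : E} (hr : r ∈ band τ δ φ 1 3) {j : Fin 6}
    (hrg : ∀ g ∈ band τ δ φ (-3) 3, inner ℝ r g = inner ℝ (τ 1 (φ j)) g) : r ∈ h.coarse := by
  have : τ (-1) r ∈ h.coarse := by
    have hb := h.tr_mem_band (-1) hr
    norm_num at hb
    refine h.mem_coarse_of_orth (band_mono (by omega) (by omega) hb) (fun k hk => ?_) (fun k => ?_)
      (fun k hk => ?_) (fun k hk => ?_) fun k hk => ?_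
    · exact h.inner_band (h.mem_band_inner k hk) hb (by omega)
    · rw [LinearIsometry.inner_map_map, real_inner_comm, hrg _ (h.mem_band k), h.inner_tr_left,
        h.orth, if_neg (by simp)]
    · exact h.inner_band (h.tr_mem k 1) hb (by omega)
    · exact h.inner_band (h.low_mem k hk) hb (by omega)
    · rw [LinearIsometry.inner_map_map, real_inner_comm,
        hrg _ (band_mono (by omega) le_rfl (h.low_mem k hk))]
      exact h.scal_wav _ _ _
  have h2 := h.tr_mem_coarse 1 this
  rwa [← h.tr_add, add_neg_cancel, h.tr_zero] at h2

/-- Up to integer translation a fine function sits at one of the positions `0` to `3`. Positions `1`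
to `3` are covered by the spanning set of `mem_span_parts`, and position `0` satisfies
`mem_coarse_of_orth` directly. -/
theorem fine_mem_coarse (s : ℤ × Fin 6) : fine τ δ φ s ∈ h.coarse := by
  have hband : band τ δ φ 1 3 ≤ h.coarse := by
    obtain ⟨r, l, hr, hl⟩ := h.exists_parts
    refine fun f hf => Submodule.span_le.2 ?_ (h.mem_span_parts hr hl hf)
    rintro _ (((⟨j, hj, rfl⟩ | ⟨j, hj, rfl⟩) | ⟨j, hj, rfl⟩) | ⟨j, hj, rfl⟩)
    · simpa [h.tr_zero] using h.scal_mem_coarse 0 j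
    · simpa [h.tr_zero] using h.wav_mem_coarse 0 j
    · exact h.right_part_mem_coarse (hr j).1 hj (hr j).2
    · exact h.left_part_mem_coarse (hl j).1 (hl j).2
  have hdil : ∀ j : Fin 6, 4 ≤ (j : ℕ) → δ 1 (φ j) ∈ h.coarse := fun j hj => by
    have hb := h.dil_mem j hj
    refine h.mem_coarse_of_orth (band_mono (by omega) (by omega) hb) (fun k hk => ?_) (fun k => ?_)
      (fun k hk => ?_) (fun k hk => ?_) fun k hk => ?_
    · simpa [h.tr_zero] using h.inner_tr_dil k j hj 0 (Or.inl hk)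
    · exact h.inner_tr_dil k j hj _ (Or.inr (by omega))
    · exact h.inner_tr_dil k j hj _ (Or.inr (by omega))
    · exact h.inner_band (h.low_mem k hk) hb (by omega)
    · exact h.inner_band (h.tr_mem_band (-1) (h.low_mem k hk)) hb (by omega)
  obtain ⟨n, k⟩ := s
  -- A coarse unit translation moves the fine index by two, so only the parity of `n` matters.
  have h01 : fine τ δ φ (n % 2, k) ∈ h.coarse := by
    rcases Int.emod_two_eq_zero_or_one n with h0 | h0 <;> rw [h0]
    · by_cases hk : (k : ℕ) < 4
      · exact hband (fine_mem_band (by simp [pos, hk]) (by simp [pos, hk]))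
      · have := hdil k (by omega)
        rwa [fine, h.tr_zero]
    · exact hband (fine_mem_band (by simp only [pos]; split_ifs <;> omega)
        (by simp only [pos]; split_ifs <;> omega))
  have := h.tr_mem_coarse (n / 2) h01
  rw [h.tr_fine] at this
  rwa [show 2 * (n / 2) + n % 2 = n by omega] at this

end WaveletSystem

end Abstract

end CubicWavelet

/-! ### Dyadic levels and orthogonality across scales -/

namespace CubicWavelet

section Abstract

variable {E : Type*} [NormedAddCommGroup E] [InnerProductSpace ℝ E]
variable {τ δ : ℤ → E →ₗᵢ[ℝ] E} {φ ψ : Fin 6 → E}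

/-- The span of the dilated translates, at level `j`, of a family of generators. -/
def level (τ δ : ℤ → E →ₗᵢ[ℝ] E) (φ : Fin 6 → E) (j : ℤ) : Submodule ℝ E :=
  Submodule.span ℝ (Set.range fun s : ℤ × Fin 6 => δ j (τ s.1 (φ s.2)))

theorem dil_tr_mem_level (j n : ℤ) (i : Fin 6) : δ j (τ n (φ i)) ∈ level τ δ φ j :=
  Submodule.subset_span ⟨(n, i), rfl⟩

namespace ScalingSystem

variable (h : ScalingSystem τ δ φ)
include h

theorem dil_band_le (j a b : ℤ) {f : E} (hf : f ∈ band τ δ φ a b) :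
    δ j f ∈ level τ δ φ (j + 1) := by
  have : band τ δ φ a b ≤ (level τ δ φ (j + 1)).comap (δ j).toLinearMap := by
    refine Submodule.span_le.2 ?_
    rintro _ ⟨s, -, rfl⟩
    change δ j (δ 1 (τ s.1 (φ s.2))) ∈ level τ δ φ (j + 1)
    rw [← h.dil_add]
    exact dil_tr_mem_level _ _ _
  exact this hf

theorem level_le_succ (j : ℤ) : level τ δ φ j ≤ level τ δ φ (j + 1) := by
  refine Submodule.span_le.2 ?_
  rintro _ ⟨s, rfl⟩
  exact h.dil_band_le j _ _ (h.tr_mem s.2 s.1)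

theorem level_mono {i j : ℤ} (hij : i ≤ j) : level τ δ φ i ≤ level τ δ φ j :=
  (monotone_int_of_le_succ h.level_le_succ) hij

end ScalingSystem

namespace WaveletSystem

variable (h : WaveletSystem τ δ φ ψ)
include h

theorem mem_band_wav (i : Fin 6) : ψ i ∈ band τ δ φ (-3) 3 := by
  by_cases h2 : (i : ℕ) < 2
  · exact band_mono (by omega) le_rfl (h.low_mem i h2)
  by_cases h4 : (i : ℕ) < 4
  · exact h.mid_mem_band i (by omega)
  · exact h.high_mem i (by omega)

theorem wav_mem_level (j n : ℤ) (i : Fin 6) : δ j (τ n (ψ i)) ∈ level τ δ φ (j + 1) :=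
  h.dil_band_le j _ _ (h.tr_mem_band n (h.mem_band_wav i))

theorem inner_level_wav {j n : ℤ} {b : Fin 6} {f : E} (hf : f ∈ level τ δ φ j) :
    inner ℝ f (δ j (τ n (ψ b))) = 0 := by
  refine inner_eq_zero_of_mem_span ?_ hf
  rintro _ ⟨s, rfl⟩
  dsimp only
  rw [LinearIsometry.inner_map_map, real_inner_comm, h.inner_tr_left, real_inner_comm, ← h.tr_add]
  exact h.scal_wav _ _ _

/-- For different levels, the coarser wavelet lies in the scaling space one level up, hence in that
of the finer level, which is orthogonal to the finer wavelets. -/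
theorem inner_dil_wav_wav (i j m n : ℤ) (a b : Fin 6) :
    inner ℝ (δ i (τ m (ψ a))) (δ j (τ n (ψ b))) = if i = j ∧ m = n ∧ a = b then 1 else 0 := by
  rcases lt_trichotomy i j with hij | rfl | hij
  · rw [if_neg (by rintro ⟨rfl, -⟩; exact lt_irrefl _ hij)]
    exact h.inner_level_wav (h.level_mono hij (h.wav_mem_level i m a))
  · rw [LinearIsometry.inner_map_map, h.inner_tr, h.wav_wav]
    simp [sub_eq_zero, eq_comm, and_comm]
  · rw [if_neg (by rintro ⟨rfl, -⟩; exact lt_irrefl _ hij), real_inner_comm]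
    exact h.inner_level_wav (h.level_mono hij (h.wav_mem_level j n b))

theorem level_succ_le (j : ℤ) : level τ δ φ (j + 1) ≤ level τ δ φ j ⊔ level τ δ ψ j := by
  have hc : h.coarse ≤ (level τ δ φ j ⊔ level τ δ ψ j).comap (δ j).toLinearMap := by
    refine sup_le (Submodule.span_le.2 ?_) (Submodule.span_le.2 ?_)
    · rintro _ ⟨s, rfl⟩
      exact Submodule.mem_sup_left (dil_tr_mem_level j s.1 s.2)
    · rintro _ ⟨s, rfl⟩
      exact Submodule.mem_sup_right (dil_tr_mem_level j s.1 s.2)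
  refine Submodule.span_le.2 ?_
  rintro _ ⟨s, rfl⟩
  dsimp only
  rw [h.dil_add]
  exact hc (h.fine_mem_coarse s)

/-- Telescoping of `level_succ_le`. For completeness `K` will consist of the splines orthogonal to a
given element of L². -/
theorem level_le_of_le {K : Submodule ℝ E} (h0 : level τ δ φ 0 ≤ K)
    (hK : ∀ j : ℕ, level τ δ ψ j ≤ K) (j : ℕ) : level τ δ φ j ≤ K := by
  induction j with
  | zero => exact h0
  | succ j ih => exact (by exact_mod_cast h.level_succ_le j : _ ≤ _).trans (sup_le ih (hK j))

end WaveletSystem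

end Abstract

end CubicWavelet

/-! ### The pre-Hilbert space of compactly supported C¹ cubic splines -/

noncomputable section

namespace CubicWavelet

theorem IsCubicSpline.add {f g : ℝ → ℝ} (hf : IsCubicSpline f) (hg : IsCubicSpline g) :
    IsCubicSpline (f + g) := by
  classical
  obtain ⟨s, hs⟩ := hf
  obtain ⟨t, ht⟩ := hg
  refine ⟨s ∪ t, fun a b hab h => ?_⟩
  obtain ⟨p, hp, hp'⟩ := hs a b hab fun y hy => h y (Finset.mem_union_left _ hy)
  obtain ⟨q, hq, hq'⟩ := ht a b hab fun y hy => h y (Finset.mem_union_right _ hy)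
  refine ⟨p + q, (Polynomial.natDegree_add_le _ _).trans (max_le hp hq), fun x hx => ?_⟩
  simp [hp' x hx, hq' x hx]

theorem IsCubicSpline.smul {f : ℝ → ℝ} (c : ℝ) (hf : IsCubicSpline f) : IsCubicSpline (c • f) := by
  obtain ⟨s, hs⟩ := hf
  refine ⟨s, fun a b hab h => ?_⟩
  obtain ⟨p, hp, hp'⟩ := hs a b hab h
  refine ⟨c • p, (Polynomial.natDegree_smul_le _ _).trans hp, fun x hx => ?_⟩
  simp [hp' x hx]

theorem IsCubicSpline.comp_affine {f : ℝ → ℝ} (hf : IsCubicSpline f) {a : ℝ} (ha : 0 < a) (b : ℝ) :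
    IsCubicSpline fun x => f (a * x - b) := by
  classical
  obtain ⟨s, hs⟩ := hf
  refine ⟨s.image fun y => (y + b) / a, fun l r hlr h => ?_⟩
  obtain ⟨p, hp, hp'⟩ := hs (a * l - b) (a * r - b) (by nlinarith) fun y hy hy' => by
    refine h _ (Finset.mem_image_of_mem _ hy) ⟨?_, ?_⟩
    · rw [lt_div_iff₀ ha]; nlinarith [hy'.1]
    · rw [div_lt_iff₀ ha]; nlinarith [hy'.2]
  refine ⟨p.comp (Polynomial.C a * Polynomial.X - Polynomial.C b), ?_, fun x hx => ?_⟩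
  · refine Polynomial.natDegree_comp_le.trans ?_
    have : (Polynomial.C a * Polynomial.X - Polynomial.C b).natDegree ≤ 1 := by
      rw [sub_eq_add_neg, ← Polynomial.C_neg]
      exact Polynomial.natDegree_linear_le
    calc _ ≤ 3 * 1 := Nat.mul_le_mul hp this
      _ = 3 := rfl
  · have := hp' (a * x - b) ⟨by nlinarith [hx.1], by nlinarith [hx.2]⟩
    simp [this]

/-- Compactly supported `C¹` cubic splines. -/
def splineSubmodule : Submodule ℝ (ℝ → ℝ) where
  carrier := {f | ContDiff ℝ 1 f ∧ HasCompactSupport f ∧ IsCubicSpline f}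
  zero_mem' := ⟨contDiff_const, HasCompactSupport.zero,
    ∅, fun _ _ _ _ => ⟨0, by simp, fun _ _ => by simp⟩⟩
  add_mem' := fun hf hg => ⟨hf.1.add hg.1, hf.2.1.add hg.2.1, hf.2.2.add hg.2.2⟩
  smul_mem' := fun c _ hf => ⟨hf.1.const_smul c, hf.2.1.smul_left (f := fun _ => c), hf.2.2.smul c⟩

/-- The type of compactly supported `C¹` cubic splines. -/
def Spline : Type := splineSubmodule

namespace Spline

instance : AddCommGroup Spline := inferInstanceAs (AddCommGroup splineSubmodule)

instance : Module ℝ Spline := inferInstanceAs (Module ℝ splineSubmodule)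

/-- The underlying function. -/
def fn : Spline →ₗ[ℝ] (ℝ → ℝ) := splineSubmodule.subtype

theorem fn_injective : Function.Injective fn := Subtype.val_injective

/-- A spline from a function. -/
def mk (f : ℝ → ℝ) (hf : f ∈ splineSubmodule) : Spline := ⟨f, hf⟩

@[simp] theorem fn_mk (f : ℝ → ℝ) (hf : f ∈ splineSubmodule) : fn (mk f hf) = f := rfl

theorem contDiff (f : Spline) : ContDiff ℝ 1 (fn f) := f.2.1

theorem continuous (f : Spline) : Continuous (fn f) := f.contDiff.continuous

theorem hasCompactSupport (f : Spline) : HasCompactSupport (fn f) := f.2.2.1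

theorem isCubicSpline (f : Spline) : IsCubicSpline (fn f) := f.2.2.2

theorem memLp (f : Spline) : MemLp (fn f) 2 volume :=
  f.continuous.memLp_of_hasCompactSupport f.hasCompactSupport

theorem integrable_mul (f : Spline) {g : ℝ → ℝ} (hg : Continuous g) :
    Integrable (fun x => g x * fn f x) volume :=
  (hg.mul f.continuous).integrable_of_hasCompactSupport f.hasCompactSupport.mul_left

theorem ip_add_left (f g h : Spline) : ip (fn (f + g)) (fn h) = ip (fn f) (fn h) + ip (fn g) (fn h) := by
  simp only [ip, map_add, Pi.add_apply, add_mul]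
  exact integral_add (h.integrable_mul f.continuous) (h.integrable_mul g.continuous)

theorem ip_smul_left (c : ℝ) (f h : Spline) : ip (fn (c • f)) (fn h) = c * ip (fn f) (fn h) := by
  simp only [ip, map_smul, Pi.smul_apply, smul_eq_mul, mul_assoc]
  exact integral_const_mul _ _

/-- Continuity makes the form definite on functions themselves, with no passage to almost-everywhere
classes. -/
theorem ip_self_eq_zero (f : Spline) (h : ip (fn f) (fn f) = 0) : f = 0 := by
  by_contra hf
  have hne : ∃ x, fn f x * fn f x ≠ 0 := by
    by_contra hc
    push Not at hc
    exact hf (fn_injective (by ext x; simpa using hc x))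
  obtain ⟨x, hx⟩ := hne
  have hpos := (f.continuous.mul f.continuous).integral_pos_of_hasCompactSupport_nonneg_nonzero
    (μ := volume) f.hasCompactSupport.mul_left (fun x => mul_self_nonneg _) hx
  rw [ip] at h
  exact hpos.ne' h

/-- The inner product of `L²(ℝ)` on splines. -/
@[reducible] def innerCore : InnerProductSpace.Core ℝ Spline where
  inner f g := ip (fn f) (fn g)
  conj_inner_symm f g := by simp [ip, mul_comm]
  re_inner_nonneg f := integral_nonneg fun x => mul_self_nonneg _
  definite f := ip_self_eq_zero f
  add_left := ip_add_left
  smul_left f g c := ip_smul_left c f g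

instance : NormedAddCommGroup Spline := innerCore.toNormedAddCommGroup

instance : InnerProductSpace ℝ Spline := InnerProductSpace.ofCore innerCore.toCore

theorem inner_eq (f g : Spline) : inner ℝ f g = ip (fn f) (fn g) := rfl

theorem norm_eq (f : Spline) : ‖f‖ = nrm (fn f) := by
  rw [nrm, ← inner_eq, real_inner_self_eq_norm_sq, Real.sqrt_sq (norm_nonneg _)]

theorem ip_rescale (f g : ℝ → ℝ) {a c : ℝ} (ha : 0 < a) (hc : c ^ 2 = a) (b : ℝ) :
    ip (fun x => c * f (a * x - b)) (fun x => c * g (a * x - b)) = ip f g := by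
  have h1 : ∀ x, c * f (a * x - b) * (c * g (a * x - b)) =
      a * (fun y => f (y - b) * g (y - b)) (a * x) := fun x => by rw [← hc]; ring
  simp only [ip, h1]
  rw [integral_const_mul, Measure.integral_comp_mul_left (fun y => f (y - b) * g (y - b)),
    integral_sub_right_eq_self (fun y => f y * g y), abs_of_pos (inv_pos.2 ha), smul_eq_mul,
    mul_inv_cancel_left₀ ha.ne']

theorem rescale_mem (f : Spline) {a : ℝ} (c b : ℝ) (ha : 0 < a) :
    (fun x => c * fn f (a * x - b)) ∈ splineSubmodule := by
  have hs : HasCompactSupport fun x => fn f (a * x - b) :=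
    f.hasCompactSupport.comp_homeomorph
      ((Homeomorph.mulLeft₀ a ha.ne').trans (Homeomorph.subRight b))
  refine ⟨?_, hs.smul_left (f := fun _ => c), (f.isCubicSpline.comp_affine ha b).smul c⟩
  have := f.contDiff
  fun_prop

/-- The isometry `f ↦ c f(a · - b)`, where `c² = a`. -/
def rescale (a c b : ℝ) (ha : 0 < a) (hc : c ^ 2 = a) : Spline →ₗᵢ[ℝ] Spline where
  toFun f := mk (fun x => c * fn f (a * x - b)) (rescale_mem f c b ha)
  map_add' f g := fn_injective (by ext x; simp [mul_add])
  map_smul' r f := fn_injective (by ext x; simp [mul_left_comm])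
  norm_map' f := by
    simp only [norm_eq, nrm]
    congr 1
    exact ip_rescale _ _ ha hc b

@[simp] theorem fn_rescale (a c b : ℝ) (ha : 0 < a) (hc : c ^ 2 = a) (f : Spline) :
    fn (rescale a c b ha hc f) = fun x => c * fn f (a * x - b) := rfl

/-- Integer translations. -/
def tr (n : ℤ) : Spline →ₗᵢ[ℝ] Spline := rescale 1 1 n one_pos (one_pow 2)

theorem fn_tr (n : ℤ) (f : Spline) (x : ℝ) : fn (tr n f) x = fn f (x - n) := by
  simp [tr]

/-- Dyadic dilations. -/
def dil (j : ℤ) : Spline →ₗᵢ[ℝ] Spline :=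
  rescale (2 ^ j) (2 ^ ((j : ℝ) / 2)) 0 (by positivity) (by
    rw [← Real.rpow_natCast, ← Real.rpow_mul zero_le_two, ← Real.rpow_intCast]
    congr 1
    push_cast
    ring)

theorem fn_dil (j : ℤ) (f : Spline) (x : ℝ) :
    fn (dil j f) x = (2 : ℝ) ^ ((j : ℝ) / 2) * fn f (2 ^ j * x) := by
  simp [dil]

theorem dilationSystem : DilationSystem tr dil where
  tr_zero f := fn_injective (by ext x; simp [fn_tr])
  tr_add m n f := fn_injective (by ext x; simp [fn_tr, sub_sub])
  dil_zero f := fn_injective (by ext x; simp [fn_dil])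
  dil_add m n f := fn_injective (by
    ext x
    simp only [fn_dil]
    rw [← mul_assoc, ← mul_assoc, ← Real.rpow_add zero_lt_two, ← zpow_add₀ two_ne_zero]
    congr 2
    · push_cast; ring_nf
    · rw [add_comm])
  tr_dil n f := fn_injective (by
    ext x
    simp only [fn_dil, fn_tr]
    congr 2
    push_cast
    rw [zpow_one, mul_sub])

/-- Vanishing outside a closed interval. -/
def SuppIn (a b : ℝ) : Submodule ℝ Spline where
  carrier := {f | ∀ x, x < a ∨ b < x → fn f x = 0}
  zero_mem' := fun x _ => by simp
  add_mem' := fun hf hg x hx => by simp [hf x hx, hg x hx]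
  smul_mem' := fun c f hf x hx => by simp [hf x hx]

theorem SuppIn.mono {a b c d : ℝ} (h1 : c ≤ a) (h2 : b ≤ d) {f : Spline} (hf : f ∈ SuppIn a b) :
    f ∈ SuppIn c d := fun x hx => hf x (hx.imp (fun h => h.trans_le h1) fun h => h2.trans_lt h)

/-- The two intervals may share an end point; a single point is a null set. -/
theorem SuppIn.inner_eq_zero {a b c d : ℝ} {f g : Spline} (hf : f ∈ SuppIn a b)
    (hg : g ∈ SuppIn c d) (h : b ≤ c ∨ d ≤ a) : inner ℝ f g = 0 := by
  rw [inner_eq, ip]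
  have key : ∀ y : ℝ, (∀ x, x ≠ y → fn f x * fn g x = 0) → ∫ x, fn f x * fn g x = 0 := by
    intro y hy
    refine integral_eq_zero_of_ae ?_
    have : ∀ᵐ x ∂(volume : Measure ℝ), x ≠ y := by
      simp [ae_iff]
    filter_upwards [this] with x hx using hy x hx
  rcases h with h | h
  · refine key b fun x hx => ?_
    rcases lt_or_gt_of_ne hx with h1 | h1
    · rw [hg x (Or.inl (h1.trans_le h)), mul_zero]
    · rw [hf x (Or.inr h1), zero_mul]
  · refine key a fun x hx => ?_
    rcases lt_or_gt_of_ne hx with h1 | h1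
    · rw [hf x (Or.inl h1), zero_mul]
    · rw [hg x (Or.inr (h.trans_lt h1)), mul_zero]

/-- The definition of `SuppIn` says nothing at the end points; continuity adds them. -/
theorem SuppIn.apply_left {a b : ℝ} {f : Spline} (hf : f ∈ SuppIn a b) {x : ℝ} (hx : x ≤ a) :
    fn f x = 0 := by
  have hs : Set.Iic a ⊆ {x | fn f x = 0} := by
    rw [← closure_Iio]
    exact closure_minimal (fun y hy => hf y (Or.inl hy)) (isClosed_eq f.continuous continuous_const)
  exact hs hx

theorem SuppIn.apply_right {a b : ℝ} {f : Spline} (hf : f ∈ SuppIn a b) {x : ℝ} (hx : b ≤ x) :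
    fn f x = 0 := by
  have hs : Set.Ici b ⊆ {x | fn f x = 0} := by
    rw [← closure_Ioi]
    exact closure_minimal (fun y hy => hf y (Or.inr hy)) (isClosed_eq f.continuous continuous_const)
  exact hs hx

theorem SuppIn.tr {a b : ℝ} {f : Spline} (hf : f ∈ SuppIn a b) (n : ℤ) :
    tr n f ∈ SuppIn (a + n) (b + n) := fun x hx => by
  rw [fn_tr]
  exact hf _ (hx.imp (fun h => by linarith) fun h => by linarith)

theorem SuppIn.dil {a b : ℝ} {f : Spline} (hf : f ∈ SuppIn a b) (j : ℤ) :
    dil j f ∈ SuppIn (a / 2 ^ j) (b / 2 ^ j) := fun x hx => by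
  have h2 : (0 : ℝ) < 2 ^ j := by positivity
  rw [fn_dil, hf, mul_zero]
  refine hx.imp (fun h => ?_) fun h => ?_
  · rw [lt_div_iff₀ h2] at h; linarith
  · rw [div_lt_iff₀ h2] at h; linarith

theorem SuppIn.ediam_tsupport_le {a b : ℝ} {f : Spline} (hf : f ∈ SuppIn a b) :
    Metric.ediam (tsupport (fn f)) ≤ ENNReal.ofReal (b - a) := by
  have : tsupport (fn f) ⊆ Set.Icc a b := closure_minimal (fun x hx => by
    by_contra hc
    rw [Set.mem_Icc, not_and_or, not_le, not_le] at hc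
    exact hx (hf x hc)) isClosed_Icc
  exact (Metric.ediam_mono this).trans (Real.ediam_Icc a b).le

end Spline

end CubicWavelet

end

/-! ### The two Hermite generators: refinement, smoothness, inner products -/

noncomputable section

namespace CubicWavelet

theorem hermite1_of_le (x : ℝ) (h : x ≤ -1) : hermite1 x = 0 := by
  rcases h.lt_or_eq with h | rfl
  · rw [hermite1, if_neg (by intro h'; linarith [h'.1]), if_neg (by intro h'; linarith [h'.1])]
  · norm_num [hermite1]

theorem hermite1_of_left (x : ℝ) (h : -1 ≤ x) (h' : x ≤ 0) :
    hermite1 x = (x + 1) ^ 2 * (1 - 2 * x) := if_pos ⟨h, h'⟩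

theorem hermite1_of_right (x : ℝ) (h : 0 ≤ x) (h' : x ≤ 1) :
    hermite1 x = (1 - x) ^ 2 * (1 + 2 * x) := by
  rcases h.lt_or_eq with h | rfl
  · rw [hermite1, if_neg (by intro h'; linarith [h'.2]), if_pos ⟨h.le, h'⟩]
  · norm_num [hermite1]

theorem hermite1_of_ge (x : ℝ) (h : 1 ≤ x) : hermite1 x = 0 := by
  rcases h.lt_or_eq with h | rfl
  · rw [hermite1, if_neg (by intro h'; linarith [h'.2]), if_neg (by intro h'; linarith [h'.2])]
  · norm_num [hermite1]

theorem hermite2_of_le (x : ℝ) (h : x ≤ -1) : hermite2 x = 0 := by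
  rcases h.lt_or_eq with h | rfl
  · rw [hermite2, if_neg (by intro h'; linarith [h'.1]), if_neg (by intro h'; linarith [h'.1])]
  · norm_num [hermite2]

theorem hermite2_of_left (x : ℝ) (h : -1 ≤ x) (h' : x ≤ 0) :
    hermite2 x = (x + 1) ^ 2 * x := if_pos ⟨h, h'⟩

theorem hermite2_of_right (x : ℝ) (h : 0 ≤ x) (h' : x ≤ 1) :
    hermite2 x = (1 - x) ^ 2 * x := by
  rcases h.lt_or_eq with h | rfl
  · rw [hermite2, if_neg (by intro h'; linarith [h'.2]), if_pos ⟨h.le, h'⟩]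
  · norm_num [hermite2]

theorem hermite2_of_ge (x : ℝ) (h : 1 ≤ x) : hermite2 x = 0 := by
  rcases h.lt_or_eq with h | rfl
  · rw [hermite2, if_neg (by intro h'; linarith [h'.2]), if_neg (by intro h'; linarith [h'.2])]
  · norm_num [hermite2]

/-- Both sides are C¹ and piecewise cubic with half-integer knots, so they agree by Hermite
interpolation. The coefficients are the values of `hermite1` at `-1/2, 0, 1/2` and half its
derivatives there, halved because of the dilation. The relation for `hermite2` arises in the same
way. -/
theorem hermite1_refine (x : ℝ) : hermite1 x = 1 / 2 * hermite1 (2 * x + 1) + hermite1 (2 * x)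
    + 1 / 2 * hermite1 (2 * x - 1) + 3 / 4 * hermite2 (2 * x + 1) - 3 / 4 * hermite2 (2 * x - 1) := by
  rcases le_total x (-1) with h1 | h1
  · rw [hermite1_of_le x (by linarith), hermite1_of_le (2 * x + 1) (by linarith),
      hermite1_of_le (2 * x) (by linarith), hermite1_of_le (2 * x - 1) (by linarith),
      hermite2_of_le (2 * x + 1) (by linarith), hermite2_of_le (2 * x - 1) (by linarith)]
    ring
  rcases le_total x (-1 / 2) with h2 | h2
  · rw [hermite1_of_left x (by linarith) (by linarith),
      hermite1_of_left (2 * x + 1) (by linarith) (by linarith),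
      hermite1_of_le (2 * x) (by linarith), hermite1_of_le (2 * x - 1) (by linarith),
      hermite2_of_left (2 * x + 1) (by linarith) (by linarith),
      hermite2_of_le (2 * x - 1) (by linarith)]
    ring
  rcases le_total x 0 with h3 | h3
  · rw [hermite1_of_left x (by linarith) (by linarith),
      hermite1_of_right (2 * x + 1) (by linarith) (by linarith),
      hermite1_of_left (2 * x) (by linarith) (by linarith),
      hermite1_of_le (2 * x - 1) (by linarith),
      hermite2_of_right (2 * x + 1) (by linarith) (by linarith),
      hermite2_of_le (2 * x - 1) (by linarith)]
    ring
  rcases le_total x (1 / 2) with h4 | h4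
  · rw [hermite1_of_right x (by linarith) (by linarith), hermite1_of_ge (2 * x + 1) (by linarith),
      hermite1_of_right (2 * x) (by linarith) (by linarith),
      hermite1_of_left (2 * x - 1) (by linarith) (by linarith),
      hermite2_of_ge (2 * x + 1) (by linarith),
      hermite2_of_left (2 * x - 1) (by linarith) (by linarith)]
    ring
  rcases le_total x 1 with h5 | h5
  · rw [hermite1_of_right x (by linarith) (by linarith), hermite1_of_ge (2 * x + 1) (by linarith),
      hermite1_of_ge (2 * x) (by linarith),
      hermite1_of_right (2 * x - 1) (by linarith) (by linarith),
      hermite2_of_ge (2 * x + 1) (by linarith),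
      hermite2_of_right (2 * x - 1) (by linarith) (by linarith)]
    ring
  · rw [hermite1_of_ge x (by linarith), hermite1_of_ge (2 * x + 1) (by linarith),
      hermite1_of_ge (2 * x) (by linarith), hermite1_of_ge (2 * x - 1) (by linarith),
      hermite2_of_ge (2 * x + 1) (by linarith), hermite2_of_ge (2 * x - 1) (by linarith)]
    ring

theorem hermite2_refine (x : ℝ) : hermite2 x = -1 / 8 * hermite1 (2 * x + 1)
    + 1 / 8 * hermite1 (2 * x - 1) - 1 / 8 * hermite2 (2 * x + 1) + 1 / 2 * hermite2 (2 * x)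
    - 1 / 8 * hermite2 (2 * x - 1) := by
  rcases le_total x (-1) with h1 | h1
  · rw [hermite2_of_le x (by linarith), hermite1_of_le (2 * x + 1) (by linarith),
      hermite1_of_le (2 * x - 1) (by linarith), hermite2_of_le (2 * x + 1) (by linarith),
      hermite2_of_le (2 * x) (by linarith), hermite2_of_le (2 * x - 1) (by linarith)]
    ring
  rcases le_total x (-1 / 2) with h2 | h2
  · rw [hermite2_of_left x (by linarith) (by linarith),
      hermite1_of_left (2 * x + 1) (by linarith) (by linarith),
      hermite1_of_le (2 * x - 1) (by linarith),
      hermite2_of_left (2 * x + 1) (by linarith) (by linarith),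
      hermite2_of_le (2 * x) (by linarith), hermite2_of_le (2 * x - 1) (by linarith)]
    ring
  rcases le_total x 0 with h3 | h3
  · rw [hermite2_of_left x (by linarith) (by linarith),
      hermite1_of_right (2 * x + 1) (by linarith) (by linarith),
      hermite1_of_le (2 * x - 1) (by linarith),
      hermite2_of_right (2 * x + 1) (by linarith) (by linarith),
      hermite2_of_left (2 * x) (by linarith) (by linarith),
      hermite2_of_le (2 * x - 1) (by linarith)]
    ring
  rcases le_total x (1 / 2) with h4 | h4
  · rw [hermite2_of_right x (by linarith) (by linarith), hermite1_of_ge (2 * x + 1) (by linarith),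
      hermite1_of_left (2 * x - 1) (by linarith) (by linarith),
      hermite2_of_ge (2 * x + 1) (by linarith),
      hermite2_of_right (2 * x) (by linarith) (by linarith),
      hermite2_of_left (2 * x - 1) (by linarith) (by linarith)]
    ring
  rcases le_total x 1 with h5 | h5
  · rw [hermite2_of_right x (by linarith) (by linarith), hermite1_of_ge (2 * x + 1) (by linarith),
      hermite1_of_right (2 * x - 1) (by linarith) (by linarith),
      hermite2_of_ge (2 * x + 1) (by linarith), hermite2_of_ge (2 * x) (by linarith),
      hermite2_of_right (2 * x - 1) (by linarith) (by linarith)]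
    ring
  · rw [hermite2_of_ge x (by linarith), hermite1_of_ge (2 * x + 1) (by linarith),
      hermite1_of_ge (2 * x - 1) (by linarith), hermite2_of_ge (2 * x + 1) (by linarith),
      hermite2_of_ge (2 * x) (by linarith), hermite2_of_ge (2 * x - 1) (by linarith)]
    ring

/-- The values at `a` match automatically, as `f a` equals both; only the derivatives need a
hypothesis. -/
theorem contDiff_one_glue {f p q : ℝ → ℝ} {a : ℝ} (hp : ContDiff ℝ 1 p) (hq : ContDiff ℝ 1 q)
    (hfp : ∀ x ≤ a, f x = p x) (hfq : ∀ x, a ≤ x → f x = q x) (hd : deriv p a = deriv q a) :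
    ContDiff ℝ 1 f := by
  have hp' := fun x => ((hp.differentiable one_ne_zero) x).hasDerivAt
  have hq' := fun x => ((hq.differentiable one_ne_zero) x).hasDerivAt
  have hl : ∀ x ≤ a, HasDerivWithinAt f (deriv p x) (Set.Iic a) x := fun x hx =>
    (hp' x).hasDerivWithinAt.congr (fun y hy => hfp y hy) (hfp x hx)
  have hr : ∀ x, a ≤ x → HasDerivWithinAt f (deriv q x) (Set.Ici a) x := fun x hx =>
    (hq' x).hasDerivWithinAt.congr (fun y hy => hfq y hy) (hfq x hx)
  have hf : ∀ x, HasDerivAt f (if x ≤ a then deriv p x else deriv q x) x := by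
    intro x
    rcases lt_trichotomy x a with h | rfl | h
    · rw [if_pos h.le]; exact (hl x h.le).hasDerivAt (Iic_mem_nhds h)
    · rw [if_pos le_rfl]
      have := (hl x le_rfl).union (hd ▸ hr x le_rfl)
      rwa [Set.Iic_union_Ici, hasDerivWithinAt_univ] at this
    · rw [if_neg h.not_ge]; exact (hr x h.le).hasDerivAt (Ici_mem_nhds h)
  rw [contDiff_one_iff_deriv]
  refine ⟨fun x => (hf x).differentiableAt, ?_⟩
  rw [show deriv f = _ from funext fun x => (hf x).deriv]
  exact (hp.continuous_deriv le_rfl).if_le (hq.continuous_deriv le_rfl) continuous_id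
    continuous_const fun x hx => by rw [hx]; exact hd

theorem contDiff_of_pieces {f p q : ℝ → ℝ} (hp : ContDiff ℝ 1 p) (hq : ContDiff ℝ 1 q)
    (h0 : ∀ x ≤ -1, f x = 0) (h1 : ∀ x, -1 ≤ x → x ≤ 0 → f x = p x)
    (h2 : ∀ x, 0 ≤ x → x ≤ 1 → f x = q x) (h3 : ∀ x, 1 ≤ x → f x = 0)
    (d0 : deriv p (-1) = 0) (d1 : deriv p 0 = deriv q 0) (d2 : deriv q 1 = 0) :
    ContDiff ℝ 1 f := by
  have e0 : p (-1) = 0 := by rw [← h1 (-1) le_rfl (by norm_num), h0 _ le_rfl]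
  have e1 : p 0 = q 0 := by rw [← h1 0 (by norm_num) le_rfl, h2 0 le_rfl zero_le_one]
  have hA : ContDiff ℝ 1 (fun x => if x ≤ -1 then 0 else p x) := by
    refine contDiff_one_glue (a := -1) (p := fun _ => 0) (q := p) contDiff_const hp
      (fun x hx => if_pos hx) (fun x hx => ?_) (by simp [d0])
    rcases hx.lt_or_eq with h | rfl
    · exact if_neg h.not_ge
    · simp [e0]
  have hB : ContDiff ℝ 1 (fun x => if x ≤ 0 then (if x ≤ -1 then 0 else p x) else q x) := by
    refine contDiff_one_glue (a := 0) hA hq (fun x hx => if_pos hx) (fun x hx => ?_) ?_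
    · rcases hx.lt_or_eq with h | rfl
      · exact if_neg h.not_ge
      · norm_num [e1]
    · rw [← d1]
      refine Filter.EventuallyEq.deriv_eq ?_
      filter_upwards [Ioi_mem_nhds (show (-1 : ℝ) < 0 by norm_num)] with x hx
      exact if_neg (not_le.2 hx)
  refine contDiff_one_glue (a := 1) hB (contDiff_const (c := 0)) (fun x hx => ?_) h3 ?_
  · split_ifs with i j
    · exact h0 x j
    · exact h1 x (not_le.1 j).le i
    · exact h2 x (not_le.1 i).le hx
  · rw [deriv_const]
    refine (Filter.EventuallyEq.deriv_eq ?_).trans d2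
    filter_upwards [Ioi_mem_nhds (show (0 : ℝ) < 1 by norm_num)] with x hx
    exact if_neg (not_le.2 hx)

theorem isCubicSpline_of_pieces {f : ℝ → ℝ} {p q : Polynomial ℝ} (hp : p.natDegree ≤ 3)
    (hq : q.natDegree ≤ 3) (h0 : ∀ x ≤ -1, f x = 0)
    (h1 : ∀ x, -1 ≤ x → x ≤ 0 → f x = p.eval x)
    (h2 : ∀ x, 0 ≤ x → x ≤ 1 → f x = q.eval x) (h3 : ∀ x, 1 ≤ x → f x = 0) :
    IsCubicSpline f := by
  refine ⟨{-1, 0, 1}, fun a b hab h => ?_⟩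
  have hm : ∀ y ∈ ({-1, 0, 1} : Finset ℝ), b ≤ y ∨ y ≤ a := fun y hy => by
    have := h y hy
    rw [Set.mem_Ioo, not_and_or, not_lt, not_lt] at this
    exact this.symm
  rcases hm (-1) (by simp) with h' | h'
  · exact ⟨0, by simp, fun x hx => by rw [h0 x (hx.2.le.trans h')]; simp⟩
  rcases hm 0 (by simp) with h'' | h''
  · exact ⟨p, hp, fun x hx => h1 x (h'.trans hx.1.le) (hx.2.le.trans h'')⟩
  rcases hm 1 (by simp) with h''' | h'''
  · exact ⟨q, hq, fun x hx => h2 x (h''.trans hx.1.le) (hx.2.le.trans h''')⟩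
  · exact ⟨0, by simp, fun x hx => by rw [h3 x (h'''.trans hx.1.le)]; simp⟩

theorem hasCompactSupport_of_pieces {f : ℝ → ℝ} (h0 : ∀ x ≤ -1, f x = 0)
    (h3 : ∀ x, 1 ≤ x → f x = 0) : HasCompactSupport f :=
  HasCompactSupport.intro (isCompact_Icc (a := (-1 : ℝ)) (b := 1)) fun x hx => by
    rw [Set.mem_Icc, not_and_or, not_le, not_le] at hx
    exact hx.elim (fun h => h0 x h.le) fun h => h3 x h.le

theorem deriv_cubic (a b c d x : ℝ) :
    deriv (fun x => a + b * x + c * x ^ 2 + d * x ^ 3) x = b + 2 * c * x + 3 * d * x ^ 2 := by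
  have h := (((hasDerivAt_const x a).add ((hasDerivAt_id x).const_mul b)).add
    ((hasDerivAt_pow 2 x).const_mul c)).add ((hasDerivAt_pow 3 x).const_mul d)
  refine (h.congr_deriv ?_).deriv
  push_cast
  ring

theorem hermite1_mem : hermite1 ∈ splineSubmodule := by
  refine ⟨?_, hasCompactSupport_of_pieces hermite1_of_le hermite1_of_ge, ?_⟩
  · refine contDiff_of_pieces (p := fun x => 1 + 0 * x + (-3) * x ^ 2 + (-2) * x ^ 3)
      (q := fun x => 1 + 0 * x + (-3) * x ^ 2 + 2 * x ^ 3) (by fun_prop) (by fun_prop) hermite1_of_le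
      (fun x h h' => by rw [hermite1_of_left x h h']; ring)
      (fun x h h' => by rw [hermite1_of_right x h h']; ring) hermite1_of_ge ?_ ?_ ?_ <;>
    simp only [deriv_cubic] <;> norm_num
  · open Polynomial in
    refine isCubicSpline_of_pieces (p := C 1 - C 3 * X ^ 2 - C 2 * X ^ 3)
      (q := C 1 - C 3 * X ^ 2 + C 2 * X ^ 3) (by compute_degree) (by compute_degree) hermite1_of_le
      (fun x h h' => by rw [hermite1_of_left x h h']; simp; ring)
      (fun x h h' => by rw [hermite1_of_right x h h']; simp; ring) hermite1_of_ge

theorem hermite2_mem : hermite2 ∈ splineSubmodule := by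
  refine ⟨?_, hasCompactSupport_of_pieces hermite2_of_le hermite2_of_ge, ?_⟩
  · refine contDiff_of_pieces (p := fun x => 0 + 1 * x + 2 * x ^ 2 + 1 * x ^ 3)
      (q := fun x => 0 + 1 * x + (-2) * x ^ 2 + 1 * x ^ 3) (by fun_prop) (by fun_prop) hermite2_of_le
      (fun x h h' => by rw [hermite2_of_left x h h']; ring)
      (fun x h h' => by rw [hermite2_of_right x h h']; ring) hermite2_of_ge ?_ ?_ ?_ <;>
    simp only [deriv_cubic] <;> norm_num
  · open Polynomial in
    refine isCubicSpline_of_pieces (p := X + C 2 * X ^ 2 + X ^ 3)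
      (q := X - C 2 * X ^ 2 + X ^ 3) (by compute_degree) (by compute_degree) hermite2_of_le
      (fun x h h' => by rw [hermite2_of_left x h h']; simp; ring)
      (fun x h h' => by rw [hermite2_of_right x h h']; simp; ring) hermite2_of_ge

/-- A product of two cubic pieces has degree at most six, so this formula evaluates every inner
product of Hermite generators. -/
theorem integral_poly_six (a b : ℝ) (c : Fin 7 → ℝ) :
    ∫ x in a..b, ∑ i, c i * x ^ (i : ℕ) = ∑ i, c i * ((b ^ ((i : ℕ) + 1) - a ^ ((i : ℕ) + 1)) / ((i : ℕ) + 1)) := by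
  rw [intervalIntegral.integral_finsetSum fun i _ => by
    apply Continuous.intervalIntegrable; fun_prop]
  simp [intervalIntegral.integral_const_mul, integral_pow]

theorem ip_eq_intervalIntegral {f g : ℝ → ℝ} {a b : ℝ} (hab : a ≤ b)
    (h : ∀ x, x ≤ a ∨ b ≤ x → f x * g x = 0) : ip f g = ∫ x in a..b, f x * g x := by
  rw [ip, intervalIntegral.integral_of_le hab,
    setIntegral_eq_integral_of_forall_compl_eq_zero fun x hx => h x ?_]
  rw [Set.mem_Ioc, not_and_or, not_lt, not_le] at hx
  exact hx.imp_right le_of_lt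

theorem ip_of_pieces {f g : ℝ → ℝ} {a b : ℝ} (hab : a ≤ b) (c : Fin 7 → ℝ)
    (h : ∀ x, x ≤ a ∨ b ≤ x → f x * g x = 0)
    (hc : ∀ x, a ≤ x → x ≤ b → f x * g x = ∑ i, c i * x ^ (i : ℕ)) :
    ip f g = ∑ i, c i * ((b ^ ((i : ℕ) + 1) - a ^ ((i : ℕ) + 1)) / ((i : ℕ) + 1)) := by
  rw [ip_eq_intervalIntegral hab h, ← integral_poly_six]
  refine intervalIntegral.integral_congr fun x hx => ?_
  rw [Set.uIcc_of_le hab] at hx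
  exact hc x hx.1 hx.2

theorem ip_of_two_pieces {f g : ℝ → ℝ} (hf : Continuous f) (hg : Continuous g) (c d : Fin 7 → ℝ)
    (h : ∀ x, x ≤ -1 ∨ 1 ≤ x → f x * g x = 0)
    (hc : ∀ x, -1 ≤ x → x ≤ 0 → f x * g x = ∑ i, c i * x ^ (i : ℕ))
    (hd : ∀ x, 0 ≤ x → x ≤ 1 → f x * g x = ∑ i, d i * x ^ (i : ℕ)) :
    ip f g = ∑ i, c i * ((0 ^ ((i : ℕ) + 1) - (-1) ^ ((i : ℕ) + 1)) / ((i : ℕ) + 1))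
      + ∑ i, d i * ((1 ^ ((i : ℕ) + 1) - 0 ^ ((i : ℕ) + 1)) / ((i : ℕ) + 1)) := by
  have hi : ∀ a b, IntervalIntegrable (fun x => f x * g x) volume a b :=
    fun a b => (hf.mul hg).intervalIntegrable a b
  rw [ip_eq_intervalIntegral (by norm_num) h,
    ← intervalIntegral.integral_add_adjacent_intervals (hi (-1) 0) (hi 0 1),
    ← integral_poly_six, ← integral_poly_six]
  congr 1
  · refine intervalIntegral.integral_congr fun x hx => ?_
    rw [Set.uIcc_of_le (by norm_num)] at hx
    exact hc x hx.1 hx.2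
  · refine intervalIntegral.integral_congr fun x hx => ?_
    rw [Set.uIcc_of_le (by norm_num)] at hx
    exact hd x hx.1 hx.2

theorem ip_hermite1_hermite1 : ip hermite1 hermite1 = 26 / 35 := by
  rw [ip_of_two_pieces hermite1_mem.1.continuous hermite1_mem.1.continuous
    ![1, 0, -6, -4, 9, 12, 4] ![1, 0, -6, 4, 9, -12, 4]
    (fun x hx => hx.elim (fun h => by rw [hermite1_of_le x h, zero_mul])
      fun h => by rw [hermite1_of_ge x h, zero_mul])
    (fun x h h' => by rw [hermite1_of_left x h h']; simp [Fin.sum_univ_succ]; ring)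
    (fun x h h' => by rw [hermite1_of_right x h h']; simp [Fin.sum_univ_succ]; ring)]
  norm_num [Fin.sum_univ_succ]

theorem ip_hermite1_hermite2 : ip hermite1 hermite2 = 0 := by
  rw [ip_of_two_pieces hermite1_mem.1.continuous hermite2_mem.1.continuous
    ![0, 1, 2, -2, -8, -7, -2] ![0, 1, -2, -2, 8, -7, 2]
    (fun x hx => hx.elim (fun h => by rw [hermite1_of_le x h, zero_mul])
      fun h => by rw [hermite1_of_ge x h, zero_mul])
    (fun x h h' => by
      rw [hermite1_of_left x h h', hermite2_of_left x h h']; simp [Fin.sum_univ_succ]; ring)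
    (fun x h h' => by
      rw [hermite1_of_right x h h', hermite2_of_right x h h']; simp [Fin.sum_univ_succ]; ring)]
  norm_num [Fin.sum_univ_succ]

theorem ip_hermite2_hermite2 : ip hermite2 hermite2 = 2 / 105 := by
  rw [ip_of_two_pieces hermite2_mem.1.continuous hermite2_mem.1.continuous
    ![0, 0, 1, 4, 6, 4, 1] ![0, 0, 1, -4, 6, -4, 1]
    (fun x hx => hx.elim (fun h => by rw [hermite2_of_le x h, zero_mul])
      fun h => by rw [hermite2_of_ge x h, zero_mul])
    (fun x h h' => by rw [hermite2_of_left x h h']; simp [Fin.sum_univ_succ]; ring)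
    (fun x h h' => by rw [hermite2_of_right x h h']; simp [Fin.sum_univ_succ]; ring)]
  norm_num [Fin.sum_univ_succ]

theorem ip_hermite1_hermite1_shift : ip hermite1 (fun x => hermite1 (x - 1)) = 9 / 70 := by
  rw [ip_of_pieces zero_le_one ![0, 0, 3, -2, -9, 12, -4]
    (fun x hx => hx.elim (fun h => by rw [hermite1_of_le (x - 1) (by linarith), mul_zero])
      fun h => by rw [hermite1_of_ge x h, zero_mul])
    (fun x h h' => by
      rw [hermite1_of_right x h h', hermite1_of_left (x - 1) (by linarith) (by linarith)]
      simp [Fin.sum_univ_succ]; ring)]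
  norm_num [Fin.sum_univ_succ]

theorem ip_hermite1_hermite2_shift : ip hermite1 (fun x => hermite2 (x - 1)) = -13 / 420 := by
  rw [ip_of_pieces zero_le_one ![0, 0, -1, 1, 3, -5, 2]
    (fun x hx => hx.elim (fun h => by rw [hermite2_of_le (x - 1) (by linarith), mul_zero])
      fun h => by rw [hermite1_of_ge x h, zero_mul])
    (fun x h h' => by
      rw [hermite1_of_right x h h', hermite2_of_left (x - 1) (by linarith) (by linarith)]
      simp [Fin.sum_univ_succ]; ring)]
  norm_num [Fin.sum_univ_succ]

theorem ip_hermite2_hermite1_shift : ip hermite2 (fun x => hermite1 (x - 1)) = 13 / 420 := by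
  rw [ip_of_pieces zero_le_one ![0, 0, 0, 3, -8, 7, -2]
    (fun x hx => hx.elim (fun h => by rw [hermite1_of_le (x - 1) (by linarith), mul_zero])
      fun h => by rw [hermite2_of_ge x h, zero_mul])
    (fun x h h' => by
      rw [hermite2_of_right x h h', hermite1_of_left (x - 1) (by linarith) (by linarith)]
      simp [Fin.sum_univ_succ]; ring)]
  norm_num [Fin.sum_univ_succ]

theorem ip_hermite2_hermite2_shift : ip hermite2 (fun x => hermite2 (x - 1)) = -1 / 140 := by
  rw [ip_of_pieces zero_le_one ![0, 0, 0, -1, 3, -3, 1]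
    (fun x hx => hx.elim (fun h => by rw [hermite2_of_le (x - 1) (by linarith), mul_zero])
      fun h => by rw [hermite2_of_ge x h, zero_mul])
    (fun x h h' => by
      rw [hermite2_of_right x h h', hermite2_of_left (x - 1) (by linarith) (by linarith)]
      simp [Fin.sum_univ_succ]; ring)]
  norm_num [Fin.sum_univ_succ]

end CubicWavelet

end

/-! ### The spline spaces `V j`: Gram matrix, two-scale relations, coordinates on `[0,1]` -/

noncomputable section

namespace CubicWavelet

namespace Spline

/-- The two Hermite generators, selected by parity. -/
def herm (m : ℤ) : Spline :=
  if m % 2 = 0 then mk hermite1 hermite1_mem else mk hermite2 hermite2_mem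

/-- The splines `ξ_{j,m}`. -/
def X (j m : ℤ) : Spline := dil j (tr (m / 2) (herm m))

theorem fn_herm (m : ℤ) : fn (herm m) = if m % 2 = 0 then hermite1 else hermite2 := by
  rw [herm]; split_ifs <;> rfl

theorem fn_X (j m : ℤ) : fn (X j m) = xi j m := by
  ext x
  rw [X, fn_dil, fn_tr, fn_herm, xi]

theorem herm_suppIn (m : ℤ) : herm m ∈ SuppIn (-1) 1 := fun x hx => by
  rw [fn_herm]
  split_ifs
  · exact hx.elim (fun h => hermite1_of_le x h.le) fun h => hermite1_of_ge x h.le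
  · exact hx.elim (fun h => hermite2_of_le x h.le) fun h => hermite2_of_ge x h.le

theorem herm_congr {m n : ℤ} (h : m % 2 = n % 2) : herm m = herm n := by
  rw [herm, herm, h]

theorem X_suppIn (j m : ℤ) :
    X j m ∈ SuppIn ((-1 + ((m / 2 : ℤ) : ℝ)) / 2 ^ j) ((1 + ((m / 2 : ℤ) : ℝ)) / 2 ^ j) :=
  SuppIn.dil (SuppIn.tr (herm_suppIn m) _) _

theorem dil_X (i j m : ℤ) : dil i (X j m) = X (i + j) m := by
  rw [X, X, dilationSystem.dil_add]

theorem tr_X_zero (n m : ℤ) : tr n (X 0 m) = X 0 (m + 2 * n) := by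
  rw [X, X, dilationSystem.dil_zero, dilationSystem.dil_zero, ← dilationSystem.tr_add,
    show (m + 2 * n) / 2 = n + m / 2 by omega, herm_congr (show m % 2 = (m + 2 * n) % 2 by omega)]

theorem tr_X_one (n m : ℤ) : tr n (X 1 m) = X 1 (m + 4 * n) := by
  have : X 1 m = dil 1 (X 0 m) := by rw [dil_X]; rfl
  rw [this, dilationSystem.tr_dil, tr_X_zero, dil_X]
  congr 1
  ring

/-- The inner products of the `ξ_{j,m}` at one level. -/
def gram (m n : ℤ) : ℝ :=
  if n / 2 - m / 2 = 0 then
    (if m % 2 = n % 2 then (if m % 2 = 0 then 26 / 35 else 2 / 105) else 0)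
  else if n / 2 - m / 2 = 1 then
    (if m % 2 = 0 then (if n % 2 = 0 then 9 / 70 else -13 / 420)
      else (if n % 2 = 0 then 13 / 420 else -1 / 140))
  else if n / 2 - m / 2 = -1 then
    (if n % 2 = 0 then (if m % 2 = 0 then 9 / 70 else -13 / 420)
      else (if m % 2 = 0 then 13 / 420 else -1 / 140))
  else 0

theorem ip_comm (f g : ℝ → ℝ) : ip f g = ip g f := by
  simp only [ip, mul_comm]

theorem inner_herm (m n : ℤ) : inner ℝ (herm m) (herm n) =
    if m % 2 = n % 2 then (if m % 2 = 0 then 26 / 35 else 2 / 105) else 0 := by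
  rw [inner_eq, fn_herm, fn_herm]
  rcases Int.emod_two_eq_zero_or_one m with hm | hm <;>
    rcases Int.emod_two_eq_zero_or_one n with hn | hn <;> simp only [hm, hn]
  · simpa using ip_hermite1_hermite1
  · simpa using ip_hermite1_hermite2
  · simpa using (ip_comm _ _).trans ip_hermite1_hermite2
  · simpa using ip_hermite2_hermite2

theorem inner_herm_shift (m n : ℤ) : inner ℝ (herm m) (tr 1 (herm n)) =
    if m % 2 = 0 then (if n % 2 = 0 then 9 / 70 else -13 / 420)
      else (if n % 2 = 0 then 13 / 420 else -1 / 140) := by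
  have h : fn (tr 1 (herm n)) = fun x => fn (herm n) (x - 1) := by
    ext x; simp [fn_tr]
  rw [inner_eq, h, fn_herm, fn_herm]
  rcases Int.emod_two_eq_zero_or_one m with hm | hm <;>
    rcases Int.emod_two_eq_zero_or_one n with hn | hn <;> simp only [hm, hn]
  · simpa using ip_hermite1_hermite1_shift
  · simpa using ip_hermite1_hermite2_shift
  · simpa using ip_hermite2_hermite1_shift
  · simpa using ip_hermite2_hermite2_shift

theorem inner_X (j m n : ℤ) : inner ℝ (X j m) (X j n) = gram m n := by
  rw [X, X, LinearIsometry.inner_map_map, gram, dilationSystem.inner_tr]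
  by_cases h0 : n / 2 - m / 2 = 0
  · rw [if_pos h0, h0, dilationSystem.tr_zero, inner_herm]
  rw [if_neg h0]
  by_cases h1 : n / 2 - m / 2 = 1
  · rw [if_pos h1, h1, inner_herm_shift]
  rw [if_neg h1]
  by_cases h2 : n / 2 - m / 2 = -1
  · rw [if_pos h2, h2, ← inner_herm_shift, ← dilationSystem.inner_tr_left, real_inner_comm]
  rw [if_neg h2]
  have hs := SuppIn.tr (herm_suppIn n) (n / 2 - m / 2)
  refine SuppIn.inner_eq_zero (herm_suppIn m) hs ?_
  rcases (by omega : 2 ≤ n / 2 - m / 2 ∨ n / 2 - m / 2 ≤ -2) with h | h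
  · left
    have : (2 : ℝ) ≤ ((n / 2 - m / 2 : ℤ) : ℝ) := by exact_mod_cast h
    linarith
  · right
    have : ((n / 2 - m / 2 : ℤ) : ℝ) ≤ -2 := by exact_mod_cast h
    linarith

/-- The level-`j` spline space. -/
def V (j : ℤ) : Submodule ℝ Spline := Submodule.span ℝ (Set.range (X j))

theorem X_mem_V (j m : ℤ) : X j m ∈ V j := Submodule.subset_span ⟨m, rfl⟩

theorem exists_eq_dil_of_mem_V {j : ℤ} {f : Spline} (hf : f ∈ V (j + 1)) :
    ∃ g ∈ V j, dil 1 g = f := by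
  have : V (j + 1) ≤ (V j).map (dil 1).toLinearMap := by
    refine Submodule.span_le.2 ?_
    rintro _ ⟨m, rfl⟩
    exact ⟨X j m, X_mem_V j m, (dil_X 1 j m).trans (by rw [add_comm])⟩
  exact this hf

/-- The value `√2` of the normalizing factor at level one. -/
abbrev rootTwo : ℝ := (2 : ℝ) ^ (((1 : ℤ) : ℝ) / 2)

theorem rootTwo_pos : 0 < rootTwo := by positivity

theorem rootTwo_sq : rootTwo ^ 2 = 2 := by
  rw [rootTwo, ← Real.rpow_natCast, ← Real.rpow_mul zero_le_two]
  norm_num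

theorem fn_dil_one (f : Spline) (x : ℝ) : fn (dil 1 f) x = rootTwo * fn f (2 * x) := by
  rw [fn_dil, zpow_one]

theorem fn_X_one (m : ℤ) (x : ℝ) :
    fn (X 1 m) x = rootTwo * fn (herm m) (2 * x - ((m / 2 : ℤ) : ℝ)) := by
  rw [X, fn_dil_one, fn_tr]

/-- The index encodes node and type: `2k` is the first Hermite function at `k`, and `2k + 1` the
second. The factor `rootTwo⁻¹` undoes the L² normalization of level one. -/
theorem X_zero_even (m : ℤ) (h : m % 2 = 0) : X 0 m = rootTwo⁻¹ • ((1 / 2 : ℝ) • X 1 (2 * m - 2)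
    + X 1 (2 * m) + (1 / 2 : ℝ) • X 1 (2 * m + 2) + (3 / 4 : ℝ) • X 1 (2 * m - 1)
    - (3 / 4 : ℝ) • X 1 (2 * m + 3)) := fn_injective (by
  have hc := rootTwo_pos.ne'
  ext x
  simp only [map_smul, map_add, map_sub, Pi.smul_apply, Pi.add_apply, Pi.sub_apply, smul_eq_mul,
    fn_X_one, fn_herm]
  rw [X, dilationSystem.dil_zero, fn_tr, fn_herm, if_pos h, if_pos (by omega), if_pos (by omega),
    if_pos (by omega), if_neg (by omega), if_neg (by omega),
    show (2 * m - 2) / 2 = 2 * (m / 2) - 1 by omega, show 2 * m / 2 = 2 * (m / 2) by omega,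
    show (2 * m + 2) / 2 = 2 * (m / 2) + 1 by omega, show (2 * m - 1) / 2 = 2 * (m / 2) - 1 by omega,
    show (2 * m + 3) / 2 = 2 * (m / 2) + 1 by omega, hermite1_refine]
  field_simp
  push_cast
  ring_nf)

theorem X_zero_odd (m : ℤ) (h : m % 2 = 1) : X 0 m = rootTwo⁻¹ • ((-1 / 8 : ℝ) • X 1 (2 * m - 4)
    + (1 / 8 : ℝ) • X 1 (2 * m) - (1 / 8 : ℝ) • X 1 (2 * m - 3) + (1 / 2 : ℝ) • X 1 (2 * m - 1)
    - (1 / 8 : ℝ) • X 1 (2 * m + 1)) := fn_injective (by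
  have hc := rootTwo_pos.ne'
  ext x
  simp only [map_smul, map_add, map_sub, Pi.smul_apply, Pi.add_apply, Pi.sub_apply, smul_eq_mul,
    fn_X_one, fn_herm]
  rw [X, dilationSystem.dil_zero, fn_tr, fn_herm, if_neg (by omega), if_pos (by omega),
    if_pos (by omega), if_neg (by omega), if_neg (by omega), if_neg (by omega),
    show (2 * m - 4) / 2 = 2 * (m / 2) - 1 by omega, show 2 * m / 2 = 2 * (m / 2) + 1 by omega,
    show (2 * m - 3) / 2 = 2 * (m / 2) - 1 by omega, show (2 * m - 1) / 2 = 2 * (m / 2) by omega,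
    show (2 * m + 1) / 2 = 2 * (m / 2) + 1 by omega, hermite2_refine]
  field_simp
  push_cast
  ring_nf)

theorem X_even (j m : ℤ) (h : m % 2 = 0) : X j m = rootTwo⁻¹ • ((1 / 2 : ℝ) • X (j + 1) (2 * m - 2)
    + X (j + 1) (2 * m) + (1 / 2 : ℝ) • X (j + 1) (2 * m + 2) + (3 / 4 : ℝ) • X (j + 1) (2 * m - 1)
    - (3 / 4 : ℝ) • X (j + 1) (2 * m + 3)) := by
  have := congrArg (dil j) (X_zero_even m h)
  simpa only [map_smul, map_add, map_sub, dil_X, add_zero] using this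

theorem X_odd (j m : ℤ) (h : m % 2 = 1) : X j m = rootTwo⁻¹ • ((-1 / 8 : ℝ) • X (j + 1) (2 * m - 4)
    + (1 / 8 : ℝ) • X (j + 1) (2 * m) - (1 / 8 : ℝ) • X (j + 1) (2 * m - 3)
    + (1 / 2 : ℝ) • X (j + 1) (2 * m - 1) - (1 / 8 : ℝ) • X (j + 1) (2 * m + 1)) := by
  have := congrArg (dil j) (X_zero_odd m h)
  simpa only [map_smul, map_add, map_sub, dil_X, add_zero] using this

theorem V_le_succ (j : ℤ) : V j ≤ V (j + 1) := by
  refine Submodule.span_le.2 ?_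
  rintro _ ⟨m, rfl⟩
  have hm := fun n => X_mem_V (j + 1) n
  rcases Int.emod_two_eq_zero_or_one m with h | h
  · rw [X_even j m h]
    exact Submodule.smul_mem _ _ (sub_mem (add_mem (add_mem (add_mem (Submodule.smul_mem _ _ (hm _))
      (hm _)) (Submodule.smul_mem _ _ (hm _))) (Submodule.smul_mem _ _ (hm _)))
      (Submodule.smul_mem _ _ (hm _)))
  · rw [X_odd j m h]
    exact Submodule.smul_mem _ _ (sub_mem (add_mem (sub_mem (add_mem (Submodule.smul_mem _ _ (hm _))
      (Submodule.smul_mem _ _ (hm _))) (Submodule.smul_mem _ _ (hm _)))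
      (Submodule.smul_mem _ _ (hm _))) (Submodule.smul_mem _ _ (hm _)))

/-- Only the six level-one splines at the nodes `0`, `1/2`, `1` can be nonzero on `[0,1]`. -/
theorem exists_coords_of_mem_V {f : Spline} (hf : f ∈ V 1) :
    ∃ d : Fin 6 → ℝ, ∀ x, 0 ≤ x → x ≤ 1 → fn f x = fn (∑ i : Fin 6, d i • X 1 (i : ℤ)) x := by
  induction hf using Submodule.span_induction with
  | mem f hf =>
    obtain ⟨m, rfl⟩ := hf
    by_cases hm : 0 ≤ m ∧ m < 6
    · obtain ⟨h0, h6⟩ := hm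
      refine ⟨Pi.single ⟨m.toNat, by omega⟩ 1, fun x _ _ => ?_⟩
      rw [Finset.sum_eq_single ⟨m.toNat, by omega⟩]
      · simp [h0]
      · intro i _ hi
        simp [Pi.single_eq_of_ne hi]
      · simp
    · refine ⟨0, fun x h0 h1 => ?_⟩
      simp only [Pi.zero_apply, zero_smul, Finset.sum_const_zero, map_zero]
      rcases (by omega : m / 2 ≤ -1 ∨ 3 ≤ m / 2) with h | h
      · refine SuppIn.apply_right (X_suppIn 1 m) ?_
        have : ((m / 2 : ℤ) : ℝ) ≤ -1 := by exact_mod_cast h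
        rw [zpow_one]
        linarith
      · refine SuppIn.apply_left (X_suppIn 1 m) ?_
        have : (3 : ℝ) ≤ ((m / 2 : ℤ) : ℝ) := by exact_mod_cast h
        rw [zpow_one]
        linarith
  | zero => exact ⟨0, fun x _ _ => by simp⟩
  | add f g _ _ hf hg =>
    obtain ⟨d, hd⟩ := hf
    obtain ⟨e, he⟩ := hg
    refine ⟨d + e, fun x h0 h1 => ?_⟩
    simp only [Pi.add_apply, add_smul, Finset.sum_add_distrib, map_add, hd x h0 h1, he x h0 h1]
  | smul c f _ hf =>
    obtain ⟨d, hd⟩ := hf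
    refine ⟨c • d, fun x h0 h1 => ?_⟩
    simp only [Pi.smul_apply, smul_eq_mul, mul_smul, ← Finset.smul_sum, map_smul, hd x h0 h1]

/-- Differentiation within a nondegenerate interval is unique, so one-sided agreement is enough at
an end point. -/
theorem deriv_eq_of_eqOn_Icc {f g : ℝ → ℝ} (hf : Differentiable ℝ f) (hg : Differentiable ℝ g)
    {a b x : ℝ} (hab : a < b) (hx : x ∈ Set.Icc a b) (h : ∀ y, a ≤ y → y ≤ b → f y = g y) :
    deriv f x = deriv g x := by
  have hu := uniqueDiffOn_Icc hab x hx
  rw [← (hf x).derivWithin hu, ← (hg x).derivWithin hu]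
  exact derivWithin_congr (fun y hy => h y hy.1 hy.2) (h x hx.1 hx.2)

theorem differentiable (f : Spline) : Differentiable ℝ (fn f) :=
  f.contDiff.differentiable one_ne_zero

theorem SuppIn.deriv_left {a b : ℝ} {f : Spline} (hf : f ∈ SuppIn a b) : deriv (fn f) a = 0 := by
  rw [deriv_eq_of_eqOn_Icc f.differentiable (differentiable_const (0 : ℝ)) (sub_one_lt a)
    ⟨(sub_one_lt a).le, le_rfl⟩ fun y _ hy => SuppIn.apply_left hf hy]
  simp

theorem SuppIn.deriv_right {a b : ℝ} {f : Spline} (hf : f ∈ SuppIn a b) : deriv (fn f) b = 0 := by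
  rw [deriv_eq_of_eqOn_Icc f.differentiable (differentiable_const (0 : ℝ)) (lt_add_one b)
    ⟨le_rfl, (lt_add_one b).le⟩ fun y hy _ => SuppIn.apply_right hf hy]
  simp

/-- A level-one spline agreeing on `[0, 1]` with a spline supported there has no boundary part. -/
theorem boundary_coords_eq_zero {d : Fin 6 → ℝ} {w : Spline} (hw : w ∈ SuppIn 0 1)
    (h : ∀ x, 0 ≤ x → x ≤ 1 → fn (∑ i : Fin 6, d i • X 1 (i : ℤ)) x = fn w x) :
    d 0 = 0 ∧ d 1 = 0 ∧ d 4 = 0 ∧ d 5 = 0 := by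
  have hc := rootTwo_pos.ne'
  have hl : ∀ x : ℝ, 0 ≤ x → x ≤ 1 / 2 → fn w x = rootTwo * d 0 + rootTwo * (2 * d 1) * x
      + rootTwo * (-12 * d 0 - 8 * d 1 + 12 * d 2 - 4 * d 3) * x ^ 2
      + rootTwo * (16 * d 0 + 8 * d 1 - 16 * d 2 + 8 * d 3) * x ^ 3 := fun x h0 h1 => by
    rw [← h x h0 (by linarith)]
    rw [Fin.sum_univ_six]
    simp only [map_add, map_smul, Pi.add_apply, Pi.smul_apply, smul_eq_mul, fn_X_one, fn_herm]
    norm_num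
    rw [hermite1_of_right (2 * x) (by linarith) (by linarith),
      hermite2_of_right (2 * x) (by linarith) (by linarith),
      hermite1_of_left (2 * x - 1) (by linarith) (by linarith),
      hermite2_of_left (2 * x - 1) (by linarith) (by linarith),
      hermite1_of_le (2 * x - 2) (by linarith), hermite2_of_le (2 * x - 2) (by linarith)]
    ring
  have hr : ∀ x : ℝ, 1 / 2 ≤ x → x ≤ 1 → fn w x =
      rootTwo * (-4 * d 2 - 4 * d 3 + 5 * d 4 - 2 * d 5)
      + rootTwo * (24 * d 2 + 16 * d 3 - 24 * d 4 + 10 * d 5) * x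
      + rootTwo * (-36 * d 2 - 20 * d 3 + 36 * d 4 - 16 * d 5) * x ^ 2
      + rootTwo * (16 * d 2 + 8 * d 3 - 16 * d 4 + 8 * d 5) * x ^ 3 := fun x h0 h1 => by
    rw [← h x (by linarith) h1]
    rw [Fin.sum_univ_six]
    simp only [map_add, map_smul, Pi.add_apply, Pi.smul_apply, smul_eq_mul, fn_X_one, fn_herm]
    norm_num
    rw [hermite1_of_ge (2 * x) (by linarith), hermite2_of_ge (2 * x) (by linarith),
      hermite1_of_right (2 * x - 1) (by linarith) (by linarith),
      hermite2_of_right (2 * x - 1) (by linarith) (by linarith),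
      hermite1_of_left (2 * x - 2) (by linarith) (by linarith),
      hermite2_of_left (2 * x - 2) (by linarith) (by linarith)]
    ring
  have hd : ∀ a b c e : ℝ, Differentiable ℝ fun x : ℝ => a + b * x + c * x ^ 2 + e * x ^ 3 := by
    intro a b c e
    fun_prop
  -- The coordinates `d 0, d 1` and `d 4, d 5` are, up to fixed factors, the value and derivative at
  -- `0` and at `1`. There `w` vanishes to first order, being C¹ and zero outside `[0,1]`.
  have v0 := hl 0 le_rfl (by norm_num)
  have v1 := hr 1 (by norm_num) le_rfl
  have e0 := deriv_eq_of_eqOn_Icc w.differentiable (hd _ _ _ _) (by norm_num : (0 : ℝ) < 1 / 2)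
    ⟨le_rfl, by norm_num⟩ hl
  have e1 := deriv_eq_of_eqOn_Icc w.differentiable (hd _ _ _ _) (by norm_num : (1 / 2 : ℝ) < 1)
    ⟨by norm_num, le_rfl⟩ hr
  rw [SuppIn.apply_left hw le_rfl] at v0
  rw [SuppIn.apply_right hw le_rfl] at v1
  rw [SuppIn.deriv_left hw, deriv_cubic] at e0
  rw [SuppIn.deriv_right hw, deriv_cubic] at e1
  have a0 : rootTwo * d 0 = 0 := by linarith
  have a1 : rootTwo * d 1 = 0 := by linarith
  have a4 : rootTwo * d 4 = 0 := by linarith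
  have a5 : rootTwo * d 5 = 0 := by linarith
  exact ⟨(mul_eq_zero.1 a0).resolve_left hc, (mul_eq_zero.1 a1).resolve_left hc,
    (mul_eq_zero.1 a4).resolve_left hc, (mul_eq_zero.1 a5).resolve_left hc⟩

end Spline

end CubicWavelet

end

/-! ### Gram–Schmidt for two and four vectors -/

noncomputable section

namespace CubicWavelet

section GramSchmidt

variable {E : Type*} [NormedAddCommGroup E] [InnerProductSpace ℝ E]

/-- Normalization in an inner product space. -/
def normE (f : E) : E := ‖f‖⁻¹ • f

/-- The component of `f` orthogonal to the orthonormal family `e`. -/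
def resE {n : ℕ} (f : E) (e : Fin n → E) : E := f - ∑ i, inner ℝ f (e i) • e i

theorem norm_normE {f : E} (hf : f ≠ 0) : ‖normE f‖ = 1 := by
  rw [normE, norm_smul, norm_inv, norm_norm, inv_mul_cancel₀ (norm_ne_zero_iff.2 hf)]

theorem inner_normE_right (f g : E) : inner ℝ f (normE g) = ‖g‖⁻¹ * inner ℝ f g :=
  real_inner_smul_right _ _ _

theorem inner_normE_left (f g : E) : inner ℝ (normE f) g = ‖f‖⁻¹ * inner ℝ f g :=
  real_inner_smul_left _ _ _

theorem span_singleton_normE {f : E} (hf : f ≠ 0) :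
    Submodule.span ℝ {normE f} = Submodule.span ℝ {f} :=
  Submodule.span_singleton_smul_eq (IsUnit.mk0 _ (inv_ne_zero (norm_ne_zero_iff.2 hf))) f

theorem inner_resE {n : ℕ} {e : Fin n → E} (he : Orthonormal ℝ e) (f : E) (j : Fin n) :
    inner ℝ (e j) (resE f e) = 0 := by
  rw [resE, inner_sub_right, he.inner_right_fintype, real_inner_comm, sub_self]

theorem gramSchmidt_step {n : ℕ} {e : Fin n → E} (he : Orthonormal ℝ e) {f : E}
    (hf : f ∉ Submodule.span ℝ (Set.range e)) :
    Orthonormal ℝ (Fin.snoc e (normE (resE f e)) : Fin (n + 1) → E) ∧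
      Submodule.span ℝ (Set.range (Fin.snoc e (normE (resE f e)) : Fin (n + 1) → E)) =
        Submodule.span ℝ (Set.range e) ⊔ Submodule.span ℝ {f} := by
  have hsum : ∑ i, inner ℝ f (e i) • e i ∈ Submodule.span ℝ (Set.range e) :=
    Submodule.sum_mem _ fun i _ => Submodule.smul_mem _ _ (Submodule.subset_span ⟨i, rfl⟩)
  have hne : resE f e ≠ 0 := fun h => hf (by rwa [sub_eq_zero.1 h])
  constructor
  · rw [orthonormal_iff_ite] at he ⊢
    have hu : inner ℝ (normE (resE f e)) (normE (resE f e)) = (1 : ℝ) := by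
      rw [real_inner_self_eq_norm_sq, norm_normE hne, one_pow]
    have ho : ∀ j, inner ℝ (e j) (normE (resE f e)) = 0 := fun j => by
      rw [inner_normE_right, inner_resE (orthonormal_iff_ite.2 he), mul_zero]
    intro i j
    induction i using Fin.lastCases with
    | last =>
      induction j using Fin.lastCases with
      | last => simpa using hu
      | cast j => simpa [(Fin.castSucc_lt_last j).ne'] using (real_inner_comm _ _).trans (ho j)
    | cast i =>
      induction j using Fin.lastCases with
      | last => simpa [(Fin.castSucc_lt_last i).ne] using ho i
      | cast j => simpa using he i j
  · rw [Fin.range_snoc, Submodule.span_insert, span_singleton_normE hne, sup_comm]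
    refine le_antisymm (sup_le le_sup_left ?_) (sup_le le_sup_left ?_)
    · rw [Submodule.span_singleton_le_iff_mem]
      exact sub_mem (Submodule.mem_sup_right (Submodule.mem_span_singleton_self f))
        (Submodule.mem_sup_left hsum)
    · rw [Submodule.span_singleton_le_iff_mem]
      have : resE f e + ∑ i, inner ℝ f (e i) • e i ∈
          Submodule.span ℝ (Set.range e) ⊔ Submodule.span ℝ {resE f e} :=
        add_mem (Submodule.mem_sup_right (Submodule.mem_span_singleton_self _))
          (Submodule.mem_sup_left hsum)
      rwa [resE, sub_add_cancel] at this

theorem gramSchmidt_one {f : E} (hf : f ≠ 0) : Orthonormal ℝ ![normE f] ∧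
    Submodule.span ℝ (Set.range ![normE f]) = Submodule.span ℝ {f} := by
  constructor
  · rw [orthonormal_iff_ite]
    intro i j
    fin_cases i; fin_cases j
    simp [norm_normE hf]
  · rw [Matrix.range_cons, Matrix.range_empty, Set.union_empty, span_singleton_normE hf]

/-- Orthonormalization of two vectors. -/
theorem gramSchmidt_two {f g : E} (h : LinearIndependent ℝ ![f, g]) :
    Orthonormal ℝ ![normE f, normE (resE g ![normE f])] ∧
      Submodule.span ℝ {normE f, normE (resE g ![normE f])} = Submodule.span ℝ {f, g} := by
  have hf : f ≠ 0 := h.ne_zero 0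
  obtain ⟨h1, h1'⟩ := gramSchmidt_one hf
  have hg : g ∉ Submodule.span ℝ (Set.range ![normE f]) := by
    rw [h1', Submodule.mem_span_singleton]
    rintro ⟨a, ha⟩
    have := LinearIndependent.pair_iff.1 h a (-1) (by rw [ha]; simp)
    norm_num at this
  obtain ⟨h2, h2'⟩ := gramSchmidt_step h1 hg
  have e : (Fin.snoc ![normE f] (normE (resE g ![normE f])) : Fin 2 → E) =
      ![normE f, normE (resE g ![normE f])] := by
    ext i; fin_cases i <;> rfl
  rw [e] at h2 h2'
  refine ⟨h2, ?_⟩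
  rw [h1', ← Submodule.span_union] at h2'
  rwa [Matrix.range_cons, Matrix.range_cons, Matrix.range_empty, Set.union_empty] at h2'

/-- Orthonormalization of four vectors. -/
theorem gramSchmidt_four {w : Fin 4 → E} (hw : LinearIndependent ℝ w) {v1 v2 v3 v4 : E}
    (h1 : v1 = normE (w 0)) (h2 : v2 = normE (resE (w 1) ![v1]))
    (h3 : v3 = normE (resE (w 2) ![v1, v2])) (h4 : v4 = normE (resE (w 3) ![v1, v2, v3])) :
    Orthonormal ℝ ![v1, v2, v3, v4] ∧
      Submodule.span ℝ (Set.range ![v1, v2, v3, v4]) = Submodule.span ℝ (Set.range w) := by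
  have hn : ∀ (s : Set (Fin 4)) (k : Fin 4), k ∉ s → w k ∉ Submodule.span ℝ (w '' s) :=
    fun s k hk => hw.notMem_span_image hk
  obtain ⟨o1, s1⟩ := gramSchmidt_one (hw.ne_zero 0)
  rw [← h1] at o1 s1
  have t1 : Submodule.span ℝ (Set.range ![v1]) = Submodule.span ℝ (w '' {0}) := by
    rw [s1, Set.image_singleton]
  obtain ⟨o2, s2⟩ := gramSchmidt_step o1 (t1 ▸ hn {0} 1 (by simp))
  rw [← h2] at o2 s2
  have e2 : (Fin.snoc ![v1] v2 : Fin 2 → E) = ![v1, v2] := by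
    ext i; fin_cases i <;> rfl
  rw [e2] at o2 s2
  have t2 : Submodule.span ℝ (Set.range ![v1, v2]) = Submodule.span ℝ (w '' {0, 1}) := by
    rw [s2, t1, ← Submodule.span_union, Set.image_insert_eq, Set.image_singleton,
      Set.image_singleton]
    rfl
  obtain ⟨o3, s3⟩ := gramSchmidt_step o2 (t2 ▸ hn {0, 1} 2 (by simp))
  rw [← h3] at o3 s3
  have e3 : (Fin.snoc ![v1, v2] v3 : Fin 3 → E) = ![v1, v2, v3] := by
    ext i; fin_cases i <;> rfl
  rw [e3] at o3 s3
  have t3 : Submodule.span ℝ (Set.range ![v1, v2, v3]) = Submodule.span ℝ (w '' {0, 1, 2}) := by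
    rw [s3, t2, ← Submodule.span_union]
    congr 1
    ext x
    simp only [Set.image_insert_eq, Set.image_singleton, Set.mem_union, Set.mem_insert_iff,
      Set.mem_singleton_iff]
    tauto
  obtain ⟨o4, s4⟩ := gramSchmidt_step o3 (t3 ▸ hn {0, 1, 2} 3 (by simp))
  rw [← h4] at o4 s4
  have e4 : (Fin.snoc ![v1, v2, v3] v4 : Fin 4 → E) = ![v1, v2, v3, v4] := by
    ext i; fin_cases i <;> rfl
  rw [e4] at o4 s4
  refine ⟨o4, ?_⟩
  rw [s4, t3, ← Submodule.span_union]
  congr 1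
  ext x
  simp only [Set.image_insert_eq, Set.image_singleton, Set.mem_union, Set.mem_insert_iff,
    Set.mem_singleton_iff, Set.mem_range, Fin.exists_fin_succ, IsEmpty.exists_iff, or_false]
  simp only [eq_comm, or_assoc]
  rfl

end GramSchmidt

end CubicWavelet

end

/-! ### Inner generators and boundary parts -/

noncomputable section

namespace CubicWavelet

namespace Spline

/-- The properties of the four scaling generators supported in the unit interval. -/
structure InnerGenerators (Φ : Fin 4 → Spline) : Prop where
  orthonormal : Orthonormal ℝ Φ
  suppIn : ∀ i, Φ i ∈ SuppIn 0 1
  mem : ∀ i, Φ i ∈ Submodule.span ℝ (X 2 '' {m | 2 ≤ m ∧ m ≤ 7})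
  zero_eq : Φ 0 = normE (X 1 2)
  one_eq : Φ 1 = normE (X 1 3)
  cond : ∀ i ∈ ({0, 1} : Set ℤ), ∀ k ∈ ({4, 5} : Set ℤ),
    ∑ m, inner ℝ (X 1 i) (Φ m) * inner ℝ (X 1 k) (Φ m) = 0

/-- A function minus its components along the inner generators on `[-1, 1]`. -/
def boundaryPart (Φ : Fin 4 → Spline) (f : Spline) : Spline :=
  f - ∑ j, inner ℝ f (Φ j) • Φ j - ∑ j, inner ℝ f (tr (-1) (Φ j)) • tr (-1) (Φ j)

/-- The fifth scaling generator. -/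
def gen5 (Φ : Fin 4 → Spline) : Spline := normE (boundaryPart Φ (X 1 0))

/-- The sixth scaling generator. -/
def gen6 (Φ : Fin 4 → Spline) : Spline := normE (resE (boundaryPart Φ (X 1 1)) ![gen5 Φ])

/-- The six scaling generators. -/
def gens (Φ : Fin 4 → Spline) : Fin 6 → Spline := ![Φ 0, Φ 1, Φ 2, Φ 3, gen5 Φ, gen6 Φ]

theorem gens_of_lt (Φ : Fin 4 → Spline) (i : Fin 6) (hi : (i : ℕ) < 4) :
    gens Φ i = Φ ⟨i, hi⟩ := by
  fin_cases i <;> first | rfl | (simp at hi)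

theorem X_ne_zero (j m : ℤ) : X j m ≠ 0 := by
  rw [← inner_self_ne_zero (𝕜 := ℝ), inner_X, gram]
  simp only [sub_self, if_true]
  split_ifs <;> norm_num

theorem X_zero_suppIn : X 1 0 ∈ SuppIn (-1) 1 :=
  SuppIn.mono (by norm_num) (by norm_num) (X_suppIn 1 0)

theorem X_one_suppIn : X 1 1 ∈ SuppIn (-1) 1 :=
  SuppIn.mono (by norm_num) (by norm_num) (X_suppIn 1 1)

theorem X_two_suppIn : X 1 2 ∈ SuppIn 0 1 :=
  SuppIn.mono (by norm_num) (by norm_num) (X_suppIn 1 2)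

theorem X_three_suppIn : X 1 3 ∈ SuppIn 0 1 :=
  SuppIn.mono (by norm_num) (by norm_num) (X_suppIn 1 3)

theorem X_four_suppIn : X 1 4 ∈ SuppIn 0 2 :=
  SuppIn.mono (by norm_num) (by norm_num) (X_suppIn 1 4)

theorem X_five_suppIn : X 1 5 ∈ SuppIn 0 2 :=
  SuppIn.mono (by norm_num) (by norm_num) (X_suppIn 1 5)

theorem mem_of_mem_span {S : Set Spline} {a b : ℝ} (h : ∀ s ∈ S, s ∈ SuppIn a b) {f : Spline}
    (hf : f ∈ Submodule.span ℝ S) : f ∈ SuppIn a b := Submodule.span_le.2 h hf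

namespace InnerGenerators

variable {Φ : Fin 4 → Spline} (h : InnerGenerators Φ)
include h

theorem inner_self (i j : Fin 4) : inner ℝ (Φ i) (Φ j) = if i = j then 1 else 0 :=
  orthonormal_iff_ite.1 h.orthonormal i j

theorem tr_suppIn (i : Fin 4) (n : ℤ) : tr n (Φ i) ∈ SuppIn n (n + 1) := by
  have := SuppIn.tr (h.suppIn i) n
  rwa [zero_add, add_comm] at this

theorem tr_neg_suppIn (i : Fin 4) : tr (-1) (Φ i) ∈ SuppIn (-1) 0 :=
  SuppIn.mono (by norm_num) (by norm_num) (h.tr_suppIn i (-1))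

theorem inner_tr_neg (i j : Fin 4) : inner ℝ (Φ i) (tr (-1) (Φ j)) = 0 :=
  SuppIn.inner_eq_zero (h.suppIn i) (h.tr_neg_suppIn j) (Or.inr le_rfl)

theorem inner_boundaryPart (f : Spline) (i : Fin 4) : inner ℝ (Φ i) (boundaryPart Φ f) = 0 := by
  simp only [boundaryPart, inner_sub_right, inner_sum, real_inner_smul_right, h.inner_tr_neg,
    h.inner_self]
  simp [real_inner_comm]

theorem inner_tr_boundaryPart (f : Spline) (i : Fin 4) :
    inner ℝ (tr (-1) (Φ i)) (boundaryPart Φ f) = 0 := by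
  have hz : ∀ j, inner ℝ (tr (-1) (Φ i)) (Φ j) = 0 := fun j => by
    rw [real_inner_comm, h.inner_tr_neg]
  unfold boundaryPart
  simp only [inner_sub_right, inner_sum, real_inner_smul_right, LinearIsometry.inner_map_map,
    h.inner_self, hz]
  simp [real_inner_comm]

theorem boundaryPart_suppIn {f : Spline} (hf : f ∈ SuppIn (-1) 1) :
    boundaryPart Φ f ∈ SuppIn (-1) 1 := by
  refine sub_mem (sub_mem hf (Submodule.sum_mem _ fun i _ => Submodule.smul_mem _ _ ?_))
    (Submodule.sum_mem _ fun i _ => Submodule.smul_mem _ _ ?_)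
  · exact SuppIn.mono (by norm_num) le_rfl (h.suppIn i)
  · exact SuppIn.mono le_rfl (by norm_num) (h.tr_neg_suppIn i)

/-- Near the right boundary of the support, the translate of one boundary part is orthogonal to
all boundary parts. -/
theorem inner_boundaryPart_tr {f g f' : Spline} (hg : g ∈ SuppIn (-1) 1) (hf' : f' ∈ SuppIn 0 2)
    (hff' : tr 1 f = f') (hgf : inner ℝ g f' = 0)
    (hc : ∑ m, inner ℝ g (Φ m) * inner ℝ f' (Φ m) = 0) :
    inner ℝ (boundaryPart Φ g) (tr 1 (boundaryPart Φ f)) = 0 := by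
  have hs := h.boundaryPart_suppIn hg
  have h1 : ∀ i, inner ℝ (boundaryPart Φ g) (tr 1 (Φ i)) = 0 := fun i =>
    SuppIn.inner_eq_zero hs (h.tr_suppIn i 1) (Or.inl (by norm_num))
  have h2 : ∀ i, inner ℝ (boundaryPart Φ g) (tr 1 (tr (-1) (Φ i))) = 0 := fun i => by
    rw [← dilationSystem.tr_add, add_neg_cancel, dilationSystem.tr_zero, real_inner_comm]
    exact h.inner_boundaryPart g i
  have h3 : ∀ i, inner ℝ (tr (-1) (Φ i)) f' = 0 := fun i =>
    SuppIn.inner_eq_zero (h.tr_neg_suppIn i) hf' (Or.inl le_rfl)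
  -- The pairing of `g` itself is `hgf`, its projection on `[0,1]` contributes the sum in `hc`, and
  -- its projection on `[-1,0]` does not reach `f'`. This is where the orthogonality condition on
  -- the coefficients enters.
  have key : inner ℝ (boundaryPart Φ g) f' = 0 := by
    have h4 : ∀ m, inner ℝ f' (Φ m) = inner ℝ (Φ m) f' := fun m => real_inner_comm _ _
    simp only [h4] at hc
    unfold boundaryPart
    simp only [inner_sub_left, sum_inner, real_inner_smul_left, h3, hgf, hc]
    simp
  have e : boundaryPart Φ f = f - ∑ j, inner ℝ f (Φ j) • Φ j
      - ∑ j, inner ℝ f (tr (-1) (Φ j)) • tr (-1) (Φ j) := rfl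
  rw [e, map_sub, map_sub, map_sum, map_sum, inner_sub_right, inner_sub_right,
    inner_sum, inner_sum, hff', key]
  simp [map_smul, real_inner_smul_right, h1, h2]

/-- Combinations of the boundary parts are orthogonal to the translates of such combinations. -/
theorem inner_boundary_tr {e e' : Spline}
    (he : e ∈ Submodule.span ℝ {boundaryPart Φ (X 1 0), boundaryPart Φ (X 1 1)})
    (he' : e' ∈ Submodule.span ℝ {boundaryPart Φ (X 1 0), boundaryPart Φ (X 1 1)}) :
    inner ℝ e (tr 1 e') = 0 := by
  have t4 : tr 1 (X 1 0) = X 1 4 := tr_X_one 1 0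
  have t5 : tr 1 (X 1 1) = X 1 5 := tr_X_one 1 1
  have z : ∀ g ∈ ({X 1 0, X 1 1} : Set Spline), ∀ f ∈ ({X 1 0, X 1 1} : Set Spline),
      inner ℝ (boundaryPart Φ g) (tr 1 (boundaryPart Φ f)) = 0 := by
    rintro g (rfl | rfl) f (rfl | rfl)
    · exact h.inner_boundaryPart_tr X_zero_suppIn X_four_suppIn t4 (by rw [inner_X]; norm_num [gram])
        (h.cond 0 (by simp) 4 (by simp))
    · exact h.inner_boundaryPart_tr X_zero_suppIn X_five_suppIn t5 (by rw [inner_X]; norm_num [gram])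
        (h.cond 0 (by simp) 5 (by simp))
    · exact h.inner_boundaryPart_tr X_one_suppIn X_four_suppIn t4 (by rw [inner_X]; norm_num [gram])
        (h.cond 1 (by simp) 4 (by simp))
    · exact h.inner_boundaryPart_tr X_one_suppIn X_five_suppIn t5 (by rw [inner_X]; norm_num [gram])
        (h.cond 1 (by simp) 5 (by simp))
  refine inner_eq_zero_of_mem_span (fun s hs => ?_) he
  rw [real_inner_comm, dilationSystem.inner_tr_left]
  refine inner_eq_zero_of_mem_span (fun t ht => ?_) he'
  rw [← dilationSystem.inner_tr_left, real_inner_comm]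
  rcases hs with rfl | rfl <;> rcases ht with rfl | rfl
  · exact z _ (by simp) _ (by simp)
  · exact z _ (by simp) _ (by simp)
  · exact z _ (by simp) _ (by simp)
  · exact z _ (by simp) _ (by simp)

end InnerGenerators

/-- The component of a function along the inner generators on `[0, 1]`. -/
def innerPart (Φ : Fin 4 → Spline) (f : Spline) : Spline := ∑ j, inner ℝ f (Φ j) • Φ j

theorem eq_of_suppIn {a b : ℝ} {f g : Spline} (hf : f ∈ SuppIn a b) (hg : g ∈ SuppIn a b)
    (h : ∀ x, a ≤ x → x ≤ b → fn f x = fn g x) : f = g := fn_injective (by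
  ext x
  by_cases hx : x < a ∨ b < x
  · rw [hf x hx, hg x hx]
  · push Not at hx
    exact h x hx.1 hx.2)

theorem boundaryPart_add (Φ : Fin 4 → Spline) (f g : Spline) :
    boundaryPart Φ (f + g) = boundaryPart Φ f + boundaryPart Φ g := by
  simp only [boundaryPart, inner_add_left, add_smul, Finset.sum_add_distrib]
  abel

theorem boundaryPart_smul (Φ : Fin 4 → Spline) (c : ℝ) (f : Spline) :
    boundaryPart Φ (c • f) = c • boundaryPart Φ f := by
  simp only [boundaryPart, real_inner_smul_left, mul_smul, ← Finset.smul_sum, smul_sub]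

namespace InnerGenerators

variable {Φ : Fin 4 → Spline} (h : InnerGenerators Φ)
include h

theorem innerPart_suppIn (f : Spline) : innerPart Φ f ∈ SuppIn 0 1 :=
  Submodule.sum_mem _ fun i _ => Submodule.smul_mem _ _ (h.suppIn i)

theorem inner_innerPart (f : Spline) (i : Fin 4) :
    inner ℝ (Φ i) (innerPart Φ f) = inner ℝ f (Φ i) := by
  rw [innerPart, h.orthonormal.inner_right_fintype]

theorem fn_boundaryPart (f : Spline) {x : ℝ} (hx : 0 ≤ x) :
    fn (boundaryPart Φ f) x = fn (f - innerPart Φ f) x := by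
  have hz : ∀ j, fn (tr (-1) (Φ j)) x = 0 := fun j => SuppIn.apply_right (h.tr_neg_suppIn j) hx
  rw [boundaryPart, map_sub, Pi.sub_apply, map_sum, Finset.sum_apply]
  simp only [map_smul, Pi.smul_apply, hz, smul_zero, Finset.sum_const_zero, sub_zero]
  rfl

/-- After translation the projection on `[-1,0]` becomes the one on `[0,1]`, while the other
projection moves to `[1,2]` and disappears here. -/
theorem fn_tr_boundaryPart (f : Spline) {x : ℝ} (hx : x ≤ 1) :
    fn (tr 1 (boundaryPart Φ f)) x = fn (tr 1 f - innerPart Φ (tr 1 f)) x := by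
  have hz : ∀ j, fn (tr 1 (Φ j)) x = 0 := fun j =>
    SuppIn.apply_left (h.tr_suppIn j 1) (by simpa using hx)
  have hi : ∀ j, inner ℝ f (tr (-1) (Φ j)) = inner ℝ (tr 1 f) (Φ j) := fun j => by
    rw [dilationSystem.inner_tr_left]
  have ht : ∀ j, tr 1 (tr (-1) (Φ j)) = Φ j := fun j => by
    rw [← dilationSystem.tr_add, add_neg_cancel, dilationSystem.tr_zero]
  simp only [boundaryPart, map_sub, map_sum, map_smul, ht, hi, innerPart, Pi.sub_apply,
    Finset.sum_apply, Pi.smul_apply, hz, smul_zero, Finset.sum_const_zero, sub_zero]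

/-- An inner part vanishes to first order at `0` and `1`, which kills the four end-point
coordinates. What remains is a combination of `X 1 2` and `X 1 3`, that is of `Φ 0` and `Φ 1`, so
the components along `Φ 2` and `Φ 3` vanish. -/
theorem coords_of_eq_innerPart {d : Fin 6 → ℝ} {K : Spline}
    (hd : ∀ x, 0 ≤ x → x ≤ 1 → fn (∑ i : Fin 6, d i • X 1 (i : ℤ)) x = fn (-innerPart Φ K) x) :
    (d 0 = 0 ∧ d 1 = 0 ∧ d 4 = 0 ∧ d 5 = 0) ∧ inner ℝ K (Φ 2) = 0 ∧ inner ℝ K (Φ 3) = 0 := by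
  have hs : -innerPart Φ K ∈ SuppIn 0 1 := neg_mem (h.innerPart_suppIn K)
  obtain ⟨h0, h1, h4, h5⟩ := boundary_coords_eq_zero hs hd
  refine ⟨⟨h0, h1, h4, h5⟩, ?_⟩
  have heq : d 2 • X 1 2 + d 3 • X 1 3 = -innerPart Φ K := by
    refine eq_of_suppIn (add_mem (Submodule.smul_mem _ _ X_two_suppIn)
      (Submodule.smul_mem _ _ X_three_suppIn)) hs fun x hx hx' => ?_
    rw [← hd x hx hx', Fin.sum_univ_six, h0, h1, h4, h5]
    simp
  have key : ∀ m : Fin 4, m ≠ 0 → m ≠ 1 → inner ℝ K (Φ m) = 0 := by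
    intro m hm0 hm1
    have e0 := h.inner_self m 0
    have e1 := h.inner_self m 1
    rw [if_neg hm0, h.zero_eq, inner_normE_right] at e0
    rw [if_neg hm1, h.one_eq, inner_normE_right] at e1
    have n0 := (mul_eq_zero.1 e0).resolve_left (inv_ne_zero (norm_ne_zero_iff.2 (X_ne_zero 1 2)))
    have n1 := (mul_eq_zero.1 e1).resolve_left (inv_ne_zero (norm_ne_zero_iff.2 (X_ne_zero 1 3)))
    have := congrArg (fun f => inner ℝ (Φ m) f) heq
    simp only [inner_add_right, real_inner_smul_right, n0, n1, inner_neg_right,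
      h.inner_innerPart] at this
    linarith
  exact ⟨key 2 (by decide) (by decide), key 3 (by decide) (by decide)⟩

/-- The orthogonality condition for combinations of boundary functions without components along
the last two inner generators. -/
theorem cond_of_inner_eq_zero {K L : Spline} (h2 : inner ℝ K (Φ 2) = 0) (h3 : inner ℝ K (Φ 3) = 0)
    (hc : ∑ m, inner ℝ K (Φ m) * inner ℝ L (Φ m) = 0) :
    35 / 26 * (inner ℝ K (X 1 2) * inner ℝ L (X 1 2))
      + 105 / 2 * (inner ℝ K (X 1 3) * inner ℝ L (X 1 3)) = 0 := by
  have n0 : ‖X 1 2‖ ^ 2 = 26 / 35 := by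
    rw [← real_inner_self_eq_norm_sq, inner_X]; norm_num [gram]
  have n1 : ‖X 1 3‖ ^ 2 = 2 / 105 := by
    rw [← real_inner_self_eq_norm_sq, inner_X]; norm_num [gram]
  rw [Fin.sum_univ_four, h2, h3, h.zero_eq, h.one_eq] at hc
  simp only [inner_normE_right, zero_mul, add_zero] at hc
  have i0 : ‖X 1 2‖⁻¹ ^ 2 = 35 / 26 := by rw [inv_pow, n0]; norm_num
  have i1 : ‖X 1 3‖⁻¹ ^ 2 = 105 / 2 := by rw [inv_pow, n1]; norm_num
  rw [← i0, ← i1]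
  linear_combination hc

/-- If a half boundary part agreed with an element of `V 1` on `[0,1]`, its inner projection would
use `Φ 0` and `Φ 1` only. The orthogonality condition then contains only known inner products with
`X 1 2` and `X 1 3`, and gives two independent linear equations for `a` and `b`. -/
theorem left_coords_eq_zero {a b : ℝ} {G : Spline} (hG : G ∈ V 1)
    (hx : ∀ x, 0 ≤ x → x ≤ 1 →
      fn G x = fn (boundaryPart Φ (a • X 1 0 + b • X 1 1)) x) : a = 0 ∧ b = 0 := by
  obtain ⟨d, hd⟩ := exists_coords_of_mem_V hG
  obtain ⟨-, h2, h3⟩ := h.coords_of_eq_innerPart (d := d - ![a, b, 0, 0, 0, 0])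
    (K := a • X 1 0 + b • X 1 1) fun x h0 h1 => by
      have e : ∑ i : Fin 6, (d - ![a, b, 0, 0, 0, 0]) i • X 1 (i : ℤ) =
          ∑ i : Fin 6, d i • X 1 (i : ℤ) - (a • X 1 0 + b • X 1 1) := by
        simp only [Pi.sub_apply, sub_smul, Finset.sum_sub_distrib]
        congr 1
        simp [Fin.sum_univ_six]
      have := hx x h0 h1
      rw [hd x h0 h1, h.fn_boundaryPart _ h0] at this
      rw [e, map_sub, Pi.sub_apply, this]
      simp
  have hc : ∀ k ∈ ({4, 5} : Set ℤ),
      ∑ m, inner ℝ (a • X 1 0 + b • X 1 1) (Φ m) * inner ℝ (X 1 k) (Φ m) = 0 := fun k hk => by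
    have e0 := h.cond 0 (by simp) k hk
    have e1 := h.cond 1 (by simp) k hk
    simp only [inner_add_left, real_inner_smul_left, add_mul, mul_assoc, Finset.sum_add_distrib,
      ← Finset.mul_sum, e0, e1]
    simp
  have c4 := h.cond_of_inner_eq_zero h2 h3 (hc 4 (by simp))
  have c5 := h.cond_of_inner_eq_zero h2 h3 (hc 5 (by simp))
  -- With the Gram entries inserted this is a two by two linear system with nonzero determinant.
  simp only [inner_add_left, real_inner_smul_left, inner_X] at c4 c5
  norm_num [gram] at c4 c5
  constructor <;> linarith

theorem right_coords_eq_zero {a b : ℝ} {G : Spline} (hG : G ∈ V 1)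
    (hx : ∀ x, 0 ≤ x → x ≤ 1 →
      fn G x = fn (tr 1 (boundaryPart Φ (a • X 1 0 + b • X 1 1))) x) : a = 0 ∧ b = 0 := by
  have t4 : tr 1 (X 1 0) = X 1 4 := tr_X_one 1 0
  have t5 : tr 1 (X 1 1) = X 1 5 := tr_X_one 1 1
  have ht : tr 1 (a • X 1 0 + b • X 1 1) = a • X 1 4 + b • X 1 5 := by
    rw [map_add, map_smul, map_smul, t4, t5]
  obtain ⟨d, hd⟩ := exists_coords_of_mem_V hG
  obtain ⟨-, h2, h3⟩ := h.coords_of_eq_innerPart (d := d - ![0, 0, 0, 0, a, b])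
    (K := a • X 1 4 + b • X 1 5) fun x h0 h1 => by
      have e : ∑ i : Fin 6, (d - ![0, 0, 0, 0, a, b]) i • X 1 (i : ℤ) =
          ∑ i : Fin 6, d i • X 1 (i : ℤ) - (a • X 1 4 + b • X 1 5) := by
        simp only [Pi.sub_apply, sub_smul, Finset.sum_sub_distrib]
        congr 1
        simp [Fin.sum_univ_six]
      have := hx x h0 h1
      rw [hd x h0 h1, h.fn_tr_boundaryPart _ h1, ht] at this
      rw [e, map_sub, Pi.sub_apply, this]
      simp
  have hc : ∀ k ∈ ({0, 1} : Set ℤ),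
      ∑ m, inner ℝ (a • X 1 4 + b • X 1 5) (Φ m) * inner ℝ (X 1 k) (Φ m) = 0 := fun k hk => by
    have e0 := h.cond k hk 4 (by simp)
    have e1 := h.cond k hk 5 (by simp)
    simp only [mul_comm (inner ℝ (X 1 k) _)] at e0 e1
    simp only [inner_add_left, real_inner_smul_left, add_mul, mul_assoc, Finset.sum_add_distrib,
      ← Finset.mul_sum, e0, e1]
    simp
  have c4 := h.cond_of_inner_eq_zero h2 h3 (hc 0 (by simp))
  have c5 := h.cond_of_inner_eq_zero h2 h3 (hc 1 (by simp))
  simp only [inner_add_left, real_inner_smul_left, inner_X] at c4 c5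
  norm_num [gram] at c4 c5
  constructor <;> linarith

/-- Here the end-point coordinates alone suffice: up to sign they are the four unknowns, and the
inner parts cannot contribute to them. -/
theorem both_coords_eq_zero {a b a' b' : ℝ}
    (hx : ∀ x, 0 ≤ x → x ≤ 1 → fn (boundaryPart Φ (a • X 1 0 + b • X 1 1)) x
      + fn (tr 1 (boundaryPart Φ (a' • X 1 0 + b' • X 1 1))) x = 0) :
    a = 0 ∧ b = 0 ∧ a' = 0 ∧ b' = 0 := by
  have t4 : tr 1 (X 1 0) = X 1 4 := tr_X_one 1 0
  have t5 : tr 1 (X 1 1) = X 1 5 := tr_X_one 1 1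
  have ht : tr 1 (a' • X 1 0 + b' • X 1 1) = a' • X 1 4 + b' • X 1 5 := by
    rw [map_add, map_smul, map_smul, t4, t5]
  have hi : ∀ f g, innerPart Φ f + innerPart Φ g = innerPart Φ (f + g) := fun f g => by
    simp only [innerPart, inner_add_left, add_smul, Finset.sum_add_distrib]
  obtain ⟨⟨h0, h1, h4, h5⟩, -⟩ := h.coords_of_eq_innerPart (d := ![-a, -b, 0, 0, -a', -b'])
    (K := (a • X 1 0 + b • X 1 1) + (a' • X 1 4 + b' • X 1 5)) fun x h0 h1 => by
      have e : ∑ i : Fin 6, (![-a, -b, 0, 0, -a', -b'] : Fin 6 → ℝ) i • X 1 (i : ℤ) =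
          -((a • X 1 0 + b • X 1 1) + (a' • X 1 4 + b' • X 1 5)) := by
        simp [Fin.sum_univ_six]
        abel
      have := hx x h0 h1
      rw [h.fn_boundaryPart _ h0, h.fn_tr_boundaryPart _ h1, ht] at this
      rw [e, ← hi]
      simp only [map_sub, map_neg, map_add, Pi.sub_apply, Pi.neg_apply, Pi.add_apply] at this ⊢
      linarith
  simp at h0 h1 h4 h5
  exact ⟨h0, h1, h4, h5⟩

theorem linearIndependent_boundary :
    LinearIndependent ℝ ![boundaryPart Φ (X 1 0), boundaryPart Φ (X 1 1)] := by
  rw [LinearIndependent.pair_iff]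
  intro a b hab
  rw [← boundaryPart_smul, ← boundaryPart_smul, ← boundaryPart_add] at hab
  exact h.left_coords_eq_zero (zero_mem (V 1)) fun x _ _ => by rw [hab]

theorem orthonormal_boundary : Orthonormal ℝ ![gen5 Φ, gen6 Φ] :=
  (gramSchmidt_two h.linearIndependent_boundary).1

theorem span_boundary : Submodule.span ℝ {gen5 Φ, gen6 Φ} =
    Submodule.span ℝ {boundaryPart Φ (X 1 0), boundaryPart Φ (X 1 1)} :=
  (gramSchmidt_two h.linearIndependent_boundary).2

end InnerGenerators

end Spline

end CubicWavelet

end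

/-! ### Orthonormality and refinability of the six scaling generators -/

noncomputable section

namespace CubicWavelet

namespace Spline

namespace InnerGenerators

variable {Φ : Fin 4 → Spline} (h : InnerGenerators Φ)
include h

theorem boundary_mem {i : Fin 6} (hi : 4 ≤ (i : ℕ)) : gens Φ i ∈
    Submodule.span ℝ {boundaryPart Φ (X 1 0), boundaryPart Φ (X 1 1)} := by
  rw [← h.span_boundary]
  rcases (by omega : i = 4 ∨ i = 5) with rfl | rfl
  · exact Submodule.subset_span (Or.inl rfl)
  · exact Submodule.subset_span (Or.inr rfl)

theorem gens_boundary_suppIn {i : Fin 6} (hi : 4 ≤ (i : ℕ)) : gens Φ i ∈ SuppIn (-1) 1 := by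
  refine mem_of_mem_span ?_ (h.boundary_mem hi)
  rintro s (rfl | rfl)
  · exact h.boundaryPart_suppIn X_zero_suppIn
  · exact h.boundaryPart_suppIn X_one_suppIn

theorem gens_inner_suppIn {i : Fin 6} (hi : (i : ℕ) < 4) : gens Φ i ∈ SuppIn 0 1 := by
  rw [gens_of_lt Φ i hi]; exact h.suppIn _

theorem gens_suppIn (i : Fin 6) : gens Φ i ∈ SuppIn (-1) 1 := by
  by_cases hi : (i : ℕ) < 4
  · exact SuppIn.mono (by norm_num) le_rfl (h.gens_inner_suppIn hi)
  · exact h.gens_boundary_suppIn (by omega)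

theorem tr_gens_suppIn (n : ℤ) (i : Fin 6) : tr n (gens Φ i) ∈ SuppIn (-1 + n) (1 + n) :=
  SuppIn.tr (h.gens_suppIn i) n

theorem inner_inner_boundary (j : Fin 4) {e : Spline}
    (he : e ∈ Submodule.span ℝ {boundaryPart Φ (X 1 0), boundaryPart Φ (X 1 1)}) :
    inner ℝ (Φ j) e = 0 ∧ inner ℝ (tr (-1) (Φ j)) e = 0 := by
  rw [real_inner_comm, real_inner_comm e]
  constructor <;> refine inner_eq_zero_of_mem_span ?_ he <;> rintro s (rfl | rfl) <;>
    rw [real_inner_comm]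
  · exact h.inner_boundaryPart _ _
  · exact h.inner_boundaryPart _ _
  · exact h.inner_tr_boundaryPart _ _
  · exact h.inner_tr_boundaryPart _ _

theorem inner_gens_boundary (n : ℤ) (i j : Fin 6) (hi : (i : ℕ) < 4) (hj : 4 ≤ (j : ℕ)) :
    inner ℝ (gens Φ i) (tr n (gens Φ j)) = 0 := by
  have ho := h.inner_inner_boundary ⟨i, hi⟩ (h.boundary_mem hj)
  rw [gens_of_lt Φ i hi]
  rcases eq_or_ne n 0 with rfl | h0
  · rw [dilationSystem.tr_zero]; exact ho.1
  rcases eq_or_ne n 1 with rfl | h1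
  · have := dilationSystem.inner_tr_left (-1) (Φ ⟨i, hi⟩) (gens Φ j)
    rw [neg_neg] at this
    rw [← this]
    exact ho.2
  refine SuppIn.inner_eq_zero (h.suppIn _) (h.tr_gens_suppIn n j) ?_
  rcases (by omega : 2 ≤ n ∨ n ≤ -1) with hn | hn
  · left
    have : (2 : ℝ) ≤ n := by exact_mod_cast hn
    linarith
  · right
    have : (n : ℝ) ≤ -1 := by exact_mod_cast hn
    linarith

theorem inner_boundary_boundary (i j : Fin 6) (hi : 4 ≤ (i : ℕ)) (hj : 4 ≤ (j : ℕ)) :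
    inner ℝ (gens Φ i) (gens Φ j) = if i = j then 1 else 0 := by
  have ho := orthonormal_iff_ite.1 h.orthonormal_boundary
  rcases (by omega : i = 4 ∨ i = 5) with rfl | rfl <;>
    rcases (by omega : j = 4 ∨ j = 5) with rfl | rfl
  · exact ho 0 0
  · exact ho 0 1
  · exact ho 1 0
  · exact ho 1 1

/-- Translates by more than one have nonoverlapping supports, and inner generators are orthogonal to
boundary ones by projection. Two boundary generators at distance one are left, the case of
`inner_boundary_tr`. -/
theorem inner_gens (i j : Fin 6) (n : ℤ) :
    inner ℝ (gens Φ i) (tr n (gens Φ j)) = if i = j ∧ n = 0 then 1 else 0 := by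
  have flip : inner ℝ (gens Φ i) (tr n (gens Φ j)) = inner ℝ (gens Φ j) (tr (-n) (gens Φ i)) := by
    rw [real_inner_comm, dilationSystem.inner_tr_left]
  have hne : ∀ (p : Fin 6 → Prop), p i → ¬ p j → ¬ (i = j ∧ n = 0) := by
    rintro p hp hq ⟨rfl, -⟩
    exact hq hp
  by_cases hi : (i : ℕ) < 4 <;> by_cases hj : (j : ℕ) < 4
  · rcases eq_or_ne n 0 with rfl | h0
    · rw [dilationSystem.tr_zero, gens_of_lt Φ i hi, gens_of_lt Φ j hj, h.inner_self]
      simp [Fin.ext_iff]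
    · rw [if_neg (by tauto), gens_of_lt Φ i hi, gens_of_lt Φ j hj]
      refine SuppIn.inner_eq_zero (h.suppIn _) (h.tr_suppIn _ n) ?_
      rcases (by omega : 1 ≤ n ∨ n ≤ -1) with hn | hn
      · left
        exact_mod_cast hn
      · right
        have : (n : ℝ) ≤ -1 := by exact_mod_cast hn
        linarith
  · rw [if_neg (hne (fun k => (k : ℕ) < 4) hi hj)]
    exact h.inner_gens_boundary n i j hi (by omega)
  · rw [if_neg (hne (fun k => ¬ (k : ℕ) < 4) hi (by simpa using hj)), flip]
    exact h.inner_gens_boundary _ j i hj (by omega)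
  · rcases eq_or_ne n 0 with rfl | h0
    · rw [dilationSystem.tr_zero, h.inner_boundary_boundary i j (by omega) (by omega)]
      simp
    rw [if_neg (by tauto)]
    rcases eq_or_ne n 1 with rfl | h1
    · exact h.inner_boundary_tr (h.boundary_mem (by omega)) (h.boundary_mem (by omega))
    rcases eq_or_ne n (-1) with rfl | h2
    · rw [flip, neg_neg]
      exact h.inner_boundary_tr (h.boundary_mem (by omega)) (h.boundary_mem (by omega))
    refine SuppIn.inner_eq_zero (h.gens_suppIn i) (h.tr_gens_suppIn n j) ?_
    rcases (by omega : 2 ≤ n ∨ n ≤ -2) with hn | hn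
    · left
      have : (2 : ℝ) ≤ n := by exact_mod_cast hn
      linarith
    · right
      have : (n : ℝ) ≤ -2 := by exact_mod_cast hn
      linarith

end InnerGenerators

theorem fine_inner_mem (Φ : Fin 4 → Spline) (n : ℤ) (i : Fin 4) :
    dil 1 (tr n (Φ i)) ∈ band tr dil (gens Φ) (2 * n + 1) (2 * n + 1) := by
  have hi : ((Fin.castLE (by norm_num) i : Fin 6) : ℕ) < 4 := i.2
  have e : dil 1 (tr n (Φ i)) = fine tr dil (gens Φ) (n, Fin.castLE (by norm_num) i) := by
    rw [fine, gens_of_lt Φ _ hi]; rfl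
  rw [e]
  apply fine_mem_band <;> simp [pos]

theorem fine_boundary_mem (Φ : Fin 4 → Spline) (n : ℤ) (i : Fin 6) (hi : 4 ≤ (i : ℕ)) :
    dil 1 (tr n (gens Φ i)) ∈ band tr dil (gens Φ) (2 * n) (2 * n) := by
  apply fine_mem_band (s := (n, i)) <;> simp [pos, not_lt.2 hi]

theorem eq_boundaryPart_add (Φ : Fin 4 → Spline) (f : Spline) :
    f = boundaryPart Φ f + ∑ j, inner ℝ f (Φ j) • Φ j
      + ∑ j, inner ℝ f (tr (-1) (Φ j)) • tr (-1) (Φ j) := by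
  rw [boundaryPart]; abel

namespace InnerGenerators

variable {Φ : Fin 4 → Spline} (h : InnerGenerators Φ)
include h

theorem dil_tr_boundary_mem (n : ℤ) {e : Spline}
    (he : e ∈ Submodule.span ℝ {boundaryPart Φ (X 1 0), boundaryPart Φ (X 1 1)}) :
    dil 1 (tr n e) ∈ band tr dil (gens Φ) (2 * n) (2 * n) := by
  rw [← h.span_boundary] at he
  obtain ⟨a, b, rfl⟩ := Submodule.mem_span_pair.1 he
  simp only [map_add, map_smul]
  exact add_mem (Submodule.smul_mem _ _ (fine_boundary_mem Φ n 4 (by decide)))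
    (Submodule.smul_mem _ _ (fine_boundary_mem Φ n 5 (by decide)))

/-- A function is its boundary part plus inner components on the two sides; dilated, these sit at
positions `2n` and `2n ± 1`. -/
theorem dil_tr_mem_of_boundary (n : ℤ) {f : Spline}
    (hf : boundaryPart Φ f ∈ Submodule.span ℝ {boundaryPart Φ (X 1 0), boundaryPart Φ (X 1 1)}) :
    dil 1 (tr n f) ∈ band tr dil (gens Φ) (2 * n - 1) (2 * n + 1) := by
  rw [eq_boundaryPart_add Φ f]
  simp only [map_add, map_sum, map_smul, ← dilationSystem.tr_add]
  refine add_mem (add_mem ?_ (Submodule.sum_mem _ fun j _ => Submodule.smul_mem _ _ ?_))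
    (Submodule.sum_mem _ fun j _ => Submodule.smul_mem _ _ ?_)
  · exact band_mono (by omega) (by omega) (h.dil_tr_boundary_mem n hf)
  · exact band_mono (by omega) (by omega) (fine_inner_mem Φ n j)
  · exact band_mono (by omega) (by omega) (fine_inner_mem Φ (n + -1) j)

theorem X_two_mem_boundary (n r : ℤ) (hr : r = 0 ∨ r = 1) :
    X 2 (4 * n + r) ∈ band tr dil (gens Φ) (2 * n - 1) (2 * n + 1) := by
  have : X 2 (4 * n + r) = dil 1 (tr n (X 1 r)) := by
    rw [tr_X_one, dil_X, add_comm]; rfl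
  rw [this]
  apply h.dil_tr_mem_of_boundary
  rcases hr with rfl | rfl
  · exact Submodule.subset_span (Or.inl rfl)
  · exact Submodule.subset_span (Or.inr rfl)

theorem X_eq_smul : X 1 2 = ‖X 1 2‖ • Φ 0 ∧ X 1 3 = ‖X 1 3‖ • Φ 1 := by
  rw [h.zero_eq, h.one_eq, normE, normE, smul_inv_smul₀ (norm_ne_zero_iff.2 (X_ne_zero 1 2)),
    smul_inv_smul₀ (norm_ne_zero_iff.2 (X_ne_zero 1 3))]
  exact ⟨rfl, rfl⟩

theorem X_two_mem_inner (n r : ℤ) (hr : r = 2 ∨ r = 3) :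
    X 2 (4 * n + r) ∈ band tr dil (gens Φ) (2 * n + 1) (2 * n + 1) := by
  have : X 2 (4 * n + r) = dil 1 (tr n (X 1 r)) := by
    rw [tr_X_one, dil_X, add_comm]; rfl
  rw [this]
  rcases hr with rfl | rfl
  · rw [h.X_eq_smul.1, map_smul, map_smul]
    exact Submodule.smul_mem _ _ (fine_inner_mem Φ n 0)
  · rw [h.X_eq_smul.2, map_smul, map_smul]
    exact Submodule.smul_mem _ _ (fine_inner_mem Φ n 1)

theorem X_two_mem (m : ℤ) : X 2 m ∈ band tr dil (gens Φ) (2 * (m / 4) - 1) (2 * (m / 4) + 1) := by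
  have e : 4 * (m / 4) + m % 4 = m := by omega
  rcases (by omega : m % 4 = 0 ∨ m % 4 = 1 ∨ m % 4 = 2 ∨ m % 4 = 3) with hr | hr | hr | hr
  · have := h.X_two_mem_boundary (m / 4) (m % 4) (Or.inl hr)
    rwa [e] at this
  · have := h.X_two_mem_boundary (m / 4) (m % 4) (Or.inr hr)
    rwa [e] at this
  · have := h.X_two_mem_inner (m / 4) (m % 4) (Or.inl hr)
    rw [e] at this
    exact band_mono (by omega) le_rfl this
  · have := h.X_two_mem_inner (m / 4) (m % 4) (Or.inr hr)
    rw [e] at this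
    exact band_mono (by omega) le_rfl this

/-- The level-two splines at the outer nodes are multiples of dilates of `Φ 0` and `Φ 1`, at
positions `1` and `3`; those at the middle node spread over positions `1` to `3`. -/
theorem inner_mem_band (i : Fin 4) : Φ i ∈ band tr dil (gens Φ) 1 3 := by
  refine Submodule.span_le.2 ?_ (h.mem i)
  rintro _ ⟨m, ⟨hm1, hm2⟩, rfl⟩
  rcases (by omega : m = 2 ∨ m = 3 ∨ m = 4 ∨ m = 5 ∨ m = 6 ∨ m = 7) with
    rfl | rfl | rfl | rfl | rfl | rfl
  · exact band_mono le_rfl (by norm_num) (h.X_two_mem_inner 0 2 (by norm_num))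
  · exact band_mono le_rfl (by norm_num) (h.X_two_mem_inner 0 3 (by norm_num))
  · exact h.X_two_mem 4
  · exact h.X_two_mem 5
  · exact band_mono (by norm_num) le_rfl (h.X_two_mem_inner 1 2 (by norm_num))
  · exact band_mono (by norm_num) le_rfl (h.X_two_mem_inner 1 3 (by norm_num))

theorem boundaryPart_mem_band {f : Spline} (hf : f ∈ band tr dil (gens Φ) (-3) 3) :
    boundaryPart Φ f ∈ band tr dil (gens Φ) (-3) 3 := by
  refine sub_mem (sub_mem hf (Submodule.sum_mem _ fun j _ => Submodule.smul_mem _ _ ?_))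
    (Submodule.sum_mem _ fun j _ => Submodule.smul_mem _ _ ?_)
  · exact band_mono (by norm_num) le_rfl (h.inner_mem_band j)
  · exact band_mono (by norm_num) (by norm_num)
      (dilationSystem.tr_mem_band (-1) (h.inner_mem_band j))

theorem X_two_mem_wide (m : ℤ) (h1 : -2 ≤ m) (h2 : m ≤ 3) :
    X 2 m ∈ band tr dil (gens Φ) (-3) 3 :=
  band_mono (by omega) (by omega) (h.X_two_mem m)

theorem boundary_mem_band {e : Spline}
    (he : e ∈ Submodule.span ℝ {boundaryPart Φ (X 1 0), boundaryPart Φ (X 1 1)}) :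
    e ∈ band tr dil (gens Φ) (-3) 3 := by
  have hm := fun m h1 h2 => h.X_two_mem_wide m h1 h2
  refine Submodule.span_le.2 ?_ he
  rintro s (rfl | rfl)
  · refine h.boundaryPart_mem_band ?_
    rw [X_even 1 0 rfl]
    refine Submodule.smul_mem _ _ (sub_mem (add_mem (add_mem (add_mem (Submodule.smul_mem _ _ ?_)
      ?_) (Submodule.smul_mem _ _ ?_)) (Submodule.smul_mem _ _ ?_)) (Submodule.smul_mem _ _ ?_)) <;>
    exact hm _ (by norm_num) (by norm_num)
  · refine h.boundaryPart_mem_band ?_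
    rw [X_odd 1 1 rfl]
    refine Submodule.smul_mem _ _ (sub_mem (add_mem (sub_mem (add_mem (Submodule.smul_mem _ _ ?_)
      (Submodule.smul_mem _ _ ?_)) (Submodule.smul_mem _ _ ?_)) (Submodule.smul_mem _ _ ?_))
      (Submodule.smul_mem _ _ ?_)) <;>
    exact hm _ (by norm_num) (by norm_num)

theorem scalingSystem : ScalingSystem tr dil (gens Φ) where
  toDilationSystem := dilationSystem
  orth := h.inner_gens
  mem_band_inner i hi := by rw [gens_of_lt Φ i hi]; exact h.inner_mem_band _
  mem_band i := by
    by_cases hi : (i : ℕ) < 4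
    · rw [gens_of_lt Φ i hi]
      exact band_mono (by norm_num) le_rfl (h.inner_mem_band _)
    · exact h.boundary_mem_band (h.boundary_mem (by omega))

/-- One half of the interleaving, obtained from level two by dilation; it carries both the density
and the vanishing moments. -/
theorem X_mem_level (j m : ℤ) : X (j + 1) m ∈ level tr dil (gens Φ) j := by
  have h2 := h.X_two_mem m
  have hle : band tr dil (gens Φ) (2 * (m / 4) - 1) (2 * (m / 4) + 1) ≤ level tr dil (gens Φ) 1 := by
    refine Submodule.span_le.2 ?_
    rintro _ ⟨s, -, rfl⟩
    exact dil_tr_mem_level 1 s.1 s.2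
  have key : level tr dil (gens Φ) 1 ≤ (level tr dil (gens Φ) j).comap (dil (j - 1)).toLinearMap := by
    refine Submodule.span_le.2 ?_
    rintro _ ⟨s, rfl⟩
    change dil (j - 1) (dil 1 (tr s.1 (gens Φ s.2))) ∈ level tr dil (gens Φ) j
    rw [← dilationSystem.dil_add, sub_add_cancel]
    exact dil_tr_mem_level j s.1 s.2
  have := key (hle h2)
  change dil (j - 1) (X 2 m) ∈ level tr dil (gens Φ) j at this
  rwa [dil_X, show j - 1 + 2 = j + 1 by ring] at this

end InnerGenerators

end Spline

end CubicWavelet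

end

/-! ### Independence of the scaling functions on the unit interval -/

noncomputable section

namespace CubicWavelet

namespace Spline

theorem tr_mem_V_one {f : Spline} (n : ℤ) (hf : f ∈ V 1) : tr n f ∈ V 1 := by
  have : V 1 ≤ (V 1).comap (tr n).toLinearMap := by
    refine Submodule.span_le.2 ?_
    rintro _ ⟨m, rfl⟩
    change tr n (X 1 m) ∈ V 1
    rw [tr_X_one]
    exact X_mem_V _ _
  exact this hf

theorem dil_mem_V_two {f : Spline} (hf : f ∈ V 1) : dil 1 f ∈ V 2 := by
  have : V 1 ≤ (V 2).comap (dil 1).toLinearMap := by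
    refine Submodule.span_le.2 ?_
    rintro _ ⟨m, rfl⟩
    change dil 1 (X 1 m) ∈ V 2
    rw [dil_X]
    exact X_mem_V _ _
  exact this hf

theorem tr_mem_V_two {f : Spline} (n : ℤ) (hf : f ∈ V 2) : tr n f ∈ V 2 := by
  obtain ⟨g, hg, rfl⟩ := exists_eq_dil_of_mem_V (j := 1) hf
  rw [dilationSystem.tr_dil]
  exact dil_mem_V_two (tr_mem_V_one _ hg)

namespace InnerGenerators

variable {Φ : Fin 4 → Spline} (h : InnerGenerators Φ)
include h

theorem inner_mem_V_two (i : Fin 4) : Φ i ∈ V 2 :=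
  Submodule.span_mono (Set.image_subset_range _ _) (h.mem i)

/-- The other half of the interleaving. It allows `left_coords_eq_zero` and its mirror image to be
applied to combinations of scaling functions. -/
theorem gens_mem_V_two (i : Fin 6) : gens Φ i ∈ V 2 := by
  by_cases hi : (i : ℕ) < 4
  · rw [gens_of_lt Φ i hi]; exact h.inner_mem_V_two _
  have hb : ∀ m, boundaryPart Φ (X 1 m) ∈ V 2 := fun m =>
    sub_mem (sub_mem (V_le_succ 1 (X_mem_V 1 m))
      (Submodule.sum_mem _ fun j _ => Submodule.smul_mem _ _ (h.inner_mem_V_two j)))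
      (Submodule.sum_mem _ fun j _ => Submodule.smul_mem _ _ (tr_mem_V_two _ (h.inner_mem_V_two j)))
  refine Submodule.span_le.2 ?_ (h.boundary_mem (i := i) (by omega))
  rintro s (rfl | rfl) <;> exact hb _

theorem fine_apply_of_ge (s : ℤ × Fin 6) {x : ℝ} (hx : ((s.1 : ℝ) + 1) / 2 ≤ x) :
    fn (fine tr dil (gens Φ) s) x = 0 := by
  rw [fine, fn_dil_one, SuppIn.apply_right (h.tr_gens_suppIn s.1 s.2) (by linarith), mul_zero]

theorem fine_apply_of_le (s : ℤ × Fin 6) {x : ℝ} (hx : x ≤ ((s.1 : ℝ) - 1) / 2) :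
    fn (fine tr dil (gens Φ) s) x = 0 := by
  rw [fine, fn_dil_one, SuppIn.apply_left (h.tr_gens_suppIn s.1 s.2) (by linarith), mul_zero]

theorem fine_apply_of_le_inner (s : ℤ × Fin 6) (hs : (s.2 : ℕ) < 4) {x : ℝ}
    (hx : x ≤ (s.1 : ℝ) / 2) : fn (fine tr dil (gens Φ) s) x = 0 := by
  rw [fine, fn_dil_one,
    SuppIn.apply_left (SuppIn.tr (h.gens_inner_suppIn hs) s.1) (by linarith), mul_zero]

omit h in
theorem apply_eq_zero_of_band {a b : ℤ} {x : ℝ} {f : Spline}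
    (hs : ∀ s : ℤ × Fin 6, a ≤ pos s → pos s ≤ b → fn (fine tr dil (gens Φ) s) x = 0)
    (hf : f ∈ band tr dil (gens Φ) a b) : fn f x = 0 := by
  have : band tr dil (gens Φ) a b ≤ LinearMap.ker ((LinearMap.proj x).comp fn) := by
    refine Submodule.span_le.2 ?_
    rintro _ ⟨s, ⟨h1, h2⟩, rfl⟩
    exact hs s h1 h2
  exact this hf

theorem band_apply_of_neg {a b : ℤ} (hb : b ≤ -1) {f : Spline}
    (hf : f ∈ band tr dil (gens Φ) a b) {x : ℝ} (hx : 0 ≤ x) : fn f x = 0 := by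
  refine apply_eq_zero_of_band (fun s _ h2 => h.fine_apply_of_ge s ?_) hf
  have : s.1 ≤ -1 := by simp only [pos] at h2; split_ifs at h2 <;> omega
  have : (s.1 : ℝ) ≤ -1 := by exact_mod_cast this
  linarith

theorem band_apply_of_nonpos {a b : ℤ} (hb : b ≤ 0) {f : Spline}
    (hf : f ∈ band tr dil (gens Φ) a b) {x : ℝ} (hx : 1 / 2 ≤ x) : fn f x = 0 := by
  refine apply_eq_zero_of_band (fun s _ h2 => h.fine_apply_of_ge s ?_) hf
  have : s.1 ≤ 0 := by simp only [pos] at h2; split_ifs at h2 <;> omega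
  have : (s.1 : ℝ) ≤ 0 := by exact_mod_cast this
  linarith

theorem band_apply_of_four_le {a b : ℤ} (ha : 4 ≤ a) {f : Spline}
    (hf : f ∈ band tr dil (gens Φ) a b) {x : ℝ} (hx : x ≤ 1 / 2) : fn f x = 0 := by
  refine apply_eq_zero_of_band (fun s h1 _ => h.fine_apply_of_le s ?_) hf
  have : 2 ≤ s.1 := by simp only [pos] at h1; split_ifs at h1 <;> omega
  have : (2 : ℝ) ≤ s.1 := by exact_mod_cast this
  linarith

theorem band_apply_of_five_le {a b : ℤ} (ha : 5 ≤ a) {f : Spline}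
    (hf : f ∈ band tr dil (gens Φ) a b) {x : ℝ} (hx : x ≤ 1) : fn f x = 0 := by
  refine apply_eq_zero_of_band (fun s h1 _ => ?_) hf
  by_cases hs : (s.2 : ℕ) < 4
  · refine h.fine_apply_of_le_inner s hs ?_
    have : 2 ≤ s.1 := by simp only [pos, hs, if_true] at h1; omega
    have : (2 : ℝ) ≤ s.1 := by exact_mod_cast this
    linarith
  · refine h.fine_apply_of_le s ?_
    have : 3 ≤ s.1 := by simp only [pos, hs, if_false] at h1; omega
    have : (3 : ℝ) ≤ s.1 := by exact_mod_cast this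
    linarith

theorem exists_of_mem_band_single (n : ℤ) {f : Spline}
    (hf : f ∈ band tr dil (gens Φ) (2 * n) (2 * n)) :
    ∃ a b : ℝ, f = dil 1 (tr n (boundaryPart Φ (a • X 1 0 + b • X 1 1))) := by
  have hle : band tr dil (gens Φ) (2 * n) (2 * n) ≤
      (Submodule.span ℝ {boundaryPart Φ (X 1 0), boundaryPart Φ (X 1 1)}).map
        ((dil 1).toLinearMap.comp (tr n).toLinearMap) := by
    refine Submodule.span_le.2 ?_
    rintro _ ⟨s, ⟨h1, h2⟩, rfl⟩
    have hs : s.1 = n ∧ 4 ≤ (s.2 : ℕ) := by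
      simp only [pos] at h1 h2; split_ifs at h1 h2 <;> omega
    obtain ⟨rfl, hs⟩ := hs
    exact ⟨gens Φ s.2, h.boundary_mem hs, rfl⟩
  obtain ⟨e, he, rfl⟩ := hle hf
  obtain ⟨a, b, rfl⟩ := Submodule.mem_span_pair.1 he
  refine ⟨a, b, ?_⟩
  rw [boundaryPart_add, boundaryPart_smul, boundaryPart_smul]
  rfl

/-- Orthogonality removes the fine components living on `[0,1]`. Those reaching in from outside are
boundary halves at `0` and at `1`; since `f` lies in `V 2`, each of them agrees, after rescaling,
with an element of `V 1` on a unit interval, and is therefore zero. -/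
theorem eq_zero_on_unit {f : Spline} (hf : f ∈ band tr dil (gens Φ) (-3) 7) (hV : f ∈ V 2)
    (ho : ∀ g ∈ band tr dil (gens Φ) 1 3, inner ℝ g f = 0) {x : ℝ} (hx0 : 0 ≤ x) (hx1 : x ≤ 1) :
    fn f x = 0 := by
  have hS := h.scalingSystem
  obtain ⟨α, hα, y, hy, rfl⟩ := exists_band_split (b := 0) hf
  obtain ⟨m, hm, β, hβ, rfl⟩ := exists_band_split (b := 3) hy
  have hm0 : m = 0 := by
    have := ho m hm
    rwa [inner_add_right, inner_add_right, hS.inner_band hm hα (by omega),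
      hS.inner_band hm hβ (by omega), zero_add, add_zero, inner_self_eq_zero] at this
  subst hm0
  rw [zero_add] at *
  obtain ⟨α', hα', α0, hα0, rfl⟩ := exists_band_split (b := -1) hα
  obtain ⟨β0, hβ0, β', hβ', rfl⟩ := exists_band_split (b := 4) hβ
  obtain ⟨a, b, rfl⟩ := h.exists_of_mem_band_single 0 hα0
  obtain ⟨a', b', rfl⟩ := h.exists_of_mem_band_single 2 hβ0
  obtain ⟨F, hF, hFf⟩ := exists_eq_dil_of_mem_V (j := 1) hV
  rw [dilationSystem.tr_zero] at *
  have hc := rootTwo_pos.ne'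
  -- On `[0, 1/2]` only the component at position `0` survives, and in the variable `2x` it is a
  -- boundary part. The next statement treats position `4` on `[1/2, 1]`.
  have hleft : ∀ y : ℝ, 0 ≤ y → y ≤ 1 →
      fn F y = fn (boundaryPart Φ (a • X 1 0 + b • X 1 1)) y := fun y h0 h1 => by
    have := congrArg (fun g => fn g (y / 2)) hFf
    simp only [map_add, Pi.add_apply] at this
    rw [h.band_apply_of_neg (by omega) hα' (by linarith),
      h.band_apply_of_four_le (by omega) hβ0 (by linarith),
      h.band_apply_of_four_le (by omega) hβ' (by linarith), fn_dil_one, fn_dil_one,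
      mul_div_cancel₀ _ two_ne_zero] at this
    refine mul_left_cancel₀ hc ?_
    rw [this]
    simp
  have hright : ∀ y : ℝ, 0 ≤ y → y ≤ 1 →
      fn (tr (-1) F) y = fn (tr 1 (boundaryPart Φ (a' • X 1 0 + b' • X 1 1))) y := fun y h0 h1 => by
    have := congrArg (fun g => fn g ((y + 1) / 2)) hFf
    simp only [map_add, Pi.add_apply] at this
    rw [h.band_apply_of_neg (by omega) hα' (by linarith),
      h.band_apply_of_nonpos (by omega) hα0 (by linarith),
      h.band_apply_of_five_le (by omega) hβ' (by linarith), fn_dil_one, fn_dil_one,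
      mul_div_cancel₀ _ two_ne_zero, fn_tr] at this
    rw [fn_tr, fn_tr]
    refine mul_left_cancel₀ hc ?_
    have e1 : y + 1 - ((2 : ℤ) : ℝ) = y - ((1 : ℤ) : ℝ) := by push_cast; ring
    have e2 : y - ((-1 : ℤ) : ℝ) = y + 1 := by push_cast; ring
    rw [e2, this, e1]
    simp
  obtain ⟨rfl, rfl⟩ := h.left_coords_eq_zero hF hleft
  obtain ⟨rfl, rfl⟩ := h.right_coords_eq_zero (tr_mem_V_one _ hF) hright
  have hb0 : boundaryPart Φ 0 = 0 := by simp [boundaryPart]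
  simp only [zero_smul, add_zero, hb0, map_zero, zero_add]
  rcases le_total x (1 / 2) with hx | hx
  · rw [map_add, Pi.add_apply, h.band_apply_of_neg (by omega) hα' hx0,
      h.band_apply_of_four_le (by omega) hβ' hx, add_zero]
  · rw [map_add, Pi.add_apply, h.band_apply_of_neg (by omega) hα' hx0,
      h.band_apply_of_five_le (by omega) hβ' hx1, add_zero]

/-- The scaling functions meeting the unit interval remain independent when projected to the
fine-scale functions supported there. -/
theorem coeff_eq_zero {c : Fin 6 → ℝ} {c4 c5 : ℝ}
    (ho : ∀ g ∈ band tr dil (gens Φ) 1 3, inner ℝ g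
      (∑ i, c i • gens Φ i + (c4 • tr 1 (gens Φ 4) + c5 • tr 1 (gens Φ 5))) = 0) :
    c = 0 ∧ c4 = 0 ∧ c5 = 0 := by
  have hS := h.scalingSystem
  have hband : ∑ i, c i • gens Φ i + (c4 • tr 1 (gens Φ 4) + c5 • tr 1 (gens Φ 5)) ∈
      band tr dil (gens Φ) (-3) 7 := by
    refine add_mem (Submodule.sum_mem _ fun i _ => Submodule.smul_mem _ _
      (band_mono le_rfl (by omega) (hS.mem_band i))) (add_mem (Submodule.smul_mem _ _ ?_)
      (Submodule.smul_mem _ _ ?_))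
    · exact band_mono (by omega) (by omega) (hS.tr_mem 4 1)
    · exact band_mono (by omega) (by omega) (hS.tr_mem 5 1)
  have hV : ∑ i, c i • gens Φ i + (c4 • tr 1 (gens Φ 4) + c5 • tr 1 (gens Φ 5)) ∈ V 2 :=
    add_mem (Submodule.sum_mem _ fun i _ => Submodule.smul_mem _ _ (h.gens_mem_V_two i))
      (add_mem (Submodule.smul_mem _ _ (tr_mem_V_two _ (h.gens_mem_V_two 4)))
        (Submodule.smul_mem _ _ (tr_mem_V_two _ (h.gens_mem_V_two 5))))
  -- The inner generators themselves lie in the test space `band 1 3`, so pairing with them isolates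
  -- their coefficients.
  have hinner : ∀ i : Fin 6, (i : ℕ) < 4 → c i = 0 := fun i hi => by
    have := ho _ (hS.mem_band_inner i hi)
    have hz : ∀ j, inner ℝ (gens Φ i) (gens Φ j) = if i = j then 1 else 0 := fun j => by
      have := hS.orth i j 0
      rw [dilationSystem.tr_zero] at this
      simpa using this
    simpa only [inner_add_right, inner_sum, real_inner_smul_right, hz, hS.orth, one_ne_zero,
      and_false, if_false, mul_ite, mul_one, mul_zero, add_zero, Finset.sum_ite_eq,
      Finset.mem_univ, if_true] using this
  -- What is left combines the two boundary pairs and vanishes pointwise on `[0,1]`;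
  -- `both_coords_eq_zero` then separates the pairs.
  have h0 : ∀ x : ℝ, 0 ≤ x → x ≤ 1 → fn (c 4 • gens Φ 4 + c 5 • gens Φ 5) x
      + fn (tr 1 (c4 • gens Φ 4 + c5 • gens Φ 5)) x = 0 := fun x hx0 hx1 => by
    have := h.eq_zero_on_unit hband hV ho hx0 hx1
    rw [Fin.sum_univ_six, hinner 0 (by decide), hinner 1 (by decide), hinner 2 (by decide),
      hinner 3 (by decide)] at this
    simpa using this
  have hz : ∀ a b : ℝ, a • gens Φ 4 + b • gens Φ 5 = 0 → a = 0 ∧ b = 0 := fun a b hab =>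
    LinearIndependent.pair_iff.1 h.orthonormal_boundary.linearIndependent a b hab
  have hmem : ∀ a b : ℝ, ∃ a' b' : ℝ, a • gens Φ 4 + b • gens Φ 5 =
      boundaryPart Φ (a' • X 1 0 + b' • X 1 1) := fun a b => by
    obtain ⟨a', b', hab⟩ := Submodule.mem_span_pair.1 (add_mem
      (Submodule.smul_mem _ a (h.boundary_mem (i := 4) (by decide)))
      (Submodule.smul_mem _ b (h.boundary_mem (i := 5) (by decide))))
    exact ⟨a', b', by rw [boundaryPart_add, boundaryPart_smul, boundaryPart_smul, hab]⟩
  obtain ⟨a, b, hab⟩ := hmem (c 4) (c 5)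
  obtain ⟨a', b', hab'⟩ := hmem c4 c5
  rw [hab, hab'] at h0
  obtain ⟨rfl, rfl, rfl, rfl⟩ := h.both_coords_eq_zero h0
  have hb0 : boundaryPart Φ 0 = 0 := by simp [boundaryPart]
  simp only [zero_smul, add_zero, hb0] at hab hab'
  obtain ⟨e4, e5⟩ := hz _ _ hab
  obtain ⟨f4, f5⟩ := hz _ _ hab'
  refine ⟨?_, f4, f5⟩
  ext i
  by_cases hi : (i : ℕ) < 4
  · exact hinner i hi
  · rcases (by omega : i = 4 ∨ i = 5) with rfl | rfl
    exacts [e4, e5]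

end InnerGenerators

end Spline

end CubicWavelet

end

/-! ### The first four scaling generators as splines -/

noncomputable section

namespace CubicWavelet

namespace Spline

theorem fn_normE (f : Spline) : fn (normE f) = normalized (fn f) := by
  rw [normE, map_smul, norm_eq, normalized]

theorem fn_resE {n : ℕ} (f : Spline) (e : Fin n → Spline) :
    fn (resE f e) = residual (fn f) (fun i => fn (e i)) := by
  rw [resE, map_sub, map_sum, residual]
  simp only [map_smul, inner_eq]

theorem residual_one {f a : ℝ → ℝ} : residual f ![a] = f - ip f a • a := by
  simp [residual]

theorem residual_two {f a b : ℝ → ℝ} :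
    residual f ![a, b] = f - (ip f a • a + ip f b • b) := by
  simp [residual, Fin.sum_univ_two]

theorem fn_resE_one (f a : Spline) : fn (resE f ![a]) = residual (fn f) ![fn a] := by
  rw [fn_resE]; congr 1; ext i; fin_cases i; rfl

theorem fn_resE_two (f a b : Spline) : fn (resE f ![a, b]) = residual (fn f) ![fn a, fn b] := by
  rw [fn_resE]; congr 1; ext i; fin_cases i <;> rfl

theorem fn_resE_three (f a b c : Spline) :
    fn (resE f ![a, b, c]) = residual (fn f) ![fn a, fn b, fn c] := by
  rw [fn_resE]; congr 1; ext i; fin_cases i <;> rfl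

/-! The orthogonality condition, rewritten without restrictions to `[0, 1]`. -/

/-- A truncated spline is no longer a spline, but the truncation is invisible to functions supported
in `[0,1]`. -/
theorem ip_indicator_sub (ξ r Z : Spline) (hZ : Z ∈ SuppIn 0 1) :
    ip ((Set.Icc (0 : ℝ) 1).indicator (fn ξ) - fn r) (fn Z) = inner ℝ (ξ - r) Z := by
  rw [inner_eq, ip, ip]
  congr 1
  ext x
  by_cases hx : x ∈ Set.Icc (0 : ℝ) 1
  · simp [Set.indicator_of_mem hx]
  · rw [Set.mem_Icc, not_and_or, not_le, not_le] at hx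
    rw [hZ x hx, mul_zero, mul_zero]

/-- By orthonormality, removing first the components along `Φ 0, Φ 1` and then those along `Φ 2, Φ
3` removes the whole projection at once. -/
theorem residual_residual {Φ : Fin 4 → Spline} (ho : Orthonormal ℝ Φ)
    (hs : ∀ i, Φ i ∈ SuppIn 0 1) (ξ : Spline) :
    residual (residual ((Set.Icc (0 : ℝ) 1).indicator (fn ξ)) ![fn (Φ 0), fn (Φ 1)])
      ![fn (Φ 2), fn (Φ 3)] = (Set.Icc (0 : ℝ) 1).indicator (fn ξ) - fn (innerPart Φ ξ) := by
  have ho' := orthonormal_iff_ite.1 ho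
  have h0 : ∀ Z ∈ SuppIn 0 1, ip ((Set.Icc (0 : ℝ) 1).indicator (fn ξ)) (fn Z) = inner ℝ ξ Z :=
    fun Z hZ => by simpa using ip_indicator_sub ξ 0 Z hZ
  have h1 : residual ((Set.Icc (0 : ℝ) 1).indicator (fn ξ)) ![fn (Φ 0), fn (Φ 1)] =
      (Set.Icc (0 : ℝ) 1).indicator (fn ξ) - fn (inner ℝ ξ (Φ 0) • Φ 0 + inner ℝ ξ (Φ 1) • Φ 1) := by
    rw [residual_two, h0 _ (hs 0), h0 _ (hs 1), map_add, map_smul, map_smul]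
  rw [h1, residual_two, ip_indicator_sub _ _ _ (hs 2), ip_indicator_sub _ _ _ (hs 3), sub_sub]
  congr 1
  simp only [inner_sub_left, inner_add_left, real_inner_smul_left, ho']
  simp [innerPart, Fin.sum_univ_four, add_assoc]

/-- As `ξ` and `η` never overlap, expanding the product leaves `0 - S - S + S`, where `S` is the
pairing of the two projections. -/
theorem ip_residual_residual {Φ : Fin 4 → Spline} (ho : Orthonormal ℝ Φ)
    (hs : ∀ i, Φ i ∈ SuppIn 0 1) {ξ η : Spline} (hξη : ∀ x, fn ξ x * fn η x = 0) :
    ip ((Set.Icc (0 : ℝ) 1).indicator (fn ξ) - fn (innerPart Φ ξ))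
      ((Set.Icc (0 : ℝ) 1).indicator (fn η) - fn (innerPart Φ η)) =
      -∑ m, inner ℝ ξ (Φ m) * inner ℝ η (Φ m) := by
  have hp : ∀ f, innerPart Φ f ∈ SuppIn 0 1 := fun f =>
    Submodule.sum_mem _ fun i _ => Submodule.smul_mem _ _ (hs i)
  have e1 : ip ((Set.Icc (0 : ℝ) 1).indicator (fn ξ) - fn (innerPart Φ ξ))
      ((Set.Icc (0 : ℝ) 1).indicator (fn η) - fn (innerPart Φ η)) =
      inner ℝ (ξ - innerPart Φ ξ) (η - innerPart Φ η) := by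
    rw [inner_eq, ip, ip]
    congr 1
    ext x
    by_cases hx : x ∈ Set.Icc (0 : ℝ) 1
    · simp [Set.indicator_of_mem hx]
    · have hx' := hx
      rw [Set.mem_Icc, not_and_or, not_le, not_le] at hx'
      simp [Set.indicator_of_notMem hx, hp _ x hx', hξη]
  have e2 : inner ℝ ξ η = 0 := by
    rw [inner_eq, ip]; simp [hξη]
  have e3 : ∀ f g, inner ℝ f (innerPart Φ g) = ∑ m, inner ℝ f (Φ m) * inner ℝ g (Φ m) :=
    fun f g => by simp [innerPart, inner_sum, real_inner_smul_right, mul_comm]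
  have e4 : ∀ g m, inner ℝ (innerPart Φ g) (Φ m) = inner ℝ g (Φ m) := fun g m => by
    rw [innerPart, real_inner_comm, ho.inner_right_fintype]
  rw [e1, inner_sub_left, inner_sub_right, inner_sub_right, e2, e3, e3,
    real_inner_comm, e3]
  simp only [e4, mul_comm]
  ring

end Spline

open Spline

/-- The conditions on the free data of the scaling generators. -/
structure Choice.ScalingAdmissible (P : Choice) : Prop where
  basisC : IsNullBasis matC P.bC
  s_norm : ∀ i, ∑ j, P.s i j ^ 2 = 1
  s_orth : ∑ j, P.s 0 j * P.s 1 j = 0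
  cond : ∀ i ∈ ({0, 1} : Set (Fin 4)), ∀ k ∈ ({2, 3} : Set (Fin 4)),
    ip (residual (cfun i) ![P.phi3, P.phi4]) (residual (cfun k) ![P.phi3, P.phi4]) = 0

theorem Choice.Admissible.scaling {P : Choice} (h : P.Admissible) : P.ScalingAdmissible :=
  ⟨h.basisC, h.s_norm, h.s_orth, h.cond⟩

namespace Choice

variable (P : Choice)

/-- The functions `w_i` as splines. -/
def eW (i : Fin 4) : Spline := ∑ j : Fin 6, P.bC i j • X 2 ((j : ℤ) + 2)

/-- The functions `v_i` as splines. -/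
def eV1 : Spline := normE (P.eW 0)

/-- See `eV1`. -/
def eV2 : Spline := normE (resE (P.eW 1) ![P.eV1])

/-- See `eV1`. -/
def eV3 : Spline := normE (resE (P.eW 2) ![P.eV1, P.eV2])

/-- See `eV1`. -/
def eV4 : Spline := normE (resE (P.eW 3) ![P.eV1, P.eV2, P.eV3])

/-- The functions `v_i` as splines. -/
def eV : Fin 4 → Spline := ![P.eV1, P.eV2, P.eV3, P.eV4]

/-- The first four scaling generators as splines. -/
def ePhi : Fin 4 → Spline :=
  ![normE (X 1 2), normE (X 1 3), ∑ j, P.s 0 j • P.eV j, ∑ j, P.s 1 j • P.eV j]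

theorem fn_eW (i : Fin 4) : fn (P.eW i) = P.w i := by
  rw [eW, w, map_sum]
  simp only [map_smul, fn_X]

theorem fn_eV1 : fn P.eV1 = P.v1 := by rw [eV1, fn_normE, fn_eW, v1]

theorem fn_eV2 : fn P.eV2 = P.v2 := by rw [eV2, fn_normE, fn_resE_one, fn_eW, fn_eV1, v2]

theorem fn_eV3 : fn P.eV3 = P.v3 := by
  rw [eV3, fn_normE, fn_resE_two, fn_eW, fn_eV1, fn_eV2, v3]

theorem fn_eV4 : fn P.eV4 = P.v4 := by
  rw [eV4, fn_normE, fn_resE_three, fn_eW, fn_eV1, fn_eV2, fn_eV3, v4]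

theorem fn_eV (j : Fin 4) : fn (P.eV j) = P.v j := by
  fin_cases j
  · exact P.fn_eV1
  · exact P.fn_eV2
  · exact P.fn_eV3
  · exact P.fn_eV4

theorem fn_ePhi_zero : fn (P.ePhi 0) = phi1 := by
  rw [show P.ePhi 0 = normE (X 1 2) from rfl, fn_normE, fn_X, phi1]

theorem fn_ePhi_one : fn (P.ePhi 1) = phi2 := by
  rw [show P.ePhi 1 = normE (X 1 3) from rfl, fn_normE, fn_X, phi2]

theorem fn_ePhi_two : fn (P.ePhi 2) = P.phi3 := by
  rw [show P.ePhi 2 = ∑ j, P.s 0 j • P.eV j from rfl, map_sum, phi3]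
  simp only [map_smul, fn_eV]

theorem fn_ePhi_three : fn (P.ePhi 3) = P.phi4 := by
  rw [show P.ePhi 3 = ∑ j, P.s 1 j • P.eV j from rfl, map_sum, phi4]
  simp only [map_smul, fn_eV]

theorem fn_ePhi (j : Fin 4) : fn (P.ePhi j) = P.phiIn j := by
  fin_cases j
  · exact P.fn_ePhi_zero
  · exact P.fn_ePhi_one
  · exact P.fn_ePhi_two
  · exact P.fn_ePhi_three

theorem eW_suppIn (i : Fin 4) : P.eW i ∈ SuppIn 0 1 := by
  refine Submodule.sum_mem _ fun j _ => Submodule.smul_mem _ _ ?_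
  refine SuppIn.mono ?_ ?_ (X_suppIn 2 ((j : ℤ) + 2))
  · have : (1 : ℤ) ≤ ((j : ℤ) + 2) / 2 := by omega
    have : (1 : ℝ) ≤ ((((j : ℤ) + 2) / 2 : ℤ) : ℝ) := by exact_mod_cast this
    exact div_nonneg (by linarith) (by positivity)
  · have : ((j : ℤ) + 2) / 2 ≤ 3 := by omega
    have : ((((j : ℤ) + 2) / 2 : ℤ) : ℝ) ≤ 3 := by exact_mod_cast this
    rw [div_le_one (by positivity)]
    norm_num
    linarith

theorem eW_mem (i : Fin 4) : P.eW i ∈ Submodule.span ℝ (X 2 '' {m | 2 ≤ m ∧ m ≤ 7}) :=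
  Submodule.sum_mem _ fun j _ => Submodule.smul_mem _ _
    (Submodule.subset_span ⟨_, ⟨by omega, by omega⟩, rfl⟩)

end Choice

/-- The six fine splines supported in the unit interval are linearly independent. -/
theorem linearIndependent_X_two : LinearIndependent ℝ fun j : Fin 6 => X 2 ((j : ℤ) + 2) := by
  rw [Fintype.linearIndependent_iff]
  intro b hb
  have hd : dil 2 (∑ j : Fin 6, b j • tr (((j : ℤ) + 2) / 2) (herm ((j : ℤ) + 2))) = 0 := by
    rw [← hb, map_sum]
    simp only [map_smul]
    rfl
  have h0 := (dil 2).injective (hd.trans (map_zero _).symm)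
  have hx : ∀ x : ℝ, b 0 * hermite1 (x - 1) + b 1 * hermite2 (x - 1) + b 2 * hermite1 (x - 2)
      + b 3 * hermite2 (x - 2) + b 4 * hermite1 (x - 3) + b 5 * hermite2 (x - 3) = 0 := fun x => by
    have := congrArg (fun f => fn f x) h0
    rw [Fin.sum_univ_six] at this
    simp only [map_add, map_smul, Pi.add_apply, Pi.smul_apply, smul_eq_mul, fn_tr, fn_herm] at this
    norm_num at this
    exact this
  -- Integer points isolate the coefficients of `hermite1`; the half-integer points then determine
  -- those of `hermite2` from left to right.
  have e1 := hx 1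
  have e2 := hx 2
  have e3 := hx 3
  have e4 := hx (1 / 2)
  have e5 := hx (3 / 2)
  have e6 := hx (5 / 2)
  norm_num [hermite1, hermite2] at e1 e2 e3 e4 e5 e6
  have z1 : b 1 = 0 := by linarith
  have z3 : b 3 = 0 := by linarith
  have z5 : b 5 = 0 := by linarith
  intro i
  fin_cases i <;> assumption

namespace Choice

variable {P : Choice}

theorem linearIndependent_eW (h : LinearIndependent ℝ P.bC) : LinearIndependent ℝ P.eW :=
  h.map' (Fintype.linearCombination ℝ (fun j : Fin 6 => X 2 ((j : ℤ) + 2)))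
    (LinearMap.ker_eq_bot.2 linearIndependent_X_two.fintypeLinearCombination_injective)

theorem gramSchmidt_eW (h : LinearIndependent ℝ P.bC) : Orthonormal ℝ P.eV ∧
    Submodule.span ℝ (Set.range P.eV) = Submodule.span ℝ (Set.range P.eW) :=
  gramSchmidt_four (linearIndependent_eW h) rfl rfl rfl rfl

theorem eV_mem_span (h : LinearIndependent ℝ P.bC) (j : Fin 4) :
    P.eV j ∈ Submodule.span ℝ (Set.range P.eW) := by
  rw [← (gramSchmidt_eW h).2]
  exact Submodule.subset_span ⟨j, rfl⟩

theorem matC_apply (i : Fin 2) (j : Fin 6) :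
    matC i j = inner ℝ (X 1 ((i : ℤ) + 2)) (X 2 ((j : ℤ) + 2)) := by
  rw [inner_eq, fn_X, fn_X]; rfl

theorem inner_eW (h : IsNullBasis matC P.bC) (i : Fin 2) (k : Fin 4) :
    inner ℝ (X 1 ((i : ℤ) + 2)) (P.eW k) = 0 := by
  have hk : P.bC k ∈ LinearMap.ker matC.mulVecLin := h.2 ▸ Submodule.subset_span ⟨k, rfl⟩
  have := congrFun (LinearMap.mem_ker.1 hk) i
  simp only [Matrix.mulVecLin_apply, Matrix.mulVec, dotProduct, Pi.zero_apply, matC_apply] at this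
  rw [eW, inner_sum, ← this]
  simp only [real_inner_smul_right, mul_comm]

theorem inner_eV (h : IsNullBasis matC P.bC) (i : Fin 2) (k : Fin 4) : inner ℝ (X 1 ((i : ℤ) + 2)) (P.eV k) = 0 := by
  rw [real_inner_comm]
  refine inner_eq_zero_of_mem_span ?_ (eV_mem_span h.1 k)
  rintro _ ⟨l, rfl⟩
  rw [real_inner_comm]
  exact inner_eW h i l

theorem inner_sum_eV (h : LinearIndependent ℝ P.bC) (c d : Fin 4 → ℝ) :
    inner ℝ (∑ j, c j • P.eV j) (∑ j, d j • P.eV j) = ∑ j, c j * d j := by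
  rw [(gramSchmidt_eW h).1.inner_sum]
  simp

theorem orthonormal_ePhi (h : IsNullBasis matC P.bC) (hs : ∀ i, ∑ j, P.s i j ^ 2 = 1)
    (s01 : ∑ j, P.s 0 j * P.s 1 j = 0) : Orthonormal ℝ P.ePhi := by
  have a0 : ∀ c : Fin 4 → ℝ, inner ℝ (X 1 2) (∑ j, c j • P.eV j) = 0 := fun c => by
    rw [inner_sum]
    exact Finset.sum_eq_zero fun j _ => by
      rw [real_inner_smul_right]
      have := inner_eV h 0 j
      norm_num at this
      rw [this, mul_zero]
  have a1 : ∀ c : Fin 4 → ℝ, inner ℝ (X 1 3) (∑ j, c j • P.eV j) = 0 := fun c => by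
    rw [inner_sum]
    exact Finset.sum_eq_zero fun j _ => by
      rw [real_inner_smul_right]
      have := inner_eV h 1 j
      norm_num at this
      rw [this, mul_zero]
  have n0 := norm_normE (X_ne_zero 1 2)
  have n1 := norm_normE (X_ne_zero 1 3)
  have x01 : inner ℝ (X 1 2) (X 1 3) = (0 : ℝ) := by rw [inner_X]; norm_num [gram]
  have s0 := hs 0
  have s1 := hs 1
  rw [orthonormal_iff_ite]
  have key : ∀ i j : Fin 4, i ≤ j → inner ℝ (P.ePhi i) (P.ePhi j) = if i = j then 1 else 0 := by
    intro i j hij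
    fin_cases i <;> fin_cases j <;> first | (exact absurd hij (by decide)) | skip
    · exact (real_inner_self_eq_norm_sq _).trans (by simp [ePhi, n0])
    · simp [ePhi, inner_normE_left, inner_normE_right, x01]
    · simp [ePhi, inner_normE_left, a0]
    · simp [ePhi, inner_normE_left, a0]
    · exact (real_inner_self_eq_norm_sq _).trans (by simp [ePhi, n1])
    · simp [ePhi, inner_normE_left, a1]
    · simp [ePhi, inner_normE_left, a1]
    · refine (inner_sum_eV h.1 _ _).trans ?_
      simpa [pow_two] using s0
    · refine (inner_sum_eV h.1 _ _).trans ?_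
      simpa using s01
    · refine (inner_sum_eV h.1 _ _).trans ?_
      simpa [pow_two] using s1
  intro i j
  rcases le_total i j with hij | hij
  · exact key i j hij
  · rw [real_inner_comm, key j i hij]
    simp [eq_comm]

theorem ePhi_suppIn (h : LinearIndependent ℝ P.bC) (i : Fin 4) : P.ePhi i ∈ SuppIn 0 1 := by
  have hV : ∀ c : Fin 4 → ℝ, ∑ j, c j • P.eV j ∈ SuppIn 0 1 := fun c =>
    Submodule.sum_mem _ fun j _ => Submodule.smul_mem _ _ (mem_of_mem_span
      (by rintro _ ⟨k, rfl⟩; exact P.eW_suppIn k)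
      (eV_mem_span h j))
  fin_cases i
  · exact Submodule.smul_mem _ _ X_two_suppIn
  · exact Submodule.smul_mem _ _ X_three_suppIn
  · exact hV _
  · exact hV _

theorem ePhi_mem (h : LinearIndependent ℝ P.bC) (i : Fin 4) :
    P.ePhi i ∈ Submodule.span ℝ (X 2 '' {m | 2 ≤ m ∧ m ≤ 7}) := by
  have hm : ∀ m, 2 ≤ m → m ≤ 7 → X 2 m ∈ Submodule.span ℝ (X 2 '' {m | 2 ≤ m ∧ m ≤ 7}) :=
    fun m h1 h2 => Submodule.subset_span ⟨m, ⟨h1, h2⟩, rfl⟩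
  have hV : ∀ c : Fin 4 → ℝ, ∑ j, c j • P.eV j ∈
      Submodule.span ℝ (X 2 '' {m | 2 ≤ m ∧ m ≤ 7}) := fun c =>
    Submodule.sum_mem _ fun j _ => Submodule.smul_mem _ _ (Submodule.span_le.2
      (by rintro _ ⟨k, rfl⟩; exact P.eW_mem k)
      (eV_mem_span h j))
  fin_cases i
  · refine Submodule.smul_mem _ _ ?_
    rw [X_even 1 2 rfl]
    refine Submodule.smul_mem _ _ (sub_mem (add_mem (add_mem (add_mem (Submodule.smul_mem _ _ ?_)
      ?_) (Submodule.smul_mem _ _ ?_)) (Submodule.smul_mem _ _ ?_)) (Submodule.smul_mem _ _ ?_)) <;>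
    exact hm _ (by norm_num) (by norm_num)
  · refine Submodule.smul_mem _ _ ?_
    rw [X_odd 1 3 rfl]
    refine Submodule.smul_mem _ _ (sub_mem (add_mem (sub_mem (add_mem (Submodule.smul_mem _ _ ?_)
      (Submodule.smul_mem _ _ ?_)) (Submodule.smul_mem _ _ ?_)) (Submodule.smul_mem _ _ ?_))
      (Submodule.smul_mem _ _ ?_)) <;>
    exact hm _ (by norm_num) (by norm_num)
  · exact hV _
  · exact hV _

/-- The indices of the functions behind `c_1, …, c_4`. -/
def cIndex : Fin 4 → ℤ := ![0, 1, 4, 5]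

theorem X_mul_X_eq_zero {i k : ℤ} (hi : i = 0 ∨ i = 1) (hk : k = 4 ∨ k = 5) (x : ℝ) :
    fn (X 1 i) x * fn (X 1 k) x = 0 := by
  have h1 := X_suppIn 1 i
  have h2 := X_suppIn 1 k
  rw [show i / 2 = 0 by omega] at h1
  rw [show k / 2 = 2 by omega] at h2
  rcases le_total x (1 / 2) with hx | hx
  · rw [SuppIn.apply_left h2 (by norm_num; linarith), mul_zero]
  · rw [SuppIn.apply_right h1 (by norm_num; linarith), zero_mul]

/-- This turns the requirement on the truncated functions `c_i` into the finite sum used in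
`InnerGenerators`, up to sign. -/
theorem ip_residual_cfun (ho : Orthonormal ℝ P.ePhi) (hs : ∀ i, P.ePhi i ∈ SuppIn 0 1)
    {i k : Fin 4} (hi : i = 0 ∨ i = 1) (hk : k = 2 ∨ k = 3) :
    ip (residual (cfun i) ![P.phi3, P.phi4]) (residual (cfun k) ![P.phi3, P.phi4]) =
      -∑ m, inner ℝ (X 1 (cIndex i)) (P.ePhi m) * inner ℝ (X 1 (cIndex k)) (P.ePhi m) := by
  have key : ∀ i, residual (cfun i) ![P.phi3, P.phi4] =
      (Set.Icc (0 : ℝ) 1).indicator (fn (X 1 (cIndex i))) - fn (innerPart P.ePhi (X 1 (cIndex i))) := by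
    intro i
    rw [← residual_residual ho hs, fn_ePhi_zero, fn_ePhi_one, fn_ePhi_two, fn_ePhi_three, fn_X]
    rfl
  rw [key, key]
  refine ip_residual_residual ho hs (X_mul_X_eq_zero ?_ ?_)
  · rcases hi with rfl | rfl <;> simp [cIndex]
  · rcases hk with rfl | rfl <;> simp [cIndex]

theorem ScalingAdmissible.innerGenerators (h : P.ScalingAdmissible) : InnerGenerators P.ePhi where
  orthonormal := orthonormal_ePhi h.basisC h.s_norm h.s_orth
  suppIn := ePhi_suppIn h.basisC.1
  mem := ePhi_mem h.basisC.1
  zero_eq := rfl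
  one_eq := rfl
  cond := by
    have key : ∀ i k : Fin 4, (i = 0 ∨ i = 1) → (k = 2 ∨ k = 3) →
        ∑ m, inner ℝ (X 1 (cIndex i)) (P.ePhi m) * inner ℝ (X 1 (cIndex k)) (P.ePhi m) = 0 := by
      intro i k hi hk
      have := h.cond i (by simpa using hi) k (by simpa using hk)
      rw [ip_residual_cfun (orthonormal_ePhi h.basisC h.s_norm h.s_orth) (ePhi_suppIn h.basisC.1) hi hk] at this
      linarith
    rintro i (rfl | rfl) k (rfl | rfl)
    · exact key 0 2 (by simp) (by simp)
    · exact key 0 3 (by simp) (by simp)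
    · exact key 1 2 (by simp) (by simp)
    · exact key 1 3 (by simp) (by simp)

end Choice

end CubicWavelet

end

/-! ### The two boundary generators as splines, and the index bookkeeping -/

noncomputable section

namespace CubicWavelet

open Spline

namespace Choice

variable {P : Choice}

theorem fn_boundaryPart_ePhi (f : Spline) : fn (boundaryPart P.ePhi f) =
    fn f - ∑ j, ip (fn f) (P.phiIn j) • P.phiIn j
      - ∑ j, ip (fn f) (fun x => P.phiIn j (x + 1)) • fun x => P.phiIn j (x + 1) := by
  have e : ∀ j, fn (tr (-1) (P.ePhi j)) = fun x => P.phiIn j (x + 1) := fun j => by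
    ext x
    rw [fn_tr, fn_ePhi]
    norm_num
  simp only [boundaryPart, map_sub, map_sum, map_smul, inner_eq, e, fn_ePhi]

theorem fn_gen5 : fn (gen5 P.ePhi) = P.phi5 := by
  rw [gen5, fn_normE, fn_boundaryPart_ePhi, fn_X]
  rfl

/-- Orthonormalizing the two boundary parts gives the prescribed function: the component along `φ_5`
is the same for `ξ_{1,1}` and for its boundary part, and the component along `φ_5(· + 1)` is zero.
-/
theorem fn_gen6 (h : InnerGenerators P.ePhi) : fn (gen6 P.ePhi) = P.phi6 := by
  have hb : gen5 P.ePhi ∈ Submodule.span ℝ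
      {boundaryPart P.ePhi (X 1 0), boundaryPart P.ePhi (X 1 1)} := h.boundary_mem (i := 4) (by decide)
  have e1 : inner ℝ (boundaryPart P.ePhi (X 1 1)) (gen5 P.ePhi) = inner ℝ (X 1 1) (gen5 P.ePhi) := by
    have a1 : ∀ j, inner ℝ (P.ePhi j) (gen5 P.ePhi) = 0 := fun j => by
      rw [gen5, inner_normE_right, h.inner_boundaryPart, mul_zero]
    have a2 : ∀ j, inner ℝ (tr (-1) (P.ePhi j)) (gen5 P.ePhi) = 0 := fun j => by
      rw [gen5, inner_normE_right, h.inner_tr_boundaryPart, mul_zero]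
    rw [boundaryPart, inner_sub_left, inner_sub_left, sum_inner, sum_inner]
    simp only [real_inner_smul_left, a1, a2]
    simp
  -- Distance-one orthogonality holds for the boundary part of `X 1 1`; the inner functions removed
  -- from it are orthogonal to this translate as well.
  have e2 : inner ℝ (X 1 1) (tr (-1) (gen5 P.ePhi)) = (0 : ℝ) := by
    have := h.inner_boundary_tr hb (Submodule.subset_span (Set.mem_insert_of_mem _ rfl))
    have a1 : ∀ j, inner ℝ (gen5 P.ePhi) (tr 1 (P.ePhi j)) = 0 := fun j =>
      SuppIn.inner_eq_zero (h.gens_suppIn 4) (h.tr_suppIn j 1) (Or.inl (by norm_num))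
    have a2 : ∀ j, inner ℝ (gen5 P.ePhi) (tr 1 (tr (-1) (P.ePhi j))) = 0 := fun j => by
      rw [← dilationSystem.tr_add, add_neg_cancel, dilationSystem.tr_zero, real_inner_comm, gen5,
        inner_normE_right, h.inner_boundaryPart, mul_zero]
    rw [boundaryPart, map_sub, map_sub, inner_sub_right, inner_sub_right, map_sum, map_sum,
      inner_sum, inner_sum] at this
    simp only [map_smul, real_inner_smul_right, a1, a2, mul_zero, Finset.sum_const_zero,
      sub_zero] at this
    rwa [← dilationSystem.inner_tr_left, real_inner_comm]
  have e3 : fn (tr (-1) (gen5 P.ePhi)) = fun x => P.phi5 (x + 1) := by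
    ext x
    rw [fn_tr, fn_gen5]
    norm_num
  have e4 : fn (resE (boundaryPart P.ePhi (X 1 1)) ![gen5 P.ePhi]) = P.g6 := by
    have f1 : ip (xi 1 1) P.phi5 = inner ℝ (X 1 1) (gen5 P.ePhi) := by
      rw [inner_eq, fn_X, fn_gen5]
    have f2 : ip (xi 1 1) (fun x => P.phi5 (x + 1)) = 0 := by
      rw [← e2, inner_eq, fn_X, e3]
    have l1 : ∀ a : Fin 5 → ℝ → ℝ, ∑ j, a j = ∑ j : Fin 4, a j.castSucc + a 4 := fun a =>
      Fin.sum_univ_castSucc a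
    have l2 : ∀ j : Fin 4, P.phiFive j.castSucc = P.phiIn j := fun j => by
      fin_cases j <;> rfl
    have l3 : P.phiFive 4 = P.phi5 := rfl
    rw [fn_resE_one, residual_one, ← inner_eq, e1, fn_gen5, fn_boundaryPart_ePhi, g6, l1, l1]
    simp only [l2, l3, f1, f2, fn_X, zero_smul, add_zero]
    abel
  rw [gen6, fn_normE, e4, phi6]

/-- The scaling generators as splines. -/
theorem fn_gens (h : InnerGenerators P.ePhi) (i : Fin 6) : fn (gens P.ePhi i) = P.phi i := by
  fin_cases i
  · exact P.fn_ePhi_zero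
  · exact P.fn_ePhi_one
  · exact P.fn_ePhi_two
  · exact P.fn_ePhi_three
  · exact fn_gen5
  · exact fn_gen6 h

end Choice

namespace Spline

/-- Translation number belonging to the index `m`, if the first `r` generators are translated by
one less. -/
def shiftOf (r : ℕ) (m : ℤ) : ℤ :=
  if ((m - 1) % 6).toNat < r then (m - 1) / 6 else (m - 1) / 6 + 1

/-- Number of the generator belonging to the index `m`. -/
def genOf (m : ℤ) : Fin 6 := ⟨((m - 1) % 6).toNat, by omega⟩

theorem shiftOf_genOf_inj {r : ℕ} {m n : ℤ} : shiftOf r m = shiftOf r n ∧ genOf m = genOf n ↔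
    m = n := by
  refine ⟨fun ⟨h1, h2⟩ => ?_, by rintro rfl; exact ⟨rfl, rfl⟩⟩
  have h2' : ((m - 1) % 6).toNat = ((n - 1) % 6).toNat := congrArg Fin.val h2
  rw [shiftOf, shiftOf, h2'] at h1
  split_ifs at h1 <;> omega

theorem exists_index (r : ℕ) (n : ℤ) (i : Fin 6) : ∃ m, shiftOf r m = n ∧ genOf m = i := by
  by_cases hi : (i : ℕ) < r
  · refine ⟨6 * n + i + 1, ?_⟩
    have e : ((6 * n + i + 1 - 1) % 6).toNat = (i : ℕ) := by omega
    refine ⟨?_, Fin.ext e⟩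
    rw [shiftOf, e, if_pos hi]
    omega
  · refine ⟨6 * (n - 1) + i + 1, ?_⟩
    have e : ((6 * (n - 1) + i + 1 - 1) % 6).toNat = (i : ℕ) := by omega
    refine ⟨?_, Fin.ext e⟩
    rw [shiftOf, e, if_neg hi]
    omega

/-- The dilated and translated functions as splines. -/
theorem fn_dil_tr {f : Fin 6 → Spline} {g : Fin 6 → ℝ → ℝ} (hfg : ∀ i, fn (f i) = g i) (r : ℕ)
    (j m : ℤ) : fn (dil j (tr (shiftOf r m) (f (genOf m)))) = dilTrans r g j m := by
  ext x
  rw [fn_dil, fn_tr, hfg]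
  rfl

end Spline

end CubicWavelet

end

/-! ### Null spaces of matrices of inner products -/

noncomputable section

namespace CubicWavelet

section NullBasis

variable {E : Type*} [NormedAddCommGroup E] [InnerProductSpace ℝ E]

/-- A matrix with linearly independent rows has a null basis of the expected size. -/
theorem exists_isNullBasis {m n d : ℕ} (hn : m + d = n) {M : Matrix (Fin m) (Fin n) ℝ}
    (hM : LinearIndependent ℝ M.row) : ∃ b : Fin d → Fin n → ℝ, IsNullBasis M b := by
  have h1 : M.rank = m := by simpa using hM.rank_matrix
  have h2 : Module.finrank ℝ (LinearMap.ker M.mulVecLin) = d := by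
    have := LinearMap.finrank_range_add_finrank_ker M.mulVecLin
    rw [← Matrix.rank, h1] at this
    simp at this
    omega
  let B := Module.finBasisOfFinrankEq ℝ _ h2
  refine ⟨fun i => (B i : Fin n → ℝ), ?_, ?_⟩
  · exact B.linearIndependent.map' (LinearMap.ker M.mulVecLin).subtype (Submodule.ker_subtype _)
  · have : Set.range (fun i => (B i : Fin n → ℝ)) =
        (LinearMap.ker M.mulVecLin).subtype '' Set.range B := by
      rw [← Set.range_comp]; rfl
    rw [this, ← Submodule.map_span, B.span_eq, Submodule.map_top, Submodule.range_subtype]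

variable {m n d : ℕ} {r : Fin m → E} {e : Fin n → E} {M : Matrix (Fin m) (Fin n) ℝ}

theorem mulVec_inner (hM : ∀ i j, M i j = inner ℝ (r i) (e j)) (b : Fin n → ℝ) (i : Fin m) :
    M.mulVec b i = inner ℝ (r i) (∑ j, b j • e j) := by
  rw [inner_sum]
  simp only [Matrix.mulVec, dotProduct, hM, real_inner_smul_right, mul_comm]

/-- The matrix of inner products of `r` and `e` has a null basis of the expected size, if no
nontrivial combination of the `r i` is orthogonal to all `e j`. -/
theorem exists_isNullBasis_inner (hn : m + d = n) (hM : ∀ i j, M i j = inner ℝ (r i) (e j))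
    (h : ∀ a : Fin m → ℝ, (∀ j, inner ℝ (e j) (∑ i, a i • r i) = 0) → a = 0) :
    ∃ b : Fin d → Fin n → ℝ, IsNullBasis M b := by
  refine exists_isNullBasis hn (Fintype.linearIndependent_iff.2 fun a ha => ?_)
  refine congrFun (h a fun j => ?_)
  have := congrFun ha j
  simp only [Finset.sum_apply, Pi.smul_apply, Matrix.row_apply, hM, smul_eq_mul,
    Pi.zero_apply] at this
  rw [inner_sum, ← this]
  simp only [real_inner_smul_right, real_inner_comm]

variable {b : Fin d → Fin n → ℝ}

theorem IsNullBasis.inner_eq_zero (hb : IsNullBasis M b) (hM : ∀ i j, M i j = inner ℝ (r i) (e j))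
    (i : Fin m) (k : Fin d) : inner ℝ (r i) (∑ j, b k j • e j) = 0 := by
  have hk : b k ∈ LinearMap.ker M.mulVecLin := hb.2 ▸ Submodule.subset_span ⟨k, rfl⟩
  rw [← mulVec_inner hM]
  exact congrFun (LinearMap.mem_ker.1 hk) i

theorem IsNullBasis.linearIndependent (hb : IsNullBasis M b) (he : LinearIndependent ℝ e) :
    LinearIndependent ℝ fun k => ∑ j, b k j • e j :=
  hb.1.map' (Fintype.linearCombination ℝ e)
    (LinearMap.ker_eq_bot.2 he.fintypeLinearCombination_injective)

theorem IsNullBasis.mem_span (hb : IsNullBasis M b) (hM : ∀ i j, M i j = inner ℝ (r i) (e j))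
    {f : E} (hf : f ∈ Submodule.span ℝ (Set.range e)) (hr : ∀ i, inner ℝ (r i) f = 0) :
    f ∈ Submodule.span ℝ (Set.range fun k => ∑ j, b k j • e j) := by
  obtain ⟨c, rfl⟩ := (Submodule.mem_span_range_iff_exists_fun ℝ).1 hf
  have hc : c ∈ Submodule.span ℝ (Set.range b) := by
    rw [hb.2, LinearMap.mem_ker]
    ext i
    rw [Matrix.mulVecLin_apply, mulVec_inner hM, hr]
    rfl
  have : Submodule.span ℝ (Set.range b) ≤ (Submodule.span ℝ (Set.range fun k => ∑ j, b k j • e j)).comap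
      (Fintype.linearCombination ℝ e) := by
    refine Submodule.span_le.2 ?_
    rintro _ ⟨k, rfl⟩
    exact Submodule.subset_span ⟨k, rfl⟩
  exact this hc

/-- Orthonormalization of a null basis of two vectors. -/
theorem IsNullBasis.gramSchmidt {b : Fin 2 → Fin n → ℝ} (hb : IsNullBasis M b)
    (hM : ∀ i j, M i j = inner ℝ (r i) (e j)) (he : LinearIndependent ℝ e) {u : Fin 2 → E}
    (hu : ∀ k, u k = ∑ j, b k j • e j) {x y : E} (hx : x = normE (u 0))
    (hy : y = normE (resE (u 1) ![x])) :
    Orthonormal ℝ ![x, y] ∧ (∀ f ∈ Submodule.span ℝ {x, y}, f ∈ Submodule.span ℝ (Set.range e)) ∧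
      (∀ f ∈ Submodule.span ℝ {x, y}, ∀ i, inner ℝ (r i) f = 0) ∧
      ∀ f ∈ Submodule.span ℝ (Set.range e), (∀ i, inner ℝ (r i) f = 0) →
        f ∈ Submodule.span ℝ {x, y} := by
  obtain rfl : u = fun k => ∑ j, b k j • e j := funext hu
  have e2 : (fun k => ∑ j, b k j • e j) = ![∑ j, b 0 j • e j, ∑ j, b 1 j • e j] := by
    ext k; fin_cases k <;> rfl
  have hs : Set.range (fun k => ∑ j, b k j • e j) = {∑ j, b 0 j • e j, ∑ j, b 1 j • e j} := by
    rw [e2, Matrix.range_cons, Matrix.range_cons, Matrix.range_empty, Set.union_empty]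
    rfl
  have hl := hb.linearIndependent he
  rw [e2] at hl
  obtain ⟨h1, h2⟩ := gramSchmidt_two hl
  subst hx
  subst hy
  refine ⟨h1, fun f hf => ?_, fun f hf i => ?_, fun f hf hr => ?_⟩
  · rw [h2] at hf
    refine Submodule.span_le.2 ?_ hf
    have hk : ∀ k, ∑ j, b k j • e j ∈ Submodule.span ℝ (Set.range e) := fun k =>
      Submodule.sum_mem _ fun j _ => Submodule.smul_mem _ _ (Submodule.subset_span ⟨j, rfl⟩)
    rintro s (rfl | rfl)
    exacts [hk 0, hk 1]
  · rw [h2] at hf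
    rw [real_inner_comm]
    refine inner_eq_zero_of_mem_span ?_ hf
    rintro s (rfl | rfl)
    · rw [real_inner_comm]; exact hb.inner_eq_zero hM i 0
    · rw [real_inner_comm]; exact hb.inner_eq_zero hM i 1
  · rw [h2, ← hs]
    exact hb.mem_span hM hf hr

end NullBasis

end CubicWavelet

end

/-! ### The first four wavelet generators -/

noncomputable section

namespace CubicWavelet

open Spline

/-- Translation and number of the functions `p_j`. -/
def idxP : Fin 10 → ℤ × Fin 6 :=
  ![(0, 0), (0, 1), (0, 2), (0, 3), (1, 0), (1, 1), (1, 2), (1, 3), (1, 4), (1, 5)]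

/-- Translation and number of the functions `q_i`. -/
def idxQ : Fin 8 → ℤ × Fin 6 :=
  ![(0, 0), (0, 1), (0, 2), (0, 3), (0, 4), (0, 5), (1, 4), (1, 5)]

namespace Choice

variable (P : Choice)

/-- The six scaling generators as splines. -/
def eGen : Fin 6 → Spline := gens P.ePhi

/-- The functions `p_j` as splines. -/
def eP (j : Fin 10) : Spline := rootTwo⁻¹ • fine tr dil P.eGen (idxP j)

/-- The functions `q_i` as splines. -/
def eQ (i : Fin 8) : Spline := tr (idxQ i).1 (P.eGen (idxQ i).2)

/-- The functions `u_i` as splines. -/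
def eU (i : Fin 2) : Spline := ∑ j, P.bS i j • P.eP j

/-- The first wavelet generator as a spline. -/
def ePsi1 : Spline := normE (P.eU 0)

/-- The second wavelet generator as a spline. -/
def ePsi2 : Spline := normE (resE (P.eU 1) ![P.ePsi1])

/-- The functions `h_i` as splines. -/
def eH (i : Fin 6) : Spline := resE (rootTwo⁻¹ • dil 1 (P.eGen i)) ![P.eGen 4, P.eGen 5]

/-- The third wavelet generator as a spline. -/
def ePsi3 : Spline := normE (P.eH 4)

/-- The fourth wavelet generator as a spline. -/
def ePsi4 : Spline := normE (resE (P.eH 5) ![P.ePsi3])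

variable {P} (h : InnerGenerators P.ePhi)
include h

theorem fn_eGen (i : Fin 6) : fn (P.eGen i) = P.phi i := fn_gens h i

theorem fn_eP (j : Fin 10) : fn (P.eP j) = P.p j := by
  have e : ∀ s : ℤ × Fin 6, fn (rootTwo⁻¹ • fine tr dil P.eGen s) =
      fun x => P.phi s.2 (2 * x - (s.1 : ℝ)) := fun s => by
    ext x
    rw [map_smul, fine, Pi.smul_apply, fn_dil_one, fn_tr, fn_eGen h, smul_eq_mul,
      inv_mul_cancel_left₀ rootTwo_pos.ne']
  rw [eP, e]
  ext x
  fin_cases j <;> simp [idxP, p]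

theorem fn_eQ (i : Fin 8) : fn (P.eQ i) = P.q i := by
  ext x
  rw [eQ, fn_tr, fn_eGen h]
  fin_cases i <;> simp [idxQ, q]

theorem matS_apply (i : Fin 8) (j : Fin 10) : P.matS.transpose i j = inner ℝ (P.eQ i) (P.eP j) := by
  rw [real_inner_comm, inner_eq, fn_eP h, fn_eQ h]; rfl

theorem fn_ePsi1 : fn P.ePsi1 = P.psi1 := by
  rw [ePsi1, fn_normE, eU, map_sum]
  simp only [map_smul, fn_eP h]
  rfl

theorem fn_ePsi2 : fn P.ePsi2 = P.psi2 := by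
  rw [ePsi2, fn_normE, fn_resE_one, fn_ePsi1 h, eU, map_sum]
  simp only [map_smul, fn_eP h]
  rfl

theorem fn_eH (i : Fin 6) :
    fn (P.eH i) = residual (fun x => P.phi i (2 * x)) ![P.phi5, P.phi6] := by
  have e : fn (rootTwo⁻¹ • dil 1 (P.eGen i)) = fun x => P.phi i (2 * x) := by
    ext x
    rw [map_smul, Pi.smul_apply, fn_dil_one, fn_eGen h, smul_eq_mul,
      inv_mul_cancel_left₀ rootTwo_pos.ne']
  rw [eH, fn_resE_two, e, fn_eGen h, fn_eGen h]
  rfl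

theorem fn_ePsi3 : fn P.ePsi3 = P.psi3 := by
  rw [ePsi3, fn_normE, fn_eH h]; rfl

theorem fn_ePsi4 : fn P.ePsi4 = P.psi4 := by
  rw [ePsi4, fn_normE, fn_resE_one, fn_eH h, fn_ePsi3 h]; rfl

theorem scalingSystem : ScalingSystem tr dil P.eGen := h.scalingSystem

theorem linearIndependent_eP : LinearIndependent ℝ P.eP := by
  have h1 : LinearIndependent ℝ fun j => fine tr dil P.eGen (idxP j) :=
    (scalingSystem h).orthonormal_fine.linearIndependent.comp idxP (by decide)
  exact h1.units_smul fun _ => (Units.mk0 _ rootTwo_pos.ne')⁻¹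

omit h in
theorem span_eP : Submodule.span ℝ (Set.range P.eP) = band tr dil P.eGen 1 3 := by
  refine le_antisymm (Submodule.span_le.2 ?_) (Submodule.span_le.2 ?_)
  · rintro _ ⟨j, rfl⟩
    refine Submodule.smul_mem _ _ (fine_mem_band ?_ ?_) <;> revert j <;> decide
  · rintro _ ⟨⟨n, k⟩, hs, rfl⟩
    have : ∃ j, idxP j = (n, k) := by
      simp only [pos, Set.mem_ofPred_eq] at hs
      have hn : n = 0 ∨ n = 1 := by split_ifs at hs <;> omega
      rcases hn with rfl | rfl
      · revert hs; revert k; decide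
      · revert hs; revert k; decide
    obtain ⟨j, hj⟩ := this
    rw [← hj]
    have e : fine tr dil P.eGen (idxP j) = rootTwo • P.eP j := by
      rw [eP, smul_inv_smul₀ rootTwo_pos.ne']
    rw [e]
    exact Submodule.smul_mem _ _ (Submodule.subset_span ⟨j, rfl⟩)

theorem eQ_eq_zero {a : Fin 8 → ℝ}
    (ha : ∀ g ∈ band tr dil P.eGen 1 3, inner ℝ g (∑ i, a i • P.eQ i) = 0) : a = 0 := by
  have e : ∑ i, a i • P.eQ i = ∑ i : Fin 6, ![a 0, a 1, a 2, a 3, a 4, a 5] i • P.eGen i +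
      (a 6 • tr 1 (P.eGen 4) + a 7 • tr 1 (P.eGen 5)) := by
    rw [Fin.sum_univ_eight, Fin.sum_univ_six]
    simp only [eQ, idxQ]
    simp [dilationSystem.tr_zero]
    abel
  rw [e] at ha
  obtain ⟨h1, h2, h3⟩ := h.coeff_eq_zero ha
  have := congrFun h1
  ext i
  fin_cases i
  exacts [this 0, this 1, this 2, this 3, this 4, this 5, h2, h3]

/-- The dimension is `10 - 8`: by `eQ_eq_zero` no nontrivial combination of the `q_i` is orthogonal
to all `p_j`. -/
theorem exists_basisS : ∃ b : Fin 2 → Fin 10 → ℝ, IsNullBasis P.matS.transpose b := by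
  refine exists_isNullBasis_inner rfl (matS_apply h) fun a ha => eQ_eq_zero h fun g hg => ?_
  rw [← span_eP] at hg
  refine inner_eq_zero_of_mem_span ?_ hg
  rintro _ ⟨j, rfl⟩
  exact ha j

omit h in
theorem forall_eQ {f : Spline} (h1 : ∀ j, inner ℝ (P.eGen j) f = 0)
    (h2 : ∀ j : Fin 6, 4 ≤ (j : ℕ) → inner ℝ (tr 1 (P.eGen j)) f = 0) (i : Fin 8) :
    inner ℝ (P.eQ i) f = 0 := by
  have e : ((idxQ i).1 = 0 ∨ (idxQ i).1 = 1 ∧ 4 ≤ ((idxQ i).2 : ℕ)) := by revert i; decide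
  rcases e with e | e
  · rw [eQ, e, dilationSystem.tr_zero, h1]
  · rw [eQ, e.1, h2 _ e.2]

omit h in
theorem inner_eGen_of_eQ {f : Spline} (hf : ∀ i, inner ℝ (P.eQ i) f = 0) (j : Fin 6) :
    inner ℝ (P.eGen j) f = 0 := by
  have e : ∃ i, idxQ i = (0, j) := by revert j; decide
  obtain ⟨i, hi⟩ := e
  have := hf i
  rwa [eQ, hi, dilationSystem.tr_zero] at this

omit h in
theorem inner_tr_eGen_of_eQ {f : Spline} (hf : ∀ i, inner ℝ (P.eQ i) f = 0) (j : Fin 6)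
    (hj : 4 ≤ (j : ℕ)) : inner ℝ (tr 1 (P.eGen j)) f = 0 := by
  have e : ∃ i, idxQ i = (1, j) := by revert hj; revert j; decide
  obtain ⟨i, hi⟩ := e
  have := hf i
  rwa [eQ, hi] at this

/-- The dilates of the last two generators are linearly independent of the generators. -/
theorem linearIndependent_eH : LinearIndependent ℝ ![P.eH 4, P.eH 5] := by
  have hS := scalingSystem h
  rw [LinearIndependent.pair_iff]
  intro a b hab
  set c := rootTwo⁻¹ with hc
  have hc0 : c ≠ 0 := inv_ne_zero rootTwo_pos.ne'
  have e : ∀ i, P.eH i = c • dil 1 (P.eGen i) -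
      (inner ℝ (c • dil 1 (P.eGen i)) (P.eGen 4) • P.eGen 4
        + inner ℝ (c • dil 1 (P.eGen i)) (P.eGen 5) • P.eGen 5) := fun i => by
    rw [eH, resE, Fin.sum_univ_two]; rfl
  obtain ⟨x, hx⟩ : ∃ x, x = a * inner ℝ (c • dil 1 (P.eGen 4)) (P.eGen 4)
    + b * inner ℝ (c • dil 1 (P.eGen 5)) (P.eGen 4) := ⟨_, rfl⟩
  obtain ⟨y, hy⟩ : ∃ y, y = a * inner ℝ (c • dil 1 (P.eGen 4)) (P.eGen 5)
    + b * inner ℝ (c • dil 1 (P.eGen 5)) (P.eGen 5) := ⟨_, rfl⟩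
  have key : (a * c) • dil 1 (P.eGen 4) + (b * c) • dil 1 (P.eGen 5) =
      x • P.eGen 4 + y • P.eGen 5 := by
    rw [e, e] at hab
    rw [← sub_eq_zero, ← hab, hx, hy]
    module
  -- The left side of `key` sits at position `0`, hence is orthogonal to all fine functions on
  -- `[0,1]`; `coeff_eq_zero` then forces `x = y = 0`.
  have hz : ∀ g ∈ band tr dil P.eGen 1 3, inner ℝ g (x • P.eGen 4 + y • P.eGen 5) = 0 :=
    fun g hg => by
      rw [← key, inner_add_right, real_inner_smul_right, real_inner_smul_right,
        hS.inner_band hg (hS.dil_mem 4 (by decide)) (by omega),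
        hS.inner_band hg (hS.dil_mem 5 (by decide)) (by omega), mul_zero, mul_zero, add_zero]
  have h0 := h.coeff_eq_zero (c := ![0, 0, 0, 0, x, y]) (c4 := 0) (c5 := 0) (by
    intro g hg
    refine (congrArg (inner ℝ g) ?_).trans (hz g hg)
    rw [Fin.sum_univ_six]
    simp [eGen])
  have hx0 : x = 0 := congrFun h0.1 4
  have hy0 : y = 0 := congrFun h0.1 5
  rw [hx0, hy0, zero_smul, zero_smul, add_zero] at key
  have hd : ∀ i j : Fin 6, inner ℝ (dil 1 (P.eGen i)) (dil 1 (P.eGen j)) =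
      if i = j then (1 : ℝ) else 0 := fun i j => by
    have := hS.orth i j 0
    rw [dilationSystem.tr_zero] at this
    rw [LinearIsometry.inner_map_map, this]
    simp
  have k4 := congrArg (fun f => inner ℝ (dil 1 (P.eGen 4)) f) key
  have k5 := congrArg (fun f => inner ℝ (dil 1 (P.eGen 5)) f) key
  simp only [inner_add_right, real_inner_smul_right, hd, inner_zero_right] at k4 k5
  simp [hc0] at k4 k5
  exact ⟨k4, k5⟩

theorem orthonormal_eGen : Orthonormal ℝ P.eGen :=
  orthonormal_iff_ite.2 fun i j => by
    have := (scalingSystem h).orth i j 0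
    rw [dilationSystem.tr_zero] at this
    simpa using this

/-- The first four wavelet generators. -/
theorem lowWavelets (hb : IsNullBasis P.matS.transpose P.bS) {ψ : Fin 6 → Spline}
    (h0 : ψ 0 = P.ePsi1) (h1 : ψ 1 = P.ePsi2) (h2 : ψ 2 = P.ePsi3) (h3 : ψ 3 = P.ePsi4) :
    LowWavelets tr dil P.eGen ψ := by
  have hS := scalingSystem h
  obtain ⟨a1, a2, a3, a4⟩ := hb.gramSchmidt (matS_apply h) (linearIndependent_eP h) (u := P.eU)
    (fun _ => rfl) (x := ψ 0) (y := ψ 1) h0 (by rw [h1, h0]; rfl)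
  obtain ⟨b1, b2⟩ := gramSchmidt_two (linearIndependent_eH h)
  rw [show normE (P.eH 4) = ψ 2 from h2.symm,
    show normE (resE (P.eH 5) ![ψ 2]) = ψ 3 by rw [h3, h2]; rfl] at b1 b2
  rw [span_eP] at a2 a4
  have m0 : ψ 0 ∈ Submodule.span ℝ {ψ 0, ψ 1} := Submodule.subset_span (by simp)
  have m1 : ψ 1 ∈ Submodule.span ℝ {ψ 0, ψ 1} := Submodule.subset_span (by simp)
  have m01 : ∀ i : Fin 6, (i : ℕ) < 2 → ψ i ∈ Submodule.span ℝ {ψ 0, ψ 1} := fun i hi => by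
    rcases (by omega : i = 0 ∨ i = 1) with rfl | rfl
    exacts [m0, m1]
  have m23 : ∀ i : Fin 6, (i = 2 ∨ i = 3) → ψ i ∈ Submodule.span ℝ {P.eH 4, P.eH 5} := by
    intro i hi
    rw [← b2]
    rcases hi with rfl | rfl <;> exact Submodule.subset_span (by simp)
  have ho : Orthonormal ℝ ![P.eGen 4, P.eGen 5] := h.orthonormal_boundary
  refine { hS with
    low_pair := fun i j hi hj => ?_
    low_mem := fun i hi => a2 _ (m01 i hi)
    low_orth := fun i hi => inner_eGen_of_eQ (a3 _ (m01 i hi))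
    low_orth_tr := fun i hi => inner_tr_eGen_of_eQ (a3 _ (m01 i hi))
    low_max := fun f hf h1 h2 => a4 f hf (forall_eQ h1 h2)
    mid_pair := fun i j hi hj => ?_
    mid_mem := fun i hi => Submodule.span_le.2 ?_ (m23 i hi)
    mid_orth := fun i hi j hj => ?_ }
  · rw [orthonormal_iff_ite] at a1
    rcases (by omega : i = 0 ∨ i = 1) with rfl | rfl <;>
      rcases (by omega : j = 0 ∨ j = 1) with rfl | rfl
    exacts [a1 0 0, a1 0 1, a1 1 0, a1 1 1]
  · rw [orthonormal_iff_ite] at b1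
    rcases hi with rfl | rfl <;> rcases hj with rfl | rfl
    exacts [b1 0 0, b1 0 1, b1 1 0, b1 1 1]
  · have m : ∀ s ∈ ({dil 1 (P.eGen 4), dil 1 (P.eGen 5), P.eGen 4, P.eGen 5} : Set Spline),
        s ∈ Submodule.span ℝ {dil 1 (P.eGen 4), dil 1 (P.eGen 5), P.eGen 4, P.eGen 5} :=
      fun s hs => Submodule.subset_span hs
    have mH : ∀ i : Fin 6, (i = 4 ∨ i = 5) → P.eH i ∈
        Submodule.span ℝ {dil 1 (P.eGen 4), dil 1 (P.eGen 5), P.eGen 4, P.eGen 5} := by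
      intro i hi
      rw [eH, resE, Fin.sum_univ_two]
      refine sub_mem (Submodule.smul_mem _ _ ?_) (add_mem (Submodule.smul_mem _ _ (m _ (by simp)))
        (Submodule.smul_mem _ _ (m _ (by simp))))
      rcases hi with rfl | rfl <;> exact m _ (by simp)
    rintro s (rfl | rfl)
    exacts [mH 4 (by simp), mH 5 (by simp)]
  · rw [real_inner_comm]
    refine inner_eq_zero_of_mem_span ?_ (m23 i hi)
    rintro s (rfl | rfl) <;> rw [real_inner_comm] <;>
      rcases (by omega : j = 4 ∨ j = 5) with rfl | rfl
    exacts [inner_resE ho _ 0, inner_resE ho _ 1, inner_resE ho _ 0, inner_resE ho _ 1]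

end Choice

end CubicWavelet

end

/-! ### The last two wavelet generators -/

noncomputable section

namespace CubicWavelet

open Spline

namespace LowWavelets

variable {E : Type*} [NormedAddCommGroup E] [InnerProductSpace ℝ E]
  {τ δ : ℤ → E →ₗᵢ[ℝ] E} {φ ψ : Fin 6 → E} (h : LowWavelets τ δ φ ψ)
include h

theorem scal_wav (m n : ℤ) (i j : Fin 6) (hj : (j : ℕ) < 4) :
    inner ℝ (τ m (φ i)) (τ n (ψ j)) = 0 := by
  rw [real_inner_comm, h.inner_tr, real_inner_comm]
  rcases (by omega : (j : ℕ) < 2 ∨ j = 2 ∨ j = 3) with hj | hj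
  · exact h.scal_low _ i j hj
  · exact h.scal_mid _ i j hj

theorem wav_wav (m n : ℤ) (i j : Fin 6) (hi : (i : ℕ) < 4) (hj : (j : ℕ) < 4) :
    inner ℝ (τ m (ψ i)) (τ n (ψ j)) = if m = n ∧ i = j then 1 else 0 := by
  have e : (m = n ∧ i = j) ↔ (i = j ∧ n - m = 0) := by
    rw [sub_eq_zero, and_comm, eq_comm (a := m)]
  rw [h.inner_tr, if_congr e rfl rfl]
  rcases (by omega : (i : ℕ) < 2 ∨ i = 2 ∨ i = 3) with hi | hi <;>
    rcases (by omega : (j : ℕ) < 2 ∨ j = 2 ∨ j = 3) with hj | hj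
  · exact h.low_low _ i j hi hj
  · rw [if_neg (by omega), ← neg_neg (n - m), ← h.inner_tr_left, real_inner_comm]
    exact h.mid_low _ j i hj hi
  · rw [if_neg (by omega)]
    exact h.mid_low _ i j hi hj
  · exact h.mid_mid _ i j hi hj

theorem wav_mem_band (i : Fin 6) (hi : (i : ℕ) < 4) : ψ i ∈ band τ δ φ (-3) 3 := by
  rcases (by omega : (i : ℕ) < 2 ∨ i = 2 ∨ i = 3) with hi | hi
  · exact band_mono (by omega) le_rfl (h.low_mem i hi)
  · exact h.mid_mem_band i hi

end LowWavelets

/-- The translation and number of the wavelets that precede the last two generators. -/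
def idxRow : Fin 6 → ℤ × Fin 6 := ![(-1, 0), (-1, 1), (0, 0), (0, 1), (0, 2), (0, 3)]

namespace Spline

/-- The functions to which the last two wavelet generators are orthogonal. -/
def rowE (φ ψ : Fin 6 → Spline) (i : Fin 20) : Spline :=
  if (i : ℕ) < 14 then tr (shiftOf 4 ((i : ℤ) - 7)) (φ (genOf ((i : ℤ) - 7)))
  else tr (idxRow ⟨(i : ℕ) - 14, by omega⟩).1 (ψ (idxRow ⟨(i : ℕ) - 14, by omega⟩).2)

/-- The fine scaling functions with support in `[-1, 1]`. -/
def colE (φ : Fin 6 → Spline) (j : Fin 22) : Spline :=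
  fine tr dil φ (shiftOf 4 ((j : ℤ) - 11), genOf ((j : ℤ) - 11))

variable {φ ψ : Fin 6 → Spline}

theorem idxRow_lt (i : Fin 6) : ((idxRow i).2 : ℕ) < 4 := by revert i; decide

theorem rowE_scal {n : ℤ} {j : Fin 6} (hn : n = 0 ∨ n = -1 ∨ n = 1 ∧ 4 ≤ (j : ℕ)) :
    ∃ i, rowE φ ψ i = tr n (φ j) := by
  obtain ⟨m, hm, rfl⟩ := exists_index 4 n j
  have hb : -7 ≤ m ∧ m ≤ 6 := by
    simp only [shiftOf, genOf] at hm hn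
    split_ifs at hm <;> omega
  refine ⟨⟨(m + 7).toNat, by omega⟩, ?_⟩
  have e : (((m + 7).toNat : ℕ) : ℤ) - 7 = m := by omega
  rw [rowE, if_pos (by simp; omega)]
  simp only [e, hm]

theorem rowE_wav (k : Fin 6) :
    ∃ i, rowE φ ψ i = tr (idxRow k).1 (ψ (idxRow k).2) := by
  refine ⟨⟨k + 14, by omega⟩, ?_⟩
  rw [rowE, if_neg (by simp)]
  simp

theorem orthRows_iff (f : Spline) :
    OrthRows tr φ ψ f ↔ ∀ i, inner ℝ (rowE φ ψ i) f = 0 := by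
  constructor
  · intro hf i
    rw [rowE]
    split_ifs with hi
    · obtain ⟨j, hj⟩ : ∃ j, j = genOf ((i : ℤ) - 7) := ⟨_, rfl⟩
      have hc : shiftOf 4 ((i : ℤ) - 7) = 0 ∨ shiftOf 4 ((i : ℤ) - 7) = -1 ∨
          shiftOf 4 ((i : ℤ) - 7) = 1 ∧ 4 ≤ (j : ℕ) := by
        rw [hj]
        simp only [shiftOf, genOf]
        split_ifs <;> omega
      rw [← hj]
      rcases hc with e | e | ⟨e, e'⟩ <;> rw [e]
      · rw [dilationSystem.tr_zero]; exact hf.scal j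
      · exact hf.scal_left j
      · exact hf.scal_right j e'
    · obtain ⟨k, hk⟩ : ∃ k : Fin 6, k = ⟨(i : ℕ) - 14, by omega⟩ := ⟨_, rfl⟩
      rw [← hk]
      have hc : (idxRow k).1 = 0 ∨ (idxRow k).1 = -1 ∧ ((idxRow k).2 : ℕ) < 2 := by
        clear hk; revert k; decide
      rcases hc with e | ⟨e, e'⟩ <;> rw [e]
      · rw [dilationSystem.tr_zero]; exact hf.wav _ (idxRow_lt k)
      · exact hf.wav_left _ e'
  · intro hf
    have hs : ∀ n (j : Fin 6), (n = 0 ∨ n = -1 ∨ n = 1 ∧ 4 ≤ (j : ℕ)) →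
        inner ℝ (tr n (φ j)) f = 0 := fun n j hn => by
      obtain ⟨i, hi⟩ := rowE_scal (φ := φ) (ψ := ψ) hn
      rw [← hi]; exact hf i
    have hw : ∀ k, inner ℝ (tr (idxRow k).1 (ψ (idxRow k).2)) f = 0 := fun k => by
      obtain ⟨i, hi⟩ := rowE_wav (φ := φ) (ψ := ψ) k
      rw [← hi]; exact hf i
    refine ⟨fun j => ?_, fun j => hs _ j (by simp), fun j hj => hs _ j (by simp [hj]),
      fun i hi => ?_, fun i hi => ?_⟩
    · have := hs 0 j (by simp)
      rwa [dilationSystem.tr_zero] at this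
    · have : ∃ k, idxRow k = (0, i) := by revert hi; revert i; decide
      obtain ⟨k, hk⟩ := this
      have := hw k
      rwa [hk, dilationSystem.tr_zero] at this
    · have : ∃ k, idxRow k = (-1, i) := by revert hi; revert i; decide
      obtain ⟨k, hk⟩ := this
      have := hw k
      rwa [hk] at this

/-- Used in `exists_basisT` to read off coefficients by pairing a combination with one of its rows.
-/
theorem orthonormal_rowE (h : LowWavelets tr dil φ ψ) : Orthonormal ℝ (rowE φ ψ) := by
  have hi : Function.Injective idxRow := by decide
  rw [orthonormal_iff_ite]
  intro i j
  rw [rowE, rowE]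
  split_ifs with h1 h2 h3 h3 h2 h3 h3
  · subst h3
    rw [h.inner_tr_tr, if_pos ⟨rfl, rfl⟩]
  · rw [h.inner_tr_tr, if_neg]
    rintro ⟨e1, e2⟩
    have := shiftOf_genOf_inj.1 ⟨e2, e1⟩
    exact h3 (Fin.ext (by omega))
  · subst h3; exact absurd h1 h2
  · exact h.scal_wav _ _ _ _ (idxRow_lt _)
  · subst h3; exact absurd h2 h1
  · rw [real_inner_comm]
    exact h.scal_wav _ _ _ _ (idxRow_lt _)
  · subst h3
    rw [h.wav_wav _ _ _ _ (idxRow_lt _) (idxRow_lt _), if_pos ⟨rfl, rfl⟩]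
  · rw [h.wav_wav _ _ _ _ (idxRow_lt _) (idxRow_lt _), if_neg]
    rintro ⟨e1, e2⟩
    have := hi (Prod.ext e1 e2)
    simp only [Fin.mk.injEq] at this
    exact h3 (Fin.ext (by omega))

theorem orthonormal_colE (h : ScalingSystem tr dil φ) : Orthonormal ℝ (colE φ) := by
  refine h.orthonormal_fine.comp (fun j : Fin 22 =>
    (shiftOf 4 ((j : ℤ) - 11), genOf ((j : ℤ) - 11))) fun i j hij => ?_
  rw [Prod.mk.injEq] at hij
  have := shiftOf_genOf_inj.1 hij
  exact Fin.ext (by omega)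

theorem span_colE : Submodule.span ℝ (Set.range (colE φ)) = band tr dil φ (-3) 3 := by
  refine le_antisymm (Submodule.span_le.2 ?_) (Submodule.span_le.2 ?_)
  · rintro _ ⟨j, rfl⟩
    apply fine_mem_band <;> (simp only [pos, shiftOf, genOf]; split_ifs <;> omega)
  · rintro _ ⟨⟨n, k⟩, hs, rfl⟩
    obtain ⟨m, hm, rfl⟩ := exists_index 4 n k
    have hb : -11 ≤ m ∧ m ≤ 10 := by
      simp only [pos, shiftOf, genOf, Set.mem_ofPred_eq] at hm hs
      split_ifs at hm hs <;> omega
    refine Submodule.subset_span ⟨⟨(m + 11).toNat, by omega⟩, ?_⟩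
    have e : (((m + 11).toNat : ℕ) : ℤ) - 11 = m := by omega
    rw [colE]
    simp only [e, hm]

end Spline

namespace Choice

variable (P : Choice)

/-- The functions `z_i` as splines. -/
def eZ (i : Fin 2) : Spline := ∑ j, P.bT i j • colE P.eGen j

/-- The fifth wavelet generator as a spline. -/
def ePsi5 : Spline := normE (P.eZ 0)

/-- The sixth wavelet generator as a spline. -/
def ePsi6 : Spline := normE (resE (P.eZ 1) ![P.ePsi5])

/-- The six wavelet generators as splines. -/
def ePsi : Fin 6 → Spline := ![P.ePsi1, P.ePsi2, P.ePsi3, P.ePsi4, P.ePsi5, P.ePsi6]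

variable {P} (h : InnerGenerators P.ePhi)
include h

theorem fn_colE (j : Fin 22) : fn (colE P.eGen j) = P.scaling 1 ((j : ℤ) - 11) :=
  fn_dil_tr (fn_eGen h) 4 1 _

theorem fn_rowE {ψ : Fin 6 → Spline} (h0 : ψ 0 = P.ePsi1) (h1 : ψ 1 = P.ePsi2)
    (h2 : ψ 2 = P.ePsi3) (h3 : ψ 3 = P.ePsi4) (i : Fin 20) :
    fn (rowE P.eGen ψ i) = P.rowT i := by
  rw [rowE, rowT]
  split_ifs with hi
  · rw [← dilationSystem.dil_zero (tr _ _)]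
    exact fn_dil_tr (fn_eGen h) 4 0 _
  · obtain ⟨k, hk⟩ : ∃ k : Fin 6, k = ⟨(i : ℕ) - 14, by omega⟩ := ⟨_, rfl⟩
    rw [← hk]
    ext x
    rw [fn_tr]
    clear hk
    fin_cases k <;>
      simp [idxRow, h0, h1, h2, h3, fn_ePsi1 h, fn_ePsi2 h, fn_ePsi3 h, fn_ePsi4 h]

theorem matT_apply {ψ : Fin 6 → Spline} (h0 : ψ 0 = P.ePsi1) (h1 : ψ 1 = P.ePsi2)
    (h2 : ψ 2 = P.ePsi3) (h3 : ψ 3 = P.ePsi4) (i : Fin 20) (j : Fin 22) :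
    P.matT i j = inner ℝ (rowE P.eGen ψ i) (colE P.eGen j) := by
  rw [inner_eq, fn_rowE h h0 h1 h2 h3, fn_colE h]; rfl

theorem fn_eZ (i : Fin 2) : fn (P.eZ i) = P.z i := by
  rw [eZ, map_sum]
  simp only [map_smul, fn_colE h]
  rfl

theorem fn_ePsi5 : fn P.ePsi5 = P.psi5 := by
  rw [ePsi5, fn_normE, fn_eZ h]; rfl

theorem fn_ePsi6 : fn P.ePsi6 = P.psi6 := by
  rw [ePsi6, fn_normE, fn_resE_one, fn_eZ h, fn_ePsi5 h]; rfl

theorem fn_ePsi (i : Fin 6) : fn (P.ePsi i) = P.psi i := by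
  fin_cases i
  exacts [fn_ePsi1 h, fn_ePsi2 h, fn_ePsi3 h, fn_ePsi4 h, fn_ePsi5 h, fn_ePsi6 h]

/-- The complete wavelet system. -/
theorem waveletSystem (hS : IsNullBasis P.matS.transpose P.bS) (hT : IsNullBasis P.matT P.bT) :
    WaveletSystem tr dil P.eGen P.ePsi := by
  have hL := lowWavelets h hS (ψ := P.ePsi) rfl rfl rfl rfl
  obtain ⟨a1, a2, a3, a4⟩ := hT.gramSchmidt (matT_apply h (ψ := P.ePsi) rfl rfl rfl rfl)
    (orthonormal_colE hL.toScalingSystem).linearIndependent (u := P.eZ) (fun _ => rfl)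
    (x := P.ePsi 4) (y := P.ePsi 5) rfl rfl
  rw [span_colE] at a2 a4
  have m45 : ∀ i : Fin 6, 4 ≤ (i : ℕ) → P.ePsi i ∈ Submodule.span ℝ {P.ePsi 4, P.ePsi 5} := by
    intro i hi
    rcases (by omega : i = 4 ∨ i = 5) with rfl | rfl <;> exact Submodule.subset_span (by simp)
  refine { hL with
    high_pair := fun i j hi hj => ?_
    high_mem := fun i hi => a2 _ (m45 i hi)
    high_orth := fun i hi => (orthRows_iff _).2 (a3 _ (m45 i hi))
    high_max := fun f hf hr => a4 f hf ((orthRows_iff _).1 hr) }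
  rw [orthonormal_iff_ite] at a1
  rcases (by omega : i = 4 ∨ i = 5) with rfl | rfl <;>
    rcases (by omega : j = 4 ∨ j = 5) with rfl | rfl
  exacts [a1 0 0, a1 0 1, a1 1 0, a1 1 1]

/-- Combinations of the boundary generators at `-1` and `1` that are orthogonal to the fine
functions with support in `[-1, 1]`. -/
theorem outer_coeff_eq_zero {c4 c5 d4 d5 : ℝ}
    (ho : ∀ g ∈ band tr dil P.eGen (-3) 3, inner ℝ g
      (c4 • tr (-1) (P.eGen 4) + c5 • tr (-1) (P.eGen 5) +
        (d4 • tr 1 (P.eGen 4) + d5 • tr 1 (P.eGen 5))) = 0) :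
    c4 = 0 ∧ c5 = 0 ∧ d4 = 0 ∧ d5 = 0 := by
  have hS := scalingSystem h
  -- Test functions on `[0,1]` see only the pair at `1`. The pair at `-1` is then tested on
  -- `[-1,0]`, which a unit translation carries to `[0,1]` and the pair to the generators at `0`.
  have hd : d4 = 0 ∧ d5 = 0 := by
    refine (h.coeff_eq_zero (c := 0) fun g hg => ?_).2
    have hz : ∀ i, inner ℝ g (tr (-1) (P.eGen i)) = 0 := fun i =>
      hS.inner_band hg (hS.tr_mem i (-1)) (by omega)
    have := ho g (band_mono (by omega) le_rfl hg)
    rw [inner_add_right, inner_add_right, real_inner_smul_right, real_inner_smul_right, hz, hz] at this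
    simpa [eGen] using this
  obtain ⟨rfl, rfl⟩ := hd
  have hc := (h.coeff_eq_zero (c := ![0, 0, 0, 0, c4, c5]) (c4 := 0) (c5 := 0) fun g hg => by
    have := ho (tr (-1) g) (band_mono (by omega) (by omega) (hS.tr_mem_band (-1) hg))
    rw [zero_smul, zero_smul, add_zero, add_zero, ← map_smul, ← map_smul, ← map_add,
      LinearIsometry.inner_map_map] at this
    refine (congrArg (inner ℝ g) ?_).trans this
    rw [Fin.sum_univ_six]
    simp [eGen]).1
  exact ⟨congrFun hc 4, congrFun hc 5, rfl, rfl⟩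

/-- The dimension is `22 - 20`. In a combination of rows orthogonal to the whole band, the sixteen
rows inside the band drop out by orthonormality, and the four boundary generators at `-1` and `1` by
`outer_coeff_eq_zero`. -/
theorem exists_basisT (hS : IsNullBasis P.matS.transpose P.bS) :
    ∃ b : Fin 2 → Fin 22 → ℝ, IsNullBasis P.matT b := by
  have hL := lowWavelets h hS (ψ := P.ePsi) rfl rfl rfl rfl
  refine exists_isNullBasis_inner rfl (matT_apply h (ψ := P.ePsi) rfl rfl rfl rfl) fun a ha => ?_
  have hb : ∀ g ∈ band tr dil P.eGen (-3) 3, inner ℝ g (∑ i, a i • rowE P.eGen P.ePsi i) = 0 := by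
    intro g hg
    rw [← span_colE] at hg
    refine inner_eq_zero_of_mem_span ?_ hg
    rintro _ ⟨j, rfl⟩
    exact ha j
  have hz : ∀ i, rowE P.eGen P.ePsi i ∈ band tr dil P.eGen (-3) 3 → a i = 0 := fun i hi => by
    rw [← hb _ hi, (orthonormal_rowE hL).inner_right_fintype]
  have h1 : ∀ i : Fin 20, 14 ≤ (i : ℕ) → a i = 0 := fun i hi => hz i (by
    rw [rowE, if_neg (by omega)]
    obtain ⟨k, hk⟩ : ∃ k : Fin 6, k = ⟨(i : ℕ) - 14, by omega⟩ := ⟨_, rfl⟩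
    rw [← hk]
    have hc : (idxRow k).1 = 0 ∨ (idxRow k).1 = -1 ∧ ((idxRow k).2 : ℕ) < 2 := by
      clear hk; revert k; decide
    rcases hc with e | ⟨e, e'⟩ <;> rw [e]
    · rw [dilationSystem.tr_zero]; exact hL.wav_mem_band _ (idxRow_lt k)
    · exact band_mono (by omega) (by omega) (hL.tr_mem_band (-1) (hL.low_mem _ e')))
  have h2 : ∀ i : Fin 20, 2 ≤ (i : ℕ) → (i : ℕ) < 12 → a i = 0 := fun i hi hi' => hz i (by
    rw [rowE, if_pos (by omega)]
    have hc : shiftOf 4 ((i : ℤ) - 7) = 0 ∨ shiftOf 4 ((i : ℤ) - 7) = -1 ∧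
        (genOf ((i : ℤ) - 7) : ℕ) < 4 := by
      simp only [shiftOf, genOf]
      split_ifs <;> omega
    rcases hc with e | ⟨e, e'⟩ <;> rw [e]
    · rw [dilationSystem.tr_zero]; exact hL.mem_band _
    · exact band_mono (by omega) (by omega) (hL.tr_mem_inner _ e' (-1)))
  -- Rows `0, 1, 12, 13` are `φ_{0,k}` with `k = -7, -6, 5, 6`: the boundary generators at `-1` and
  -- `1`, the only rows leaving `[-1,1]`.
  have e0 : ∑ i, a i • rowE P.eGen P.ePsi i =
      a 0 • tr (-1) (P.eGen 4) + a 1 • tr (-1) (P.eGen 5) +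
        (a 12 • tr 1 (P.eGen 4) + a 13 • tr 1 (P.eGen 5)) := by
    have : ∀ i ∉ ({0, 1, 12, 13} : Finset (Fin 20)), a i • rowE P.eGen P.ePsi i = 0 := by
      intro i hi
      rw [show a i = 0 from ?_, zero_smul]
      simp only [Finset.mem_insert, Finset.mem_singleton, not_or, Fin.ext_iff] at hi
      have : (i : ℕ) ≠ 0 ∧ (i : ℕ) ≠ 1 ∧ (i : ℕ) ≠ 12 ∧ (i : ℕ) ≠ 13 := hi
      rcases le_or_gt 14 (i : ℕ) with h14 | h14
      · exact h1 i h14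
      · exact h2 i (by omega) (by omega)
    have hr : ∀ (i : Fin 20) {n : ℤ} {l : Fin 6}, (i : ℕ) < 14 → shiftOf 4 ((i : ℤ) - 7) = n →
        genOf ((i : ℤ) - 7) = l → rowE P.eGen P.ePsi i = tr n (P.eGen l) := by
      rintro i _ _ hi rfl rfl
      rw [rowE, if_pos hi]
    have r0 : rowE P.eGen P.ePsi 0 = tr (-1) (P.eGen 4) :=
      hr 0 (by decide) (by decide) (by decide)
    have r1 : rowE P.eGen P.ePsi 1 = tr (-1) (P.eGen 5) :=
      hr 1 (by decide) (by decide) (by decide)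
    have r12 : rowE P.eGen P.ePsi 12 = tr 1 (P.eGen 4) :=
      hr 12 (by decide) (by decide) (by decide)
    have r13 : rowE P.eGen P.ePsi 13 = tr 1 (P.eGen 5) :=
      hr 13 (by decide) (by decide) (by decide)
    rw [← Finset.sum_subset (Finset.subset_univ {0, 1, 12, 13}) fun i _ hi => this i hi,
      Finset.sum_insert (by decide), Finset.sum_insert (by decide), Finset.sum_insert (by decide),
      Finset.sum_singleton, r0, r1, r12, r13, ← add_assoc]
  rw [e0] at hb
  obtain ⟨z0, z1, z12, z13⟩ := outer_coeff_eq_zero h hb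
  ext i
  rcases le_or_gt 14 (i : ℕ) with h14 | h14
  · exact h1 i h14
  by_cases hi : 2 ≤ (i : ℕ) ∧ (i : ℕ) < 12
  · exact h2 i hi.1 hi.2
  · rcases (by omega : i = 0 ∨ i = 1 ∨ i = 12 ∨ i = 13) with rfl | rfl | rfl | rfl
    exacts [z0, z1, z12, z13]

end Choice

end CubicWavelet

end

/-! ### Solving the orthogonality condition for the third and fourth generator -/

noncomputable section

namespace CubicWavelet

open Spline

namespace Spline

/-- Combinations of the six fine splines with support in the unit interval. -/
def comb (α : Fin 6 → ℝ) : Spline := ∑ j : Fin 6, α j • X 2 ((j : ℤ) + 2)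

theorem comb_eq (α : Fin 6 → ℝ) : comb α = α 0 • X 2 2 + α 1 • X 2 3 + α 2 • X 2 4 + α 3 • X 2 5
    + α 4 • X 2 6 + α 5 • X 2 7 := by
  rw [comb, Fin.sum_univ_six]
  rfl

theorem inner_comb (α β : Fin 6 → ℝ) : inner ℝ (comb α) (comb β) =
    26 / 35 * (α 0 * β 0 + α 2 * β 2 + α 4 * β 4) + 2 / 105 * (α 1 * β 1 + α 3 * β 3 + α 5 * β 5)
    + 9 / 70 * (α 0 * β 2 + α 2 * β 0 + α 2 * β 4 + α 4 * β 2)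
    - 13 / 420 * (α 0 * β 3 + α 3 * β 0 + α 2 * β 5 + α 5 * β 2)
    + 13 / 420 * (α 1 * β 2 + α 2 * β 1 + α 3 * β 4 + α 4 * β 3)
    - 1 / 140 * (α 1 * β 3 + α 3 * β 1 + α 3 * β 5 + α 5 * β 3) := by
  rw [comb_eq, comb_eq]
  simp only [inner_add_left, inner_add_right, real_inner_smul_left, real_inner_smul_right, inner_X]
  norm_num [gram]
  ring

/-- The factor in the two-scale relation cancels, so the inner products below have rational
coefficients. -/
theorem rootTwo_mul_inner_comb {f g : Spline} (hf : f = rootTwo⁻¹ • g) (α : Fin 6 → ℝ) :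
    inner ℝ f (rootTwo • comb α) = inner ℝ g (comb α) := by
  rw [hf, real_inner_smul_left, real_inner_smul_right, inv_mul_cancel_left₀ rootTwo_pos.ne']

theorem inner_X_zero_comb (α : Fin 6 → ℝ) : inner ℝ (X 1 0) (rootTwo • comb α) =
    1 / 2 * α 0 - 19 / 420 * α 1 + 23 / 560 * α 2 - 17 / 1680 * α 3 := by
  rw [rootTwo_mul_inner_comb (X_even 1 0 rfl), comb_eq]
  simp only [inner_add_left, inner_sub_left, inner_add_right, real_inner_smul_left,
    real_inner_smul_right, inner_X, Int.reduceAdd, inner_X]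
  norm_num [gram]
  ring

theorem inner_X_one_comb (α : Fin 6 → ℝ) : inner ℝ (X 1 1) (rootTwo • comb α) =
    13 / 120 * α 0 - 1 / 168 * α 1 + 41 / 3360 * α 2 - 1 / 336 * α 3 := by
  rw [rootTwo_mul_inner_comb (X_odd 1 1 rfl), comb_eq]
  simp only [inner_add_left, inner_sub_left, inner_add_right, real_inner_smul_left,
    real_inner_smul_right, inner_X, Int.reduceAdd, inner_X]
  norm_num [gram]
  ring

theorem inner_X_two_comb (α : Fin 6 → ℝ) : inner ℝ (X 1 2) (rootTwo • comb α) =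
    1 / 2 * α 0 + 19 / 420 * α 1 + 257 / 280 * α 2 + 1 / 2 * α 4 - 19 / 420 * α 5 := by
  rw [rootTwo_mul_inner_comb (X_even 1 2 rfl), comb_eq]
  simp only [inner_add_left, inner_sub_left, inner_add_right, real_inner_smul_left,
    real_inner_smul_right, inner_X, Int.reduceAdd, inner_X]
  norm_num [gram]
  ring

theorem inner_X_three_comb (α : Fin 6 → ℝ) : inner ℝ (X 1 3) (rootTwo • comb α) =
    -13 / 120 * α 0 - 1 / 168 * α 1 + 2 / 105 * α 3 + 13 / 120 * α 4 - 1 / 168 * α 5 := by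
  rw [rootTwo_mul_inner_comb (X_odd 1 3 rfl), comb_eq]
  simp only [inner_add_left, inner_sub_left, inner_add_right, real_inner_smul_left,
    real_inner_smul_right, inner_X, Int.reduceAdd, inner_X]
  norm_num [gram]
  ring

theorem inner_X_four_comb (α : Fin 6 → ℝ) : inner ℝ (X 1 4) (rootTwo • comb α) =
    23 / 560 * α 2 + 17 / 1680 * α 3 + 1 / 2 * α 4 + 19 / 420 * α 5 := by
  rw [rootTwo_mul_inner_comb (X_even 1 4 rfl), comb_eq]
  simp only [inner_add_left, inner_sub_left, inner_add_right, real_inner_smul_left,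
    real_inner_smul_right, inner_X, Int.reduceAdd, inner_X]
  norm_num [gram]
  ring

theorem inner_X_five_comb (α : Fin 6 → ℝ) : inner ℝ (X 1 5) (rootTwo • comb α) =
    -41 / 3360 * α 2 - 1 / 336 * α 3 - 13 / 120 * α 4 - 1 / 168 * α 5 := by
  rw [rootTwo_mul_inner_comb (X_odd 1 5 rfl), comb_eq]
  simp only [inner_add_left, inner_sub_left, inner_add_right, real_inner_smul_left,
    real_inner_smul_right, inner_X, Int.reduceAdd, inner_X]
  norm_num [gram]
  ring

/-- Coefficients of the basis dual, up to the factor `2`, to the symmetric and antisymmetric parts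
of the functions that meet the unit interval at its end points. -/
def dualVec : Fin 4 → Fin 6 → ℝ :=
  ![![-331 / 33, -2931 / 22, 794 / 33, 0, -331 / 33, 2931 / 22],
    ![760 / 11, 7020 / 11, -1520 / 11, 0, 760 / 11, -7020 / 11],
    ![-75 / 4, -715 / 4, 0, -325, 75 / 4, -715 / 4],
    ![495 / 4, 3695 / 4, 0, 1985, -495 / 4, 3695 / 4]]

/-- The combination of the dual basis with coefficients `x` on the symmetric part and `y` on the
antisymmetric part. -/
def dualComb (x₀ x₁ y₀ y₁ : ℝ) : Spline := rootTwo • comb (x₀ • dualVec 0 + x₁ • dualVec 1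
  + y₀ • dualVec 2 + y₁ • dualVec 3)

section

variable (x₀ x₁ y₀ y₁ : ℝ)

theorem inner_X_zero_dualComb : inner ℝ (X 1 0) (dualComb x₀ x₁ y₀ y₁) = 2 * (x₀ + y₀) := by
  rw [dualComb, inner_X_zero_comb]
  simp [dualVec]
  ring

theorem inner_X_one_dualComb : inner ℝ (X 1 1) (dualComb x₀ x₁ y₀ y₁) = 2 * (x₁ + y₁) := by
  rw [dualComb, inner_X_one_comb]
  simp [dualVec]
  ring

theorem inner_X_two_dualComb : inner ℝ (X 1 2) (dualComb x₀ x₁ y₀ y₁) = 0 := by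
  rw [dualComb, inner_X_two_comb]
  simp [dualVec]
  ring

theorem inner_X_three_dualComb : inner ℝ (X 1 3) (dualComb x₀ x₁ y₀ y₁) = 0 := by
  rw [dualComb, inner_X_three_comb]
  simp [dualVec]
  ring

theorem inner_X_four_dualComb : inner ℝ (X 1 4) (dualComb x₀ x₁ y₀ y₁) = 2 * (x₀ - y₀) := by
  rw [dualComb, inner_X_four_comb]
  simp [dualVec]
  ring

theorem inner_X_five_dualComb : inner ℝ (X 1 5) (dualComb x₀ x₁ y₀ y₁) = 2 * (y₁ - x₁) := by
  rw [dualComb, inner_X_five_comb]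
  simp [dualVec]
  ring

/-- The Gram form of the dual basis. -/
def dualForm (x₀ x₁ y₀ y₁ x₀' x₁' y₀' y₁' : ℝ) : ℝ :=
  444496 / 605 * (x₀ * x₀') - 467584 / 121 * (x₀ * x₁' + x₁ * x₀') + 17756160 / 847 * (x₁ * x₁')
    + 9360 / 7 * (y₀ * y₀') - 55120 / 7 * (y₀ * y₁' + y₁ * y₀') + 332560 / 7 * (y₁ * y₁')

theorem inner_dualComb (x₀' x₁' y₀' y₁' : ℝ) :
    inner ℝ (dualComb x₀ x₁ y₀ y₁) (dualComb x₀' x₁' y₀' y₁') =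
      2 * dualForm x₀ x₁ y₀ y₁ x₀' x₁' y₀' y₁' := by
  rw [dualComb, dualComb, real_inner_smul_left, real_inner_smul_right, ← mul_assoc, ← pow_two,
    rootTwo_sq, inner_comb, dualForm]
  simp [dualVec]
  ring

end

/-- The matrix equation that expresses the orthogonality condition has a real solution. -/
theorem exists_riccati : ∃ h₀₀ h₀₁ h₁₁ : ℝ,
    dualForm (h₀₀ + 35 / 4992) (h₀₁ + 1 / 640) (h₀₀ - 35 / 4992) (h₀₁ - 1 / 640)
      (h₀₀ + 35 / 4992) (h₀₁ + 1 / 640) (h₀₀ - 35 / 4992) (h₀₁ - 1 / 640) = 2 * h₀₀ ∧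
    dualForm (h₀₀ + 35 / 4992) (h₀₁ + 1 / 640) (h₀₀ - 35 / 4992) (h₀₁ - 1 / 640)
      (h₀₁ + 1 / 640) (h₁₁ + 1 / 2880) (h₀₁ - 1 / 640) (h₁₁ - 1 / 2880) = 2 * h₀₁ ∧
    dualForm (h₀₁ + 1 / 640) (h₁₁ + 1 / 2880) (h₀₁ - 1 / 640) (h₁₁ - 1 / 2880)
      (h₀₁ + 1 / 640) (h₁₁ + 1 / 2880) (h₀₁ - 1 / 640) (h₁₁ - 1 / 2880) = 2 * h₁₁ := by
  -- With `H` the symmetric matrix of unknowns, `K` that of the offsets, and `A`, `B` the two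
  -- diagonal blocks of `dualForm`, the system is `(H + K) A (H + K) + (H - K) B (H - K) = 2 H`. It
  -- has a solution with entries in the field generated by `t` and `σ`; `t ≥ 0` ensures that `σ` is
  -- real.
  obtain ⟨t, ht0, ht⟩ : ∃ t : ℝ, 0 ≤ t ∧ t ^ 2 = 67160353 / 69155856 :=
    ⟨Real.sqrt (67160353 / 69155856), Real.sqrt_nonneg _, Real.sq_sqrt (by norm_num)⟩
  obtain ⟨σ, hσ⟩ : ∃ σ : ℝ, σ ^ 2 = 5259113 / 2668050 + 2 * t :=
    ⟨Real.sqrt (5259113 / 2668050 + 2 * t), Real.sq_sqrt (by positivity)⟩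
  refine ⟨((120839504187260162768545 / 5548600946331068226237312) + (-89902430405909069730705 /
    284543638273388114166016) * σ + (-6849334050753580155 / 8891988696043378567688) * t +
    (288488928592880874502875 / 924766824388511371039552) * t * σ),
    ((17672952798362039670509 / 4268154574100821712490240) + (-15132961146008757715125 /
    284543638273388114166016) * σ + (-24277399675412559291 / 71135909568347028541504) * t +
    (3733521844003296577155 / 71135909568347028541504) * t * σ),
    ((5142509681454190907813 / 6402231861151232568735360) + (-1236272603323698699605 /
    142271819136694057083008) * σ + (-3333033293511256335 / 35567954784173514270752) * t +
    (304324114736736475227 / 35567954784173514270752) * t * σ), ?_, ?_, ?_⟩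
  · rw [dualForm]
    -- The coefficients are quotients: after substitution, each equation is a combination of the two
    -- defining relations for `t` and `σ`.
    linear_combination ((-89959588238314749990264075 / 7398134595108090968316416) +
    (21642582295216171046575125 / 1849533648777022742079104) * t) * ht +
    ((27306847761539266998058905 / 4552698212374209826656256) + (-6742436677659361768787775 /
    569087276546776228332032) * t + (21642582295216171046575125 / 3699067297554045484158208) * t *
    t) * hσ
  · rw [dualForm]
    linear_combination ((-1185199610773187701037115 / 569087276546776228332032) +
    (285409615378082649178725 / 142271819136694057083008) * t) * ht + ((4676912601646515269579925
    / 4552698212374209826656256) + (-1155331436021161328419875 / 569087276546776228332032) * t +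
    (285409615378082649178725 / 284543638273388114166016) * t * t) * hσ
  · rw [dualForm]
    linear_combination ((-26047604513892024965979 / 71135909568347028541504) +
    (6296792543623061480385 / 17783977392086757135376) * t) * ht + ((102786652232150501355125 /
    569087276546776228332032) + (-25438956284418552015525 / 71135909568347028541504) * t +
    (6296792543623061480385 / 35567954784173514270752) * t * t) * hσ

/-- Two fine splines in the unit interval whose span has the orthogonality property required of
the third and fourth scaling generator. -/
theorem exists_inner_pair : ∃ w : Fin 2 → Spline,
    (∀ i, w i ∈ Submodule.span ℝ (Set.range fun j : Fin 6 => X 2 ((j : ℤ) + 2))) ∧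
    (∀ i, inner ℝ (X 1 2) (w i) = 0 ∧ inner ℝ (X 1 3) (w i) = 0) ∧
    (∀ i j : Fin 2, inner ℝ (w i) (w j) = inner ℝ (X 1 (j : ℤ)) (w i)) ∧
    inner ℝ (X 1 4) (w 0) = 35 / 1248 ∧ inner ℝ (X 1 5) (w 0) = -1 / 160 ∧
    inner ℝ (X 1 4) (w 1) = 1 / 160 ∧ inner ℝ (X 1 5) (w 1) = -1 / 720 := by
  obtain ⟨a, b, c, h1, h2, h3⟩ := exists_riccati
  have hm : ∀ x₀ x₁ y₀ y₁, dualComb x₀ x₁ y₀ y₁ ∈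
      Submodule.span ℝ (Set.range fun j : Fin 6 => X 2 ((j : ℤ) + 2)) := fun _ _ _ _ =>
    Submodule.smul_mem _ _ (Submodule.sum_mem _ fun j _ => Submodule.smul_mem _ _
      (Submodule.subset_span ⟨j, rfl⟩))
  have h2' : dualForm (b + 1 / 640) (c + 1 / 2880) (b - 1 / 640) (c - 1 / 2880)
      (a + 35 / 4992) (b + 1 / 640) (a - 35 / 4992) (b - 1 / 640) = 2 * b := by
    rw [← h2, dualForm, dualForm]
    ring
  -- The numbers `a, b, c` are a quarter of the pairings with `X 1 0` and `X 1 1`. The offsets are a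
  -- quarter, up to sign, of the prescribed pairings with `X 1 4` and `X 1 5`, for instance `35/4992
  -- = (35/1248)/4`.
  refine ⟨![dualComb (a + 35 / 4992) (b + 1 / 640) (a - 35 / 4992) (b - 1 / 640),
    dualComb (b + 1 / 640) (c + 1 / 2880) (b - 1 / 640) (c - 1 / 2880)], fun i => ?_, fun i => ?_,
    fun i j => ?_, ?_, ?_, ?_, ?_⟩
  · fin_cases i <;> exact hm _ _ _ _
  · fin_cases i <;> exact ⟨inner_X_two_dualComb _ _ _ _, inner_X_three_dualComb _ _ _ _⟩
  · fin_cases i <;> fin_cases j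
    · refine (inner_dualComb _ _ _ _ _ _ _ _).trans (Eq.trans ?_
        (inner_X_zero_dualComb _ _ _ _).symm)
      rw [h1]; ring
    · refine (inner_dualComb _ _ _ _ _ _ _ _).trans (Eq.trans ?_
        (inner_X_one_dualComb _ _ _ _).symm)
      rw [h2]; ring
    · refine (inner_dualComb _ _ _ _ _ _ _ _).trans (Eq.trans ?_
        (inner_X_zero_dualComb _ _ _ _).symm)
      rw [h2']; ring
    · refine (inner_dualComb _ _ _ _ _ _ _ _).trans (Eq.trans ?_
        (inner_X_one_dualComb _ _ _ _).symm)
      rw [h3]; ring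
  · refine (inner_X_four_dualComb _ _ _ _).trans ?_
    ring
  · refine (inner_X_five_dualComb _ _ _ _).trans ?_
    ring
  · refine (inner_X_four_dualComb _ _ _ _).trans ?_
    ring
  · refine (inner_X_five_dualComb _ _ _ _).trans ?_
    ring

end Spline

end CubicWavelet

end

/-! ### Existence of admissible data -/

noncomputable section

namespace CubicWavelet

open Spline

namespace Choice

/-- The two rows are independent because `X 1 2` and `X 1 3` are nonzero, mutually orthogonal, and
lie in the span of the six fine splines by the two-scale relations. -/
theorem exists_basisC : ∃ b : Fin 4 → Fin 6 → ℝ, IsNullBasis matC b := by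
  refine exists_isNullBasis_inner (r := fun i : Fin 2 => X 1 ((i : ℤ) + 2))
    (e := fun j : Fin 6 => X 2 ((j : ℤ) + 2)) rfl matC_apply fun a ha => ?_
  have hm : ∀ m, 2 ≤ m → m ≤ 7 → X 2 m ∈
      Submodule.span ℝ (Set.range fun j : Fin 6 => X 2 ((j : ℤ) + 2)) := fun m h1 h2 =>
    Submodule.subset_span ⟨⟨(m - 2).toNat, by omega⟩, by simp only; congr 1; omega⟩
  have h2 : X 1 2 ∈ Submodule.span ℝ (Set.range fun j : Fin 6 => X 2 ((j : ℤ) + 2)) := by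
    rw [X_even 1 2 rfl]
    refine Submodule.smul_mem _ _ (sub_mem (add_mem (add_mem (add_mem (Submodule.smul_mem _ _ ?_)
      ?_) (Submodule.smul_mem _ _ ?_)) (Submodule.smul_mem _ _ ?_)) (Submodule.smul_mem _ _ ?_)) <;>
    exact hm _ (by norm_num) (by norm_num)
  have h3 : X 1 3 ∈ Submodule.span ℝ (Set.range fun j : Fin 6 => X 2 ((j : ℤ) + 2)) := by
    rw [X_odd 1 3 rfl]
    refine Submodule.smul_mem _ _ (sub_mem (add_mem (sub_mem (add_mem (Submodule.smul_mem _ _ ?_)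
      (Submodule.smul_mem _ _ ?_)) (Submodule.smul_mem _ _ ?_)) (Submodule.smul_mem _ _ ?_))
      (Submodule.smul_mem _ _ ?_)) <;>
    exact hm _ (by norm_num) (by norm_num)
  have e : ∑ i : Fin 2, a i • X 1 ((i : ℤ) + 2) = a 0 • X 1 2 + a 1 • X 1 3 := by
    rw [Fin.sum_univ_two]; rfl
  rw [e] at ha
  have key : ∀ f ∈ Submodule.span ℝ (Set.range fun j : Fin 6 => X 2 ((j : ℤ) + 2)),
      inner ℝ f (a 0 • X 1 2 + a 1 • X 1 3) = 0 := fun f hf =>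
    inner_eq_zero_of_mem_span (by rintro _ ⟨j, rfl⟩; exact ha j) hf
  have k2 := key _ h2
  have k3 := key _ h3
  simp only [inner_add_right, real_inner_smul_right, inner_X] at k2 k3
  norm_num [gram] at k2 k3
  ext i
  fin_cases i
  exacts [k2, k3]

theorem norm_X_sq (m : ℤ) : ‖X 1 m‖ ^ 2 = gram m m := by
  rw [← real_inner_self_eq_norm_sq, inner_X]

/-- Sums of products of components along two orthonormal vectors, in terms of the projections. -/
theorem sum_inner_mul_inner {E : Type*} [NormedAddCommGroup E] [InnerProductSpace ℝ E]
    {f : Fin 2 → E} (hf : Orthonormal ℝ f) {w ξ η : E} (hw : w ∈ Submodule.span ℝ (Set.range f))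
    (hξ : ∀ m, inner ℝ (f m) w = inner ℝ (f m) ξ) :
    ∑ m, inner ℝ ξ (f m) * inner ℝ η (f m) = inner ℝ η w := by
  obtain ⟨c, rfl⟩ := (Submodule.mem_span_range_iff_exists_fun ℝ).1 hw
  have : ∀ m, inner ℝ ξ (f m) = c m := fun m => by
    rw [real_inner_comm, ← hξ m, hf.inner_right_fintype]
  simp only [this, inner_sum, real_inner_smul_right]

theorem linearIndependent_inner_pair {w : Fin 2 → Spline}
    (h04 : inner ℝ (X 1 4) (w 0) = (35 / 1248 : ℝ)) (h05 : inner ℝ (X 1 5) (w 0) = (-1 / 160 : ℝ))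
    (h14 : inner ℝ (X 1 4) (w 1) = (1 / 160 : ℝ)) (h15 : inner ℝ (X 1 5) (w 1) = (-1 / 720 : ℝ)) :
    LinearIndependent ℝ ![w 0, w 1] := by
  rw [LinearIndependent.pair_iff]
  intro a b hab
  have e4 := congrArg (inner ℝ (X 1 4)) hab
  have e5 := congrArg (inner ℝ (X 1 5)) hab
  simp only [inner_add_right, real_inner_smul_right, h04, h05, h14, h15, inner_zero_right] at e4 e5
  constructor <;> linarith

/-- In `exists_inner_pair`, `w i` is the projection of `X 1 i` to the span of `w 0` and `w 1`. Hence
an orthonormal basis of this plane contributes exactly the pairing of `X 1 k` with `w i` to the sum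
in the condition. The plane lies in the span of the `v_j`, and expanding its basis there gives the
coefficients. -/
theorem exists_s {bC : Fin 4 → Fin 6 → ℝ} (hC : IsNullBasis matC bC) :
    ∃ s : Fin 2 → Fin 4 → ℝ, ∀ bS bT, (⟨bC, s, bS, bT⟩ : Choice).ScalingAdmissible := by
  obtain ⟨w, hw1, hw2, hw3, h04, h05, h14, h15⟩ := exists_inner_pair
  obtain ⟨ho, hs⟩ := gramSchmidt_two (linearIndependent_inner_pair h04 h05 h14 h15)
  set f : Fin 2 → Spline := ![normE (w 0), normE (resE (w 1) ![normE (w 0)])] with hf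
  have hfs : Submodule.span ℝ (Set.range f) = Submodule.span ℝ {w 0, w 1} := by
    rw [← hs, hf, Matrix.range_cons, Matrix.range_cons, Matrix.range_empty, Set.union_empty]
    rfl
  -- The `v_j` depend on `bC` alone, so the other fields are placeholders.
  let Q : Choice := ⟨bC, 0, 0, 0⟩
  have hwW : ∀ i, w i ∈ Submodule.span ℝ (Set.range Q.eW) := fun i =>
    hC.mem_span (r := fun i : Fin 2 => X 1 ((i : ℤ) + 2)) matC_apply (hw1 i) fun k => by
      fin_cases k
      exacts [(hw2 i).1, (hw2 i).2]
  have hfV : ∀ i, f i ∈ Submodule.span ℝ (Set.range Q.eV) := fun i => by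
    rw [(gramSchmidt_eW (P := Q) hC.1).2]
    have : f i ∈ Submodule.span ℝ {w 0, w 1} := by
      rw [← hfs]; exact Submodule.subset_span ⟨i, rfl⟩
    refine Submodule.span_le.2 ?_ this
    rintro _ (rfl | rfl)
    exacts [hwW 0, hwW 1]
  choose s hsf using fun i => (Submodule.mem_span_range_iff_exists_fun ℝ).1 (hfV i)
  have hinner : ∀ i k, ∑ j, s i j * s k j = if i = k then 1 else 0 := fun i k => by
    rw [← inner_sum_eV (P := Q) hC.1, hsf, hsf]
    exact orthonormal_iff_ite.1 ho i k
  refine ⟨s, fun bS bT => ?_⟩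
  let P : Choice := ⟨bC, s, bS, bT⟩
  have hn : ∀ i, ∑ j, P.s i j ^ 2 = 1 := fun i => by
    simpa [pow_two] using hinner i i
  have h01 : ∑ j, P.s 0 j * P.s 1 j = 0 := by simpa using hinner 0 1
  have hP := orthonormal_ePhi (P := P) hC hn h01
  refine ⟨hC, hn, h01, fun i hi k hk => ?_⟩
  refine (ip_residual_cfun (P := P) hP (ePhi_suppIn hC.1) (by simpa using hi)
    (by simpa using hk)).trans ?_
  have e2 : P.ePhi 2 = f 0 := hsf 0
  have e3 : P.ePhi 3 = f 1 := hsf 1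
  have e0 : P.ePhi 0 = normE (X 1 2) := rfl
  have e1 : P.ePhi 1 = normE (X 1 3) := rfl
  have hwf : ∀ i, w i ∈ Submodule.span ℝ (Set.range f) := fun i => by
    rw [hfs]
    fin_cases i <;> exact Submodule.subset_span (by simp)
  have hproj : ∀ (i m : Fin 2), inner ℝ (f m) (w i) = inner ℝ (f m) (X 1 (i : ℤ)) := fun i m => by
    have : f m ∈ Submodule.span ℝ {w 0, w 1} := by
      rw [← hfs]; exact Submodule.subset_span ⟨m, rfl⟩
    have := inner_eq_zero_of_mem_span (g := w i - X 1 (i : ℤ)) (by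
      rintro _ (rfl | rfl) <;> rw [inner_sub_right, hw3, real_inner_comm, sub_self]) this
    rwa [inner_sub_right, sub_eq_zero] at this
  have hsum : ∀ (i : Fin 2) (η : Spline), inner ℝ (X 1 (i : ℤ)) (f 0) * inner ℝ η (f 0) +
      inner ℝ (X 1 (i : ℤ)) (f 1) * inner ℝ η (f 1) = inner ℝ η (w i) := fun i η => by
    rw [← sum_inner_mul_inner ho (hwf i) (hproj i), Fin.sum_univ_two]
  have hnorm : ∀ (a b m : ℤ), inner ℝ (X 1 a) (normE (X 1 m)) * inner ℝ (X 1 b) (normE (X 1 m)) =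
      (gram m m)⁻¹ * (gram a m * gram b m) := fun a b m => by
    rw [inner_normE_right, inner_normE_right, inner_X, inner_X, ← norm_X_sq]
    ring
  have key : ∀ (i : Fin 2) (k : ℤ), ∑ m, inner ℝ (X 1 (i : ℤ)) (P.ePhi m) *
      inner ℝ (X 1 k) (P.ePhi m) = (gram 2 2)⁻¹ * (gram i 2 * gram k 2) +
        (gram 3 3)⁻¹ * (gram i 3 * gram k 3) + inner ℝ (X 1 k) (w i) := fun i k => by
    rw [Fin.sum_univ_four, e0, e1, e2, e3, hnorm, hnorm, add_assoc _ (_ * _) (_ * _), hsum]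
  rw [neg_eq_zero]
  -- The values prescribed for the pairings with `w` are the negatives of the contributions of the
  -- first two generators.
  rcases hi with rfl | rfl <;> rcases hk with rfl | rfl
  · refine (key 0 4).trans ?_
    rw [h04]; norm_num [gram]
  · refine (key 0 5).trans ?_
    rw [h05]; norm_num [gram]
  · refine (key 1 4).trans ?_
    rw [h14]; norm_num [gram]
  · refine (key 1 5).trans ?_
    rw [h15]; norm_num [gram]

/-- The free data can be chosen as required. -/
theorem exists_admissible : ∃ P : Choice, P.Admissible := by
  obtain ⟨bC, hC⟩ := exists_basisC
  obtain ⟨s, hs⟩ := exists_s hC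
  -- The matrix `S` involves only `bC` and `s`, and `T` in addition only `bS`; zeros stand in for
  -- the data not yet chosen.
  obtain ⟨bS, hS⟩ := exists_basisS (hs 0 0).innerGenerators
  obtain ⟨bT, hT⟩ := exists_basisT (P := ⟨bC, s, bS, 0⟩) (hs bS 0).innerGenerators hS
  have h := hs bS bT
  exact ⟨⟨bC, s, bS, bT⟩, h.basisC, h.s_norm, h.s_orth, h.cond, hS, hT⟩

end Choice

end CubicWavelet

end

/-! ### Vanishing moments and density of the Hermite splines -/

noncomputable section

namespace CubicWavelet

namespace Spline

/-- The level-zero splines reproduce cubic polynomials on `[-1, 1]`. -/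
theorem exists_mem_V_zero_eq_cubic (a b c d : ℝ) : ∃ g ∈ V 0, ∀ x : ℝ, -1 ≤ x → x ≤ 1 →
    fn g x = a + b * x + c * x ^ 2 + d * x ^ 3 := by
  have hX : ∀ (m : ℤ) (x : ℝ), fn (X 0 m) x = fn (herm m) (x - ((m / 2 : ℤ) : ℝ)) := fun m x => by
    rw [X, dilationSystem.dil_zero, fn_tr]
  -- Hermite interpolation: the coefficients are the values and derivatives of the cubic at `-1`,
  -- `0`, `1`.
  refine ⟨(a - b + c - d) • X 0 (-2) + (b - 2 * c + 3 * d) • X 0 (-1) + a • X 0 0 + b • X 0 1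
    + (a + b + c + d) • X 0 2 + (b + 2 * c + 3 * d) • X 0 3, ?_, fun x h1 h2 => ?_⟩
  · have hm := fun m => X_mem_V 0 m
    exact add_mem (add_mem (add_mem (add_mem (add_mem (Submodule.smul_mem _ _ (hm _))
      (Submodule.smul_mem _ _ (hm _))) (Submodule.smul_mem _ _ (hm _)))
      (Submodule.smul_mem _ _ (hm _))) (Submodule.smul_mem _ _ (hm _)))
      (Submodule.smul_mem _ _ (hm _))
  · simp only [map_add, map_smul, Pi.add_apply, Pi.smul_apply, smul_eq_mul, hX, fn_herm]
    norm_num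
    rcases le_total x 0 with hx | hx
    · rw [hermite1_of_right (x + 1) (by linarith) (by linarith), hermite1_of_left x h1 hx,
        hermite1_of_le (x - 1) (by linarith), hermite2_of_right (x + 1) (by linarith) (by linarith),
        hermite2_of_left x h1 hx, hermite2_of_le (x - 1) (by linarith)]
      ring
    · rw [hermite1_of_ge (x + 1) (by linarith), hermite1_of_right x hx h2,
        hermite1_of_left (x - 1) (by linarith) (by linarith), hermite2_of_ge (x + 1) (by linarith),
        hermite2_of_right x hx h2, hermite2_of_left (x - 1) (by linarith) (by linarith)]
      ring

theorem integral_poly_mul_eq_zero {f : Spline} (hf : f ∈ SuppIn (-1) 1)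
    (hV : ∀ g ∈ V 0, inner ℝ g f = 0) {p : Polynomial ℝ} (hp : p.natDegree < 4) :
    ∫ x, p.eval x * fn f x = 0 := by
  obtain ⟨g, hg, hgx⟩ := exists_mem_V_zero_eq_cubic (p.coeff 0) (p.coeff 1) (p.coeff 2) (p.coeff 3)
  rw [← hV g hg, inner_eq, ip]
  congr 1
  ext x
  by_cases hx : x ∈ Set.Icc (-1 : ℝ) 1
  · rw [hgx x hx.1 hx.2, Polynomial.eval_eq_sum_range' hp]
    simp [Finset.sum_range_succ]
  · rw [Set.mem_Icc, not_and_or, not_le, not_le] at hx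
    rw [hf x hx, mul_zero, mul_zero]

/-- An affine change of variable moves the dilation and translation to the polynomial, whose degree
stays below four. -/
theorem integral_poly_mul_dil_tr_eq_zero {f : Spline} (hf : f ∈ SuppIn (-1) 1)
    (hV : ∀ g ∈ V 0, inner ℝ g f = 0) {p : Polynomial ℝ} (hp : p.natDegree < 4) (j n : ℤ) :
    ∫ x, p.eval x * fn (dil j (tr n f)) x = 0 := by
  have ha : (0 : ℝ) < 2 ^ j := by positivity
  set q := p.comp (Polynomial.C ((2 : ℝ) ^ j)⁻¹ * Polynomial.X +
    Polynomial.C (((2 : ℝ) ^ j)⁻¹ * n)) with hq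
  have hqd : q.natDegree < 4 := by
    refine lt_of_le_of_lt Polynomial.natDegree_comp_le ?_
    exact lt_of_le_of_lt (Nat.mul_le_mul le_rfl Polynomial.natDegree_linear_le) (by omega)
  have h0 := integral_poly_mul_eq_zero hf hV hqd
  have e : ∀ x : ℝ, p.eval x * fn (dil j (tr n f)) x = (fun y : ℝ => (2 : ℝ) ^ ((j : ℝ) / 2) *
      (q.eval (y - n) * fn f (y - n))) (2 ^ j * x) := fun x => by
    have : q.eval ((2 : ℝ) ^ j * x - n) = p.eval x := by
      rw [hq]
      simp only [Polynomial.eval_comp, Polynomial.eval_add, Polynomial.eval_mul,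
        Polynomial.eval_C, Polynomial.eval_X]
      congr 1
      field_simp
      ring
    simp only [this, fn_dil, fn_tr]
    ring
  simp only [e]
  rw [Measure.integral_comp_mul_left (fun y : ℝ => (2 : ℝ) ^ ((j : ℝ) / 2) *
      (q.eval (y - n) * fn f (y - n))), integral_const_mul,
    integral_sub_right_eq_self (fun y => q.eval y * fn f y), h0, mul_zero, smul_zero]

end Spline

open Spline

theorem hermite1_nonneg (x : ℝ) : 0 ≤ hermite1 x := by
  rcases le_total x (-1) with h1 | h1
  · rw [hermite1_of_le x h1]
  rcases le_total x 0 with h2 | h2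
  · rw [hermite1_of_left x h1 h2]
    exact mul_nonneg (sq_nonneg _) (by linarith)
  rcases le_total x 1 with h3 | h3
  · rw [hermite1_of_right x h2 h3]
    exact mul_nonneg (sq_nonneg _) (by linarith)
  · rw [hermite1_of_ge x h3]

theorem hermite1_add_sub_one {x : ℝ} (h0 : 0 ≤ x) (h1 : x ≤ 1) :
    hermite1 x + hermite1 (x - 1) = 1 := by
  rw [hermite1_of_right x h0 h1, hermite1_of_left (x - 1) (by linarith) (by linarith)]
  ring

/-- Interpolation of `f` by the first Hermite generator at the points `k / 2^j`, `|k| ≤ K`. -/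
def interp (f : ℝ → ℝ) (j K : ℕ) (x : ℝ) : ℝ :=
  ∑ k ∈ Finset.Icc (-(K : ℤ)) K, f (k / 2 ^ j) * hermite1 (2 ^ j * x - k)

/-- Only the two nodes next to `x` contribute; nodes outside the finite range carry the value zero
of `f`. -/
theorem interp_eq {f : ℝ → ℝ} {j K : ℕ} (hf : ∀ x : ℝ, (K : ℝ) / 2 ^ j < |x| → f x = 0) (x : ℝ) :
    interp f j K x = f (⌊2 ^ j * x⌋ / 2 ^ j) * hermite1 (2 ^ j * x - ⌊2 ^ j * x⌋) +
      f ((⌊2 ^ j * x⌋ + 1) / 2 ^ j) * hermite1 (2 ^ j * x - ⌊2 ^ j * x⌋ - 1) := by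
  set n := ⌊(2 : ℝ) ^ j * x⌋ with hn
  have h1 : (n : ℝ) ≤ 2 ^ j * x := Int.floor_le _
  have h2 : (2 : ℝ) ^ j * x < n + 1 := Int.lt_floor_add_one _
  have hz : ∀ k : ℤ, k ∉ ({n, n + 1} : Finset ℤ) →
      f (k / 2 ^ j) * hermite1 (2 ^ j * x - k) = 0 := fun k hk => by
    simp only [Finset.mem_insert, Finset.mem_singleton, not_or] at hk
    rcases (by omega : k ≤ n - 1 ∨ n + 2 ≤ k) with h | h
    · have : (k : ℝ) ≤ n - 1 := by exact_mod_cast h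
      rw [hermite1_of_ge _ (by linarith), mul_zero]
    · have : (n : ℝ) + 2 ≤ k := by exact_mod_cast h
      rw [hermite1_of_le _ (by linarith), mul_zero]
  have hz' : ∀ k : ℤ, k ∉ Finset.Icc (-(K : ℤ)) K →
      f (k / 2 ^ j) * hermite1 (2 ^ j * x - k) = 0 := fun k hk => by
    rw [Finset.mem_Icc, ← abs_le, not_le] at hk
    rw [hf, zero_mul]
    have : (K : ℝ) < |(k : ℝ)| := by exact_mod_cast hk
    rw [abs_div, abs_of_pos (by positivity : (0 : ℝ) < 2 ^ j)]
    gcongr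
  have e : interp f j K x = ∑ k ∈ ({n, n + 1} : Finset ℤ),
      f (k / 2 ^ j) * hermite1 (2 ^ j * x - k) := by
    rw [interp, Finset.sum_subset (Finset.subset_union_left (s₂ := {n, n + 1})) fun k _ h => hz' k h,
      ← Finset.sum_subset (Finset.subset_union_right (s₁ := Finset.Icc (-(K : ℤ)) K))
        fun k _ h => hz k h]
  rw [e, Finset.sum_pair (by omega)]
  push_cast
  rw [sub_sub]

theorem continuous_hermite1 : Continuous hermite1 := hermite1_mem.1.continuous

/-- The weights at the two neighbouring nodes are nonnegative and add up to one. The same convexity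
gives pointwise convergence in `tendsto_interp`. -/
theorem abs_interp_le {f : ℝ → ℝ} {j K : ℕ} (hf : ∀ x : ℝ, (K : ℝ) / 2 ^ j < |x| → f x = 0)
    {M : ℝ} (hM : ∀ x, |f x| ≤ M) (x : ℝ) : |interp f j K x| ≤ M := by
  rw [interp_eq hf]
  have h1 := Int.floor_le ((2 : ℝ) ^ j * x)
  have h2 := Int.lt_floor_add_one ((2 : ℝ) ^ j * x)
  have hs := hermite1_add_sub_one (x := 2 ^ j * x - ⌊2 ^ j * x⌋) (by linarith) (by linarith)
  set y := (2 : ℝ) ^ j * x - ⌊2 ^ j * x⌋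
  calc _ ≤ |f (⌊2 ^ j * x⌋ / 2 ^ j) * hermite1 y| + |f ((⌊2 ^ j * x⌋ + 1) / 2 ^ j) * hermite1 (y - 1)| :=
        abs_add_le _ _
    _ ≤ M * hermite1 y + M * hermite1 (y - 1) := by
        rw [abs_mul, abs_mul, abs_of_nonneg (hermite1_nonneg _), abs_of_nonneg (hermite1_nonneg _)]
        exact add_le_add (mul_le_mul_of_nonneg_right (hM _) (hermite1_nonneg _))
          (mul_le_mul_of_nonneg_right (hM _) (hermite1_nonneg _))
    _ = M := by rw [← mul_add, hs, mul_one]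

open Filter Topology in
theorem tendsto_interp {f : ℝ → ℝ} (hc : Continuous f) {K : ℕ → ℕ}
    (hf : ∀ (j : ℕ) (x : ℝ), (K j : ℝ) / 2 ^ j < |x| → f x = 0) (x : ℝ) :
    Tendsto (fun j => interp f j (K j) x) atTop (𝓝 (f x)) := by
  have hpow : Tendsto (fun j : ℕ => ((1 : ℝ) / 2) ^ j) atTop (𝓝 0) :=
    tendsto_pow_atTop_nhds_zero_of_lt_one (by norm_num) (by norm_num)
  have hinv : ∀ j : ℕ, ((1 : ℝ) / 2) ^ j = 1 / 2 ^ j := fun j => by rw [div_pow, one_pow]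
  have ha : Tendsto (fun j : ℕ => (⌊(2 : ℝ) ^ j * x⌋ : ℝ) / 2 ^ j) atTop (𝓝 x) := by
    rw [tendsto_iff_dist_tendsto_zero]
    refine squeeze_zero (fun _ => dist_nonneg) (fun j => ?_) hpow
    have h0 : (0 : ℝ) < 2 ^ j := by positivity
    have h1 := Int.floor_le ((2 : ℝ) ^ j * x)
    have h2 := Int.lt_floor_add_one ((2 : ℝ) ^ j * x)
    rw [Real.dist_eq, hinv, abs_le, div_sub' h0.ne', le_div_iff₀ h0, div_le_div_iff_of_pos_right h0,
      neg_mul, div_mul_cancel₀ _ h0.ne']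
    constructor <;> linarith
  have hb : Tendsto (fun j : ℕ => ((⌊(2 : ℝ) ^ j * x⌋ : ℝ) + 1) / 2 ^ j) atTop (𝓝 x) := by
    have := ha.add hpow
    rw [add_zero] at this
    refine this.congr fun j => ?_
    rw [hinv, add_div]
  have hA := (hc.tendsto x).comp ha
  have hB := (hc.tendsto x).comp hb
  rw [tendsto_iff_dist_tendsto_zero] at hA hB ⊢
  refine squeeze_zero (fun _ => dist_nonneg) (fun j => ?_) (by simpa using hA.add hB)
  rw [interp_eq (hf j), Real.dist_eq, Real.dist_eq, Real.dist_eq]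
  have h1 := Int.floor_le ((2 : ℝ) ^ j * x)
  have h2 := Int.lt_floor_add_one ((2 : ℝ) ^ j * x)
  have hs := hermite1_add_sub_one (x := 2 ^ j * x - ⌊2 ^ j * x⌋) (by linarith) (by linarith)
  set y := (2 : ℝ) ^ j * x - ⌊2 ^ j * x⌋
  set a := f (⌊2 ^ j * x⌋ / 2 ^ j)
  set b := f ((⌊2 ^ j * x⌋ + 1) / 2 ^ j)
  have p1 := hermite1_nonneg y
  have p2 := hermite1_nonneg (y - 1)
  calc _ = |(a - f x) * hermite1 y + (b - f x) * hermite1 (y - 1)| := by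
        congr 1
        linear_combination f x * hs
    _ ≤ |(a - f x) * hermite1 y| + |(b - f x) * hermite1 (y - 1)| := abs_add_le _ _
    _ = |a - f x| * hermite1 y + |b - f x| * hermite1 (y - 1) := by
        rw [abs_mul, abs_mul, abs_of_nonneg p1, abs_of_nonneg p2]
    _ ≤ |a - f x| * 1 + |b - f x| * 1 :=
        add_le_add (mul_le_mul_of_nonneg_left (by linarith) (abs_nonneg _))
          (mul_le_mul_of_nonneg_left (by linarith) (abs_nonneg _))
    _ = _ := by ring

open Filter Topology in
/-- A locally integrable function orthogonal to all splines of the first Hermite generator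
vanishes. -/
theorem ae_eq_zero_of_forall_integral_hermite1 {g : ℝ → ℝ} (hg : LocallyIntegrable g volume)
    (h : ∀ (j : ℕ) (k : ℤ), ∫ x, hermite1 (2 ^ (j + 1) * x - k) * g x = 0) : g =ᵐ[volume] 0 := by
  refine ae_eq_zero_of_integral_contDiff_smul_eq_zero hg fun f hf hfc => ?_
  obtain ⟨M, hM⟩ := hfc.exists_bound_of_continuous hf.continuous
  obtain ⟨R, hR⟩ := hfc.isCompact.isBounded.subset_closedBall (0 : ℝ)
  obtain ⟨N, hN⟩ := exists_nat_ge R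
  have hf0 : ∀ x : ℝ, (N : ℝ) < |x| → f x = 0 := fun x hx => by
    by_contra hne
    have := hR (subset_tsupport _ hne)
    rw [Metric.mem_closedBall, dist_zero_right, Real.norm_eq_abs] at this
    linarith
  let K : ℕ → ℕ := fun j => N * 2 ^ j
  have hK : ∀ (j : ℕ) (x : ℝ), (K j : ℝ) / 2 ^ j < |x| → f x = 0 := fun j x hx => by
    refine hf0 x ?_
    have : (K j : ℝ) / 2 ^ j = N := by
      simp only [K]; push_cast; field_simp
    rwa [this] at hx
  have hint : ∀ (j : ℕ) (k : ℤ), Integrable (fun x => hermite1 (2 ^ j * x - k) * g x) volume := by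
    intro j k
    have hs : HasCompactSupport fun x : ℝ => hermite1 (2 ^ j * x - k) :=
      hermite1_mem.2.1.comp_homeomorph
        ((Homeomorph.mulLeft₀ ((2 : ℝ) ^ j) (by positivity)).trans (Homeomorph.subRight (k : ℝ)))
    have hc : Continuous fun x : ℝ => hermite1 (2 ^ j * x - k) := by
      have := continuous_hermite1
      fun_prop
    exact hg.integrable_smul_left_of_hasCompactSupport hc hs
  have hzero : ∀ j : ℕ, ∫ x, interp f (j + 1) (K (j + 1)) x * g x = 0 := fun j => by
    have : ∀ x, interp f (j + 1) (K (j + 1)) x * g x =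
        ∑ k ∈ Finset.Icc (-(K (j + 1) : ℤ)) (K (j + 1)), f (k / 2 ^ (j + 1)) *
          (hermite1 (2 ^ (j + 1) * x - k) * g x) := fun x => by
      rw [interp, Finset.sum_mul]
      exact Finset.sum_congr rfl fun k _ => mul_assoc _ _ _
    simp only [this]
    rw [integral_finsetSum _ fun k _ => (hint (j + 1) k).const_mul _]
    refine Finset.sum_eq_zero fun k _ => ?_
    rw [integral_const_mul, h, mul_zero]
  -- The interpolants are bounded by `M` and vanish outside `[-N - 1, N + 1]`, since a dilated
  -- Hermite function reaches at most one unit beyond its node. There `g` is integrable, which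
  -- provides the dominating function.
  have hlim := tendsto_integral_of_dominated_convergence
    (μ := volume) (F := fun (j : ℕ) x => interp f (j + 1) (K (j + 1)) x * g x)
    (f := fun x => f x * g x)
    (fun x => (Set.Icc (-(N + 1 : ℝ)) (N + 1)).indicator (fun x => M * ‖g x‖) x)
    (fun j => ?_) ?_ (fun j => ae_of_all _ fun x => ?_) (ae_of_all _ fun x => ?_)
  · simp only [hzero] at hlim
    simpa using (tendsto_nhds_unique hlim tendsto_const_nhds)
  · refine AEStronglyMeasurable.mul (Continuous.aestronglyMeasurable ?_) hg.aestronglyMeasurable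
    unfold interp
    have := continuous_hermite1
    fun_prop
  · rw [integrable_indicator_iff measurableSet_Icc]
    exact ((hg.integrableOn_isCompact isCompact_Icc).norm.const_mul M)
  · have hle := abs_interp_le (hK (j + 1)) (fun x => by simpa using hM x) x
    by_cases hx : x ∈ Set.Icc (-(N + 1 : ℝ)) (N + 1)
    · rw [Set.indicator_of_mem hx, norm_mul]
      exact mul_le_mul_of_nonneg_right hle (norm_nonneg _)
    · rw [Set.indicator_of_notMem hx, interp, Finset.sum_eq_zero, zero_mul, norm_zero]
      intro k hk
      have h2 : (1 : ℝ) ≤ 2 ^ (j + 1) := one_le_pow₀ (by norm_num)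
      rw [Finset.mem_Icc] at hk
      have k1 : -((N : ℝ) * 2 ^ (j + 1)) ≤ k := by exact_mod_cast hk.1
      have k2 : (k : ℝ) ≤ (N : ℝ) * 2 ^ (j + 1) := by exact_mod_cast hk.2
      rw [Set.mem_Icc, not_and_or, not_le, not_le] at hx
      rcases hx with hx | hx
      · rw [hermite1_of_le _ (by nlinarith), mul_zero]
      · rw [hermite1_of_ge _ (by nlinarith), mul_zero]
  · exact ((tendsto_interp hf.continuous hK x).comp (tendsto_add_atTop_nat 1)).mul_const _

end CubicWavelet

end

/-! ### Passage to L² and the Hilbert basis -/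

noncomputable section

namespace CubicWavelet

namespace Spline

/-- The class in `L²(ℝ)` of a spline. -/
def toL2 : Spline →ₗ[ℝ] Lp ℝ 2 (volume : Measure ℝ) where
  toFun f := f.memLp.toLp (fn f)
  map_add' f g := by
    rw [← MemLp.toLp_add]
    congr 1
  map_smul' c f := by
    rw [RingHom.id_apply, ← MemLp.toLp_const_smul]
    congr 1

theorem coeFn_toL2 (f : Spline) : (toL2 f : ℝ → ℝ) =ᵐ[volume] fn f := f.memLp.coeFn_toLp

theorem inner_toL2_right (g : Lp ℝ 2 (volume : Measure ℝ)) (f : Spline) :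
    inner ℝ g (toL2 f) = ∫ x, fn f x * g x := by
  rw [L2.inner_def]
  refine integral_congr_ae ?_
  filter_upwards [coeFn_toL2 f] with x hx
  simp [hx]

theorem inner_toL2 (f g : Spline) : inner ℝ (toL2 f) (toL2 g) = inner ℝ f g := by
  rw [inner_toL2_right, real_inner_comm, inner_eq, ip]
  refine integral_congr_ae ?_
  filter_upwards [coeFn_toL2 f] with x hx
  rw [hx]

/-- The spline spaces are dense in `L²(ℝ)`. -/
theorem eq_zero_of_forall_inner_X {g : Lp ℝ 2 (volume : Measure ℝ)}
    (h : ∀ (j : ℕ) (m : ℤ), inner ℝ g (toL2 (X (j + 1) m)) = 0) : g = 0 := by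
  rw [Lp.eq_zero_iff_ae_eq_zero]
  refine ae_eq_zero_of_forall_integral_hermite1 ((Lp.memLp g).locallyIntegrable (by norm_num))
    fun j k => ?_
  have := h j (2 * k)
  rw [inner_toL2_right, fn_X] at this
  have hc : (0 : ℝ) < (2 : ℝ) ^ ((((j : ℤ) + 1 : ℤ) : ℝ) / 2) := by positivity
  have e : ∀ x, xi ((j : ℤ) + 1) (2 * k) x * g x = (2 : ℝ) ^ ((((j : ℤ) + 1 : ℤ) : ℝ) / 2) *
      (hermite1 (2 ^ (j + 1) * x - k) * g x) := fun x => by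
    rw [xi, if_pos (by omega), show 2 * k / 2 = k by omega, mul_assoc]
    norm_cast
  simp only [e] at this
  rw [integral_const_mul] at this
  exact (mul_eq_zero.1 this).resolve_left hc.ne'

end Spline

open Spline

namespace Choice

namespace Admissible

variable {P : Choice} (h : P.Admissible)
include h

theorem innerGenerators : InnerGenerators P.ePhi := h.scaling.innerGenerators

theorem waveletSystem : WaveletSystem tr dil P.eGen P.ePsi :=
  Choice.waveletSystem h.innerGenerators h.basisS h.basisT

theorem fn_scaling (j m : ℤ) :
    fn (dil j (tr (shiftOf 4 m) (P.eGen (genOf m)))) = P.scaling j m :=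
  fn_dil_tr (fn_eGen h.innerGenerators) 4 j m

theorem fn_wavelet (j m : ℤ) :
    fn (dil j (tr (shiftOf 2 m) (P.ePsi (genOf m)))) = P.wavelet j m :=
  fn_dil_tr (fn_ePsi h.innerGenerators) 2 j m

theorem ip_scaling_scaling (i k l : ℤ) :
    ip (P.scaling i k) (P.scaling i l) = if k = l then 1 else 0 := by
  rw [← h.fn_scaling, ← h.fn_scaling, ← inner_eq, LinearIsometry.inner_map_map,
    h.waveletSystem.inner_tr_tr]
  exact if_congr (and_comm.trans shiftOf_genOf_inj) rfl rfl

theorem ip_wavelet_wavelet (i j k l : ℤ) :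
    ip (P.wavelet i k) (P.wavelet j l) = if i = j ∧ k = l then 1 else 0 := by
  rw [← h.fn_wavelet, ← h.fn_wavelet, ← inner_eq, h.waveletSystem.inner_dil_wav_wav]
  exact if_congr (and_congr_right fun _ => shiftOf_genOf_inj) rfl rfl

theorem ip_scaling_wavelet (i j k l : ℤ) (hij : i ≤ j) :
    ip (P.scaling i k) (P.wavelet j l) = 0 := by
  rw [← h.fn_scaling, ← h.fn_wavelet, ← inner_eq]
  exact h.waveletSystem.inner_level_wav
    (h.waveletSystem.level_mono hij (dil_tr_mem_level i _ _))

theorem ip_phi_phi (i j : Fin 6) : ip (P.phi i) (P.phi j) = if i = j then 1 else 0 := by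
  rw [← fn_eGen h.innerGenerators, ← fn_eGen h.innerGenerators, ← inner_eq]
  exact orthonormal_iff_ite.1 (orthonormal_eGen h.innerGenerators) i j

theorem ip_psi_psi (i j : Fin 6) : ip (P.psi i) (P.psi j) = if i = j then 1 else 0 := by
  have := h.waveletSystem.wav_wav 0 i j
  rw [dilationSystem.tr_zero] at this
  rw [← fn_ePsi h.innerGenerators, ← fn_ePsi h.innerGenerators, ← inner_eq, this]
  simp

theorem ip_phi_psi (i j : Fin 6) : ip (P.phi i) (P.psi j) = 0 := by
  have := h.waveletSystem.scal_wav 0 i j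
  rwa [dilationSystem.tr_zero, inner_eq, fn_eGen h.innerGenerators, fn_ePsi h.innerGenerators]
    at this

theorem eGen_suppIn (i : Fin 6) : P.eGen i ∈ SuppIn (-1) 1 := h.innerGenerators.gens_suppIn i

theorem fine_suppIn (s : ℤ × Fin 6) (h1 : -3 ≤ pos s) (h2 : pos s ≤ 3) :
    fine tr dil P.eGen s ∈ SuppIn (-1) 1 := by
  obtain ⟨n, i⟩ := s
  simp only [pos] at h1 h2
  by_cases hi : (i : ℕ) < 4
  · rw [if_pos hi] at h1 h2
    have n1 : (-2 : ℝ) ≤ n := by exact_mod_cast (by omega : -2 ≤ n)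
    have n2 : (n : ℝ) ≤ 1 := by exact_mod_cast (by omega : n ≤ 1)
    refine SuppIn.mono ?_ ?_ (SuppIn.dil (SuppIn.tr
      (h.innerGenerators.gens_inner_suppIn hi) n) 1) <;> norm_num <;> linarith
  · rw [if_neg hi] at h1 h2
    have n1 : (-1 : ℝ) ≤ n := by exact_mod_cast (by omega : -1 ≤ n)
    have n2 : (n : ℝ) ≤ 1 := by exact_mod_cast (by omega : n ≤ 1)
    refine SuppIn.mono ?_ ?_ (SuppIn.dil (SuppIn.tr (h.eGen_suppIn i) n) 1) <;>
      norm_num <;> linarith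

theorem ePsi_suppIn (i : Fin 6) : P.ePsi i ∈ SuppIn (-1) 1 := by
  refine mem_of_mem_span ?_ (h.waveletSystem.mem_band_wav i)
  rintro _ ⟨s, hs, rfl⟩
  exact h.fine_suppIn s hs.1 hs.2

theorem ediam_tsupport_scaling (k : ℤ) : Metric.ediam (tsupport (P.scaling 0 k)) ≤ 2 := by
  rw [← h.fn_scaling, dilationSystem.dil_zero]
  refine (SuppIn.ediam_tsupport_le (SuppIn.tr (h.eGen_suppIn _) _)).trans ?_
  rw [show (1 : ℝ) + (shiftOf 4 k : ℝ) - (-1 + (shiftOf 4 k : ℝ)) = 2 by ring]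
  simp

theorem ediam_tsupport_wavelet (j k : ℤ) :
    Metric.ediam (tsupport (P.wavelet j k)) ≤ ENNReal.ofReal ((2 : ℝ) ^ (1 - j)) := by
  rw [← h.fn_wavelet]
  refine (SuppIn.ediam_tsupport_le (SuppIn.dil (SuppIn.tr (h.ePsi_suppIn _) _) j)).trans ?_
  refine (congrArg ENNReal.ofReal ?_).le
  rw [zpow_sub₀ two_ne_zero, zpow_one]
  ring

/-- The inclusions `V 0 ≤ V 1 ≤ level 0` put the local cubics inside the scaling space, to which the
wavelet generators are orthogonal. -/
theorem inner_V_zero_psi (i : Fin 6) {g : Spline} (hg : g ∈ V 0) : inner ℝ g (P.ePsi i) = 0 := by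
  have hV : V 1 ≤ level tr dil P.eGen 0 := by
    refine Submodule.span_le.2 ?_
    rintro _ ⟨m, rfl⟩
    exact h.innerGenerators.X_mem_level 0 m
  have := h.waveletSystem.inner_level_wav (n := 0) (b := i) (hV (V_le_succ 0 hg))
  rwa [dilationSystem.dil_zero, dilationSystem.tr_zero] at this

theorem moments (j k : ℤ) (p : Polynomial ℝ) (hp : p.degree < 4) :
    Integrable (fun x => p.eval x * P.wavelet j k x) volume ∧
      ∫ x, p.eval x * P.wavelet j k x = 0 := by
  have hp' : p.natDegree < 4 := by
    rcases eq_or_ne p 0 with rfl | h0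
    · simp
    · exact (Polynomial.natDegree_lt_iff_degree_lt h0).2 hp
  rw [← h.fn_wavelet]
  exact ⟨integrable_mul _ p.continuous, integral_poly_mul_dil_tr_eq_zero (h.ePsi_suppIn _)
    (fun g hg => h.inner_V_zero_psi _ hg) hp' j _⟩

/-- The wavelet basis. -/
theorem exists_hilbertBasis :
    ∃ b : HilbertBasis (ℤ ⊕ (ℕ × ℤ)) ℝ (Lp ℝ 2 (volume : Measure ℝ)),
      (∀ k : ℤ, (b (Sum.inl k) : ℝ → ℝ) =ᵐ[volume] P.scaling 0 k) ∧
      ∀ (j : ℕ) (k : ℤ), (b (Sum.inr (j, k)) : ℝ → ℝ) =ᵐ[volume] P.wavelet (j : ℤ) k := by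
  have hW := h.waveletSystem
  let S : ℤ → Spline := fun k => dil 0 (tr (shiftOf 4 k) (P.eGen (genOf k)))
  let T : ℕ × ℤ → Spline := fun s => dil s.1 (tr (shiftOf 2 s.2) (P.ePsi (genOf s.2)))
  let v : ℤ ⊕ (ℕ × ℤ) → Lp ℝ 2 (volume : Measure ℝ) := fun s => toL2 (Sum.elim S T s)
  have hv : Orthonormal ℝ v := by
    rw [orthonormal_iff_ite]
    rintro (k | ⟨i, k⟩) (l | ⟨j, l⟩) <;> simp only [v, Sum.elim_inl, Sum.elim_inr, inner_toL2]
    · rw [inner_eq, h.fn_scaling, h.fn_scaling, h.ip_scaling_scaling]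
      simp
    · rw [inner_eq, h.fn_scaling, h.fn_wavelet, h.ip_scaling_wavelet _ _ _ _ (by positivity)]
      simp
    · rw [real_inner_comm, inner_eq, h.fn_scaling, h.fn_wavelet,
        h.ip_scaling_wavelet _ _ _ _ (by positivity)]
      simp
    · rw [inner_eq, h.fn_wavelet, h.fn_wavelet, h.ip_wavelet_wavelet]
      simp
  have hsp : (Submodule.span ℝ (Set.range v))ᗮ = ⊥ := by
    rw [Submodule.eq_bot_iff]
    intro g hg
    have hz : ∀ s, inner ℝ g (v s) = 0 := fun s =>
      (Submodule.mem_orthogonal' _ _).1 hg _ (Submodule.subset_span ⟨s, rfl⟩)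
    -- `K` consists of the splines orthogonal to `g`. It contains the scaling functions of level
    -- zero and all wavelets of nonnegative level, hence every finer scaling level and with it all
    -- `X (j + 1) m`; density then gives `g = 0`.
    let K : Submodule ℝ Spline := ((Submodule.span ℝ {g})ᗮ).comap toL2
    have hK : ∀ f, f ∈ K ↔ inner ℝ g (toL2 f) = 0 := fun f => by
      rw [Submodule.mem_comap, Submodule.mem_orthogonal_singleton_iff_inner_right]
    have h0 : level tr dil P.eGen 0 ≤ K := by
      refine Submodule.span_le.2 ?_
      rintro _ ⟨⟨n, i⟩, rfl⟩
      obtain ⟨m, rfl, rfl⟩ := exists_index 4 n i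
      exact (hK _).2 (hz (Sum.inl m))
    have h1 : ∀ j : ℕ, level tr dil P.ePsi j ≤ K := fun j => by
      refine Submodule.span_le.2 ?_
      rintro _ ⟨⟨n, i⟩, rfl⟩
      obtain ⟨m, rfl, rfl⟩ := exists_index 2 n i
      exact (hK _).2 (hz (Sum.inr (j, m)))
    exact eq_zero_of_forall_inner_X fun j m =>
      (hK _).1 (hW.level_le_of_le h0 h1 j (h.innerGenerators.X_mem_level j m))
  refine ⟨HilbertBasis.mkOfOrthogonalEqBot hv hsp, fun k => ?_, fun j k => ?_⟩
  · rw [HilbertBasis.coe_mkOfOrthogonalEqBot, ← h.fn_scaling]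
    exact coeFn_toL2 _
  · rw [HilbertBasis.coe_mkOfOrthogonalEqBot, ← h.fn_wavelet]
    exact coeFn_toL2 _

end Admissible

end Choice

end CubicWavelet

end

theorem mainTheorem5 :
    -- the free data of the construction can be chosen as required
    (∃ P : CubicWavelet.Choice, P.Admissible) ∧
    -- and each such choice has the following properties
    ∀ P : CubicWavelet.Choice, P.Admissible →
      -- a) cubic splines of class C¹
      ((∀ i : Fin 6, CubicWavelet.IsCubicSpline (P.psi i) ∧ ContDiff ℝ 1 (P.psi i)) ∧
        ∀ j k : ℤ, CubicWavelet.IsCubicSpline (P.wavelet j k) ∧ ContDiff ℝ 1 (P.wavelet j k)) ∧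
      -- all scaling functions and wavelets are square integrable
      (∀ j k : ℤ, MemLp (P.scaling j k) 2 volume ∧ MemLp (P.wavelet j k) 2 volume) ∧
      -- b) orthogonality of the generators
      (∀ i j : Fin 6,
        CubicWavelet.ip (P.phi i) (P.phi j) = (if i = j then 1 else 0) ∧
        CubicWavelet.ip (P.psi i) (P.psi j) = (if i = j then 1 else 0) ∧
        CubicWavelet.ip (P.phi i) (P.psi j) = 0) ∧
      -- c) orthogonality of the scaling functions and wavelets
      ((∀ i k l : ℤ,
          CubicWavelet.ip (P.scaling i k) (P.scaling i l) = (if k = l then 1 else 0)) ∧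
        (∀ i j k l : ℤ,
          CubicWavelet.ip (P.wavelet i k) (P.wavelet j l) = (if i = j ∧ k = l then 1 else 0)) ∧
        ∀ i j k l : ℤ, i ≤ j → CubicWavelet.ip (P.scaling i k) (P.wavelet j l) = 0) ∧
      -- d) four vanishing moments
      (∀ (j k : ℤ) (p : Polynomial ℝ), p.degree < 4 →
        Integrable (fun x => p.eval x * P.wavelet j k x) volume ∧
          ∫ x, p.eval x * P.wavelet j k x = 0) ∧
      -- e) orthonormal (Hilbert) basis of L²(ℝ)
      (∃ b : HilbertBasis (ℤ ⊕ (ℕ × ℤ)) ℝ (Lp ℝ 2 (volume : Measure ℝ)),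
        (∀ k : ℤ, (b (Sum.inl k) : ℝ → ℝ) =ᵐ[volume] P.scaling 0 k) ∧
        ∀ (j : ℕ) (k : ℤ), (b (Sum.inr (j, k)) : ℝ → ℝ) =ᵐ[volume] P.wavelet (j : ℤ) k) ∧
      -- f) diameters of the supports
      ((∀ k : ℤ, Metric.ediam (tsupport (P.scaling 0 k)) ≤ 2) ∧
        ∀ j k : ℤ, Metric.ediam (tsupport (P.wavelet j k)) ≤
          ENNReal.ofReal ((2 : ℝ) ^ (1 - j))) := by
  refine ⟨CubicWavelet.Choice.exists_admissible, fun P h => ⟨⟨fun i => ?_, fun j k => ?_⟩,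
    fun j k => ?_, fun i j => ⟨h.ip_phi_phi i j, h.ip_psi_psi i j, h.ip_phi_psi i j⟩,
    ⟨h.ip_scaling_scaling, h.ip_wavelet_wavelet, h.ip_scaling_wavelet⟩, h.moments,
    h.exists_hilbertBasis, h.ediam_tsupport_scaling, h.ediam_tsupport_wavelet⟩⟩
  · rw [← CubicWavelet.Choice.fn_ePsi h.innerGenerators]
    exact ⟨CubicWavelet.Spline.isCubicSpline _, CubicWavelet.Spline.contDiff _⟩
  · rw [← h.fn_wavelet]
    exact ⟨CubicWavelet.Spline.isCubicSpline _, CubicWavelet.Spline.contDiff _⟩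
  · rw [← h.fn_scaling, ← h.fn_wavelet]
    exact ⟨CubicWavelet.Spline.memLp _, CubicWavelet.Spline.memLp _⟩
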